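/- **Setting.** Let $d\ge 2$, let $e_1$ be the first vector of the canonical basis of $\mathbb R^d$, and $\mathcal S_0(x)=x-2(x\cdot e_1)e_1$. A configuration of $m$ particles is $Z_m=(x_1,v_1,\dots,x_m,v_m)$, with $|V_m|^2=\sum_i|v_i|^2$; $Z^{X,j}$, $Z^{V,j}$ are the position and velocity of particle $j$. *Flows.* For $\tau\ge0$, $T^{m,0}_{-\tau}$ is the backward free flow with specular reflection at $\{x\cdot e_1=0\}$, and $T^{m,\varepsilon}_{-\tau}$ is the backward hard sphere flow for $m$ balls of radius $\varepsilon/2$ in the half-space (phase space $x_i\cdot e_1\ge\varepsilon/2$, $|x_i-x_j|\ge\varepsilon$; specular reflection at $\{x\cdot e_1=\varepsilon/2\}$; elastic collisions $v'=v-((v-v_*)\cdot\omega)\omega$, $v_*'=v_*+((v-v_*)\cdot\omega)\omega$; a trajectory stops being defined when a particle takes part in two contacts at once). $\mathcal G^\varepsilon_m(c)$ is the set of $Z_m$ whose backward hard sphere trajectory exists for all times with $|x_i(\tau)-x_j(\tau)|>c$ for all $\tau>0$, $i\ne j$; $\mathcal G^0_m(c)$ is the analogous set for $T^{m,0}_{-\tau}$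 and configurations in $\{x\cdot e_1>0\}$. *Adjunctions.* For $r\ge0$, $\sigma=\pm1$, $1\le j\le m$ and $(\omega,v)\in\mathbb S^{d-1}\times\mathbb R^d$, $A^{r}_{\sigma,j,\omega,v}(Z_m)$ is $(Z_m,x_j+r\omega,v)$ if $\sigma=-1$; if $\sigma=+1$, the velocities $(v_j,v)$ are moreover replaced by $(v_j',v')=(v_j-((v_j-v)\cdot\omega)\omega,\ v+((v_j-v)\cdot\omega)\omega)$. *Pathological parameters.* Fix $R,\delta,\varepsilon,a,\varepsilon_0,\rho,\alpha>0$. Let $\mathcal B_j(\overline Z_m)$ be the set of $(\omega,v)$ with $|v|\le R$ and $\omega\cdot(v-\overline v_j)\neq0$, of sign $\sigma$, such that at least one of the following fails: (i) $A^\varepsilon_{\sigma,j,\omega,v}(Z_m)\in\mathcal G^\varepsilon_{m+1}(\varepsilon)$ for every $Z_m\in\mathcal G^\varepsilon_m(\varepsilon)$ with $|x_i-\overline x_i|\le a$ for all $i$, $v_j=\overline v_j$ and $v_i\in\{\overline v_i,\mathcal S_0(\overline v_i)\}$ for $i\neq j$; (ii) $T^{m+1,0}_{-\delta}A^0_{\sigma,j,\omega,v}(\overline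 Z_m)\in\mathcal G^0_{m+1}(\varepsilon_0)$. Let $\mathcal N_j(\overline Z_m)$ be the set of $(\omega,v)$ with $|v|\le R$ such that either $\omega\cdot(v-\overline v_j)<0$ and $|v\cdot e_1|\le\alpha$, or $\omega\cdot(v-\overline v_j)>0$ and $\min(|\overline v_j'\cdot e_1|,|v'\cdot e_1|)\le\alpha$. A *pathological family* $(U,E)$ consists of (jointly) measurable families of sets $U_j(t,Z_m)\subset\mathbb R$ and $E_j(Z_m)\subset\mathbb S^{d-1}\times\mathbb R^d$ ($m\ge1$, $1\le j\le m$) such that $U_j(t,Z_m)$ contains all $\tau\in[0,t]$ with $|(T^{m,0}_{-(t-\tau)}Z_m)^{X,j}\cdot e_1|<\rho$, and $E_j(\overline Z_m)\supset\mathcal B_j(\overline Z_m)\cup\mathcal N_j(\overline Z_m)$ whenever $\overline Z_m\in\mathcal G^0_m(\varepsilon_0)$ and $\overline x_j\cdot e_1\ge\rho$. *Elementary terms.* Let $g=(g^{(m)})_m$ be functions of $m$-particle configurations, $M_k=(\sigma_1,\dots,\sigma_k)\in\mathfrak M_k=\{\pm1\}^k$ and $J_k\in\mathfrak J_k^s=\{(j_1,\dots,j_k):1\le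 j_l\le s+l-1\}$. Write $t_0=t$. Given times $t_l$ and $(\omega_l,v_{s+l})$, the pseudo-trajectories issued from $Z_s$ at time $t$ are: $Z^0$ evolves backward by $T^{\cdot,0}$ and at time $t_l$ undergoes $A^0_{\sigma_l,j_l,\omega_l,v_{s+l}}$; $Z^\varepsilon$ evolves backward by $T^{\cdot,\varepsilon}$ and at time $t_l$ undergoes $A^\varepsilon_{\sigma_l,j_l,\omega_l,v_{s+l}}$. $Z^\cdot_{s,l}(\tau)$ denotes the configuration at time $\tau$ after $l$ adjunctions ($Z^{\cdot}_{s,0}(t)=Z_s$). With $[x]_\pm=\max(\pm x,0)$, the Boltzmann term is $$\mathcal J^{0,\delta}_{M_k,J_k}(U^c,E^c)g\,(t,Z_s)=\mathbb 1_{t\ge k\delta}\int_{(k-1)\delta}^{t-\delta}\!\!\mathbb 1_{U_{j_1}^c(t,Z_s)}(t_1)\int_{\mathbb S^{d-1}\times\mathbb R^d}\!\!\sigma_1\mathbb 1_{E_{j_1}^c(Z^0_{s,0}(t_1))}\big[\omega_1\cdot(v_{s+1}-v^{0,j_1}_{s,0}(t_1))\big]_{\sigma_1}\cdots$$ $$\cdots\mathbb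 1_{t_{k-1}\ge\delta}\int_0^{t_{k-1}-\delta}\!\!\mathbb 1_{U^c_{j_k}(t_{k-1},Z^0_{s,k-1}(t_{k-1}))}(t_k)\int\sigma_k\mathbb 1_{E^c_{j_k}(Z^0_{s,k-1}(t_k))}\big[\omega_k\cdot(v_{s+k}-v^{0,j_k}_{s,k-1}(t_k))\big]_{\sigma_k}\,g^{(s+k)}(Z^0_{s,k}(0))\,d\omega_k\,dv_{s+k}\,dt_k\cdots d\omega_1\,dv_{s+1}\,dt_1,$$ and the hybrid term $\overline{\mathcal J}^{\varepsilon,\delta}_{M_k,J_k}(U^c,E^c)g$ is given by the same formula with $v^{0,j_l}_{s,l-1}(t_l)$ and $Z^0_{s,k}(0)$ replaced by $v^{\varepsilon,j_l}_{s,l-1}(t_l)$ and $Z^\varepsilon_{s,k}(0)$ (the sets $U,E$ are still evaluated along $Z^0$). *Norms and domain.* $|f|_{0,m,\beta}=\sup|f(Z_m)|e^{\frac\beta2|V_m|^2}$ over $(\{x\cdot e_1\ge0\}\times\mathbb R^d)^m$, and $\|F\|_{0,\beta,\mu}=\sup_{m\ge1}|f^{(m)}|_{0,m,\beta}e^{m\mu}\in[0,\infty]$.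 $X_{0,1,\beta}$ is the space of continuous functions on $\{x\cdot e_1\ge0\}\times\mathbb R^d$ vanishing at infinity, with $|f|_{0,1,\beta}<\infty$ and $f(x,v)=f(x,\mathcal S_0(v))$ when $x\cdot e_1=0$. $\Omega_s$ is the set of $Z_s$ with $x_i\cdot e_1>0$ and $v_i\cdot e_1\ne0$ for all $i$, and, for all $i\ne j$, $x_i\ne x_j$, $v_j\notin v_i+\mathrm{Vect}(x_i-x_j)$ and $v_j\notin\mathcal S_0(v_i)+\mathrm{Vect}(\mathcal S_0(x_i)-x_j)$. **Lemma (error coming from the divergence of the trajectories).** For every $d\ge2$ there are constants $c(d),C(d)>0$ such that the following holds. Let $s,n\ge1$ be integers, $\beta_0>0$, $\mu_0\in\mathbb R$ and $T>0$ (in particular, $T$ may be the common time of existence of the solutions of the BBGKY and Boltzmann hierarchies). There is $T'\in(0,T)$, depending only on $d,s,n,\beta_0,\mu_0,T$, such that for every nonnegative $f_0\in X_{0,1,\beta_0}$ with $\int f_0=1$ and $\sqrt{f_0}$ Lipschitz in $x$ uniformly in $v$, and every compact $K\subset\Omega_s$, there are positive numbers $\overline\varepsilon,\overline\varepsilon_0,\overline\alpha,\overline\gamma,\overline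 R$, depending only on $K$, with the following property. For all positive $R,\delta,\varepsilon,a,\varepsilon_0,\rho,\eta,\alpha$ such that $$\varepsilon\le\overline\varepsilon,\ \varepsilon_0\le\overline\varepsilon_0,\ \alpha\le\overline\alpha,\ \max(16R\varepsilon/\varepsilon_0,\varepsilon_0/\delta)\le\overline\gamma,\ R\ge\overline R,\ 4\sqrt3\,a\le\varepsilon_0,\ 3a\le\rho,\ \varepsilon_0\le\eta\delta,\ R\ge1,\ \eta\le1,\ \alpha\le c(d),\ 2n\varepsilon\le a,$$ for every pathological family $(U,E)$, all $t\in[0,T']$ and all $Z_s\in K$, $$\Big|\sum_{k=1}^n\sum_{M_k\in\mathfrak M_k}\sum_{J_k\in\mathfrak J^s_k}\Big(\mathcal J^{0,\delta}_{M_k,J_k}(U^c,E^c)-\overline{\mathcal J}^{\varepsilon,\delta}_{M_k,J_k}(U^c,E^c)\Big)\big(f_0^{\otimes(s+k)}\mathbb 1_{|V_{s+k}|\le R}\big)(t,Z_s)\Big|\le C(d)(s+n)^2nR\,\frac\varepsilon\alpha\,\big|\nabla_x\sqrt{f_0}\big|_\infty\,\|F_0\|_{0,\beta_0/2,\mu_0},$$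 where $F_0=(f_0^{\otimes m})_{m\ge1}$ (the bound is void if $\|F_0\|_{0,\beta_0/2,\mu_0}=\infty$). -/

import Mathlib

open MeasureTheory Set Filter Topology
open scoped ENNReal NNReal BigOperators

namespace HalfSpaceLanford

/-- Physical space `ℝ^d` with its Euclidean norm. -/
abbrev Space (d : ℕ) := EuclideanSpace ℝ (Fin d)

/-- State (position, velocity) of one particle. -/
abbrev Particle (d : ℕ) := Space d × Space d

/-- Configurations of `m` particles: `(Z i).1` is the position of particle `i`
and `(Z i).2` is its velocity. -/
abbrev Config (d m : ℕ) := Fin m → Particle d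

/-- Parameters `(ω, v)` of the adjunction of a particle, in `S^{d-1} × ℝ^d`. -/
abbrev AdjParam (d : ℕ) := Metric.sphere (0 : Space d) 1 × Space d

noncomputable section

variable {d : ℕ} [NeZero d]

/-- First vector of the canonical basis; `x 0` is the coordinate `x · e₁`. -/
def e1 : Space d := EuclideanSpace.single 0 1

/-- The reflection `S₀ x = x - 2 (x · e₁) e₁`. -/
def reflect (x : Space d) : Space d := x - (2 * x 0) • e1

/-- `|V_m|`, the Euclidean norm of the collection of all the velocities. -/
def velNorm {d m : ℕ} (Z : Config d m) : ℝ := Real.sqrt (∑ i, ‖(Z i).2‖ ^ 2)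

/-- The closed one-particle phase space `{x · e₁ ≥ 0} × ℝ^d`. -/
def closedPhase (d : ℕ) [NeZero d] : Set (Particle d) := {z | 0 ≤ z.1 0}

/-- The open one-particle phase space `{x · e₁ > 0} × ℝ^d`. -/
def openPhase (d : ℕ) [NeZero d] : Set (Particle d) := {z | 0 < z.1 0}

/-! ### Free flow with specular reflection (particles of radius zero) -/

/-- Backward free transport of one particle during a time `τ ≥ 0`, with specular reflection
against the wall `{x · e₁ = 0}`. -/
def freeBackParticle (τ : ℝ) (z : Particle d) : Particle d :=
  if 0 ≤ (z.1 - τ • z.2) 0 then (z.1 - τ • z.2, z.2)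
  else (reflect (z.1 - τ • z.2), reflect z.2)

/-- `T^{m,0}_{-τ}`: backward free flow of `m` particles with specular reflection, `τ ≥ 0`. -/
def freeBack {m : ℕ} (τ : ℝ) (Z : Config d m) : Config d m := fun i => freeBackParticle τ (Z i)

/-! ### Hard sphere flow -/

/-- Phase space of `m` hard spheres of radius `ε / 2` in the half-space. -/
def hardPhase (d : ℕ) [NeZero d] (ε : ℝ) (m : ℕ) : Set (Config d m) :=
  {Z | (∀ i, ε / 2 ≤ (Z i).1 0) ∧ ∀ i j, i ≠ j → ε ≤ ‖(Z i).1 - (Z j).1‖}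

/-- Straight lines: `(X, V) ↦ (X + τ V, V)`. -/
def straight {d m : ℕ} (τ : ℝ) (Z : Config d m) : Config d m :=
  fun i => ((Z i).1 + τ • (Z i).2, (Z i).2)

/-- The law of the events. `W` and `W'` are the configurations just before and just after a given
instant. A particle takes part in at most one contact (with the wall or with one other
particle); otherwise the trajectory is pathological and cannot be continued. Since the scattering
and the reflection are involutions, the law is the same for the forward and the backward
dynamics. -/
structure EventLaw (ε : ℝ) {m : ℕ} (W W' : Config d m) : Prop where
  position : ∀ i, (W' i).1 = (W i).1
  free : ∀ i, (W i).1 0 ≠ ε / 2 → (∀ j, j ≠ i → ‖(W i).1 - (W j).1‖ ≠ ε) →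
    (W' i).2 = (W i).2
  wall : ∀ i, (W i).1 0 = ε / 2 →
    (∀ j, j ≠ i → ‖(W i).1 - (W j).1‖ ≠ ε) ∧ (W' i).2 = reflect (W i).2
  collision : ∀ i j, i ≠ j → ‖(W i).1 - (W j).1‖ = ε →
    (W i).1 0 ≠ ε / 2 ∧ (∀ l, l ≠ i → l ≠ j → ‖(W i).1 - (W l).1‖ ≠ ε) ∧
    (W' i).2 = (W i).2 - ((1 / ε ^ 2) * inner ℝ ((W i).2 - (W j).2) ((W i).1 - (W j).1)) •
      ((W i).1 - (W j).1)

/-- `γ` is the backward hard sphere trajectory issued from `Z`: `γ τ` is the configuration reached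
after following the hard sphere dynamics backward in time during a time `τ ≥ 0`. The motion is
in straight lines on both sides of every instant, and the velocities just before (`W`) and just
after (`γ τ`) the instant `τ > 0` are related by the law of the events. -/
structure IsBackwardTrajectory (ε : ℝ) {m : ℕ} (Z : Config d m) (γ : ℝ → Config d m) :
    Prop where
  initial : γ 0 = Z
  mem : ∀ τ, 0 ≤ τ → γ τ ∈ hardPhase d ε m
  after : ∀ τ, 0 ≤ τ → ∃ h > 0, ∀ u ∈ Ico 0 h, γ (τ + u) = straight (-u) (γ τ)
  before : ∀ τ, 0 < τ → ∃ h > 0, ∃ W : Config d m, EventLaw ε W (γ τ) ∧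
    ∀ u ∈ Ioo 0 h, γ (τ - u) = straight u W

open Classical in
/-- `T^{m,ε}_{-τ}`: backward hard sphere flow, `τ ≥ 0`. Trajectories are unique when they exist;
configurations without a global trajectory are, by convention, left fixed. -/
def hardBack (ε : ℝ) {m : ℕ} (τ : ℝ) (Z : Config d m) : Config d m :=
  if h : ∃ γ, IsBackwardTrajectory ε Z γ then h.choose τ else Z

/-! ### Good configurations -/

/-- `G^ε_m(c)`: the backward hard sphere trajectory exists and its particles remain at a distance
larger than `c` from one another at all positive times. -/
def goodHard (d : ℕ) [NeZero d] (ε c : ℝ) (m : ℕ) : Set (Config d m) :=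
  {Z | ∃ γ, IsBackwardTrajectory ε Z γ ∧
    ∀ τ, 0 < τ → ∀ i j, i ≠ j → c < ‖(γ τ i).1 - (γ τ j).1‖}

/-- `G^0_m(c)`: the same for the free flow with reflection, in the open half-space. -/
def goodFree (d : ℕ) [NeZero d] (c : ℝ) (m : ℕ) : Set (Config d m) :=
  {Z | (∀ i, Z i ∈ openPhase d) ∧
    ∀ τ, 0 < τ → ∀ i j, i ≠ j → c < ‖(freeBack τ Z i).1 - (freeBack τ Z j).1‖}

/-! ### Adjunction of particles -/

/-- Post-collisional velocities are turned into pre-collisional ones: `v' = v - ((v - w)·ω) ω`. -/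
def scatterFst {d : ℕ} (ω v w : Space d) : Space d := v - (inner ℝ (v - w) ω : ℝ) • ω

/-- `w' = w + ((v - w)·ω) ω`. -/
def scatterSnd {d : ℕ} (ω v w : Space d) : Space d := w + (inner ℝ (v - w) ω : ℝ) • ω

/-- Adjunction to `Z`, next to the particle `j`, of a particle at `x_j + r ω` with velocity `v`.
For `σ = -1` (pre-collisional case) the velocities are unchanged; for `σ = 1` (post-collisional
case) the scattering is applied to the pair formed by `j` and the new particle. The
Boltzmann pseudo-trajectories use `r = 0`, the BBGKY ones use `r = ε`. -/
def adjoin {d m : ℕ} (r : ℝ) (σ : ℤˣ) (j : Fin m) (p : AdjParam d) (Z : Config d m) :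
    Config d (m + 1) :=
  if σ = 1 then
    Fin.snoc (α := fun _ => Particle d)
      (Function.update Z j ((Z j).1, scatterFst (p.1 : Space d) (Z j).2 p.2))
      ((Z j).1 + r • (p.1 : Space d), scatterSnd (p.1 : Space d) (Z j).2 p.2)
  else
    Fin.snoc (α := fun _ => Particle d) Z ((Z j).1 + r • (p.1 : Space d), p.2)

/-- The signed quantity `ω · (v - v_j)`. -/
def flux {d m : ℕ} (j : Fin m) (p : AdjParam d) (Z : Config d m) : ℝ :=
  inner ℝ (p.1 : Space d) (p.2 - (Z j).2)

/-! ### Pathological adjunction parameters -/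

/-- The configuration `Z` (of hard spheres) is close to `Zbar`: positions at distance at most `a`,
velocities equal up to the reflection, and equal for the particle `j`. -/
def CloseConfig (a : ℝ) {m : ℕ} (j : Fin m) (Zbar Z : Config d m) : Prop :=
  (∀ i, ‖(Zbar i).1 - (Z i).1‖ ≤ a) ∧ (Z j).2 = (Zbar j).2 ∧
    ∀ i, i ≠ j → (Z i).2 = (Zbar i).2 ∨ (Z i).2 = reflect (Zbar i).2

/-- The adjunction of type `σ` with parameters `p` keeps good configurations good: no recollision
for all the hard sphere configurations close to `Zbar`, and the Boltzmann configuration is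
good (with distance `ε₀`) after a time `δ`. -/
def StableAdjunction (δ ε a ε₀ : ℝ) (σ : ℤˣ) {m : ℕ} (j : Fin m) (Zbar : Config d m)
    (p : AdjParam d) : Prop :=
  (∀ Z ∈ goodHard d ε ε m, CloseConfig a j Zbar Z →
      adjoin ε σ j p Z ∈ goodHard d ε ε (m + 1)) ∧
    freeBack δ (adjoin 0 σ j p Zbar) ∈ goodFree d ε₀ (m + 1)

/-- Adjunctions, to the particle `j` of `Zbar`, with velocity in `B(0,R)`, which do not
preserve good configurations. -/
def unstableSet (R δ ε a ε₀ : ℝ) {m : ℕ} (j : Fin m) (Zbar : Config d m) : Set (AdjParam d) :=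
  {p | ‖p.2‖ ≤ R ∧
    ((flux j p Zbar < 0 ∧ ¬ StableAdjunction δ ε a ε₀ (-1) j Zbar p) ∨
     (0 < flux j p Zbar ∧ ¬ StableAdjunction δ ε a ε₀ 1 j Zbar p))}

/-- Adjunctions, with velocity in `B(0,R)`, producing a grazing velocity (`|v · e₁| ≤ α`): that of
the new particle in the pre-collisional case, one of the two scattered velocities in
the post-collisional case. -/
def grazingSet (R α : ℝ) {m : ℕ} (j : Fin m) (Zbar : Config d m) : Set (AdjParam d) :=
  {p | ‖p.2‖ ≤ R ∧
    ((flux j p Zbar < 0 ∧ |p.2 0| ≤ α) ∨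
     (0 < flux j p Zbar ∧ (|scatterFst (p.1 : Space d) (Zbar j).2 p.2 0| ≤ α ∨
        |scatterSnd (p.1 : Space d) (Zbar j).2 p.2 0| ≤ α)))}

/-- Times `τ ∈ [0,t]` at which the particle `j` of the Boltzmann pseudo-trajectory, which is in the
configuration `Z` at time `t` and evolves backward without adjunction, is at distance less
than `ρ` from the wall. -/
def nearWallTimes (ρ : ℝ) {m : ℕ} (j : Fin m) (t : ℝ) (Z : Config d m) : Set ℝ :=
  {τ | τ ∈ Icc 0 t ∧ |(freeBack (t - τ) Z j).1 0| < ρ}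

/-- Families of sets of times: for each number `m` of particles, each particle `j`, each current
time `t` and each configuration at time `t`. -/
abbrev TimeFamily (d : ℕ) := (m : ℕ) → Fin m → ℝ → Config d m → Set ℝ

/-- Families of sets of adjunction parameters `(ω, v)`: for each number `m` of particles, each
particle `j` and each configuration. -/
abbrev ParamFamily (d : ℕ) := (m : ℕ) → Fin m → Config d m → Set (AdjParam d)

/-- `U` and `E` are measurable families of pathological adjunction parameters: `U` contains the
times when the chosen particle is too close to the wall, and `E` contains the
adjunctions that destroy a good configuration or produce grazing velocities, whenever
the chosen particle is far from the wall. -/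
structure IsPathologicalFamily (R δ ε a ε₀ ρ α : ℝ) (U : TimeFamily d) (E : ParamFamily d) :
    Prop where
  measurable_times : ∀ m (j : Fin m),
    MeasurableSet {q : ℝ × ℝ × Config d m | q.1 ∈ U m j q.2.1 q.2.2}
  measurable_params : ∀ m (j : Fin m),
    MeasurableSet {q : Config d m × AdjParam d | q.2 ∈ E m j q.1}
  times : ∀ m (j : Fin m) t Z, nearWallTimes ρ j t Z ⊆ U m j t Z
  params : ∀ m (j : Fin m), ∀ Z ∈ goodFree d ε₀ m, ρ ≤ (Z j).1 0 →
    unstableSet R δ ε a ε₀ j Z ∪ grazingSet R α j Z ⊆ E m j Z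

/-! ### Elementary terms -/

/-- Labels `J_k = (j_1, …, j_k)` of the particles undergoing the adjunctions: `j_l` is one of the
`m + l - 1` particles present at that stage. -/
abbrev Labels (m k : ℕ) := (l : Fin k) → Fin (m + l)

def Labels.head {m k : ℕ} (J : Labels m (k + 1)) : Fin m := Fin.cast (by simp) (J 0)

def Labels.tail {m k : ℕ} (J : Labels m (k + 1)) : Labels (m + 1) k :=
  fun l => Fin.cast (by simp only [Fin.val_succ]; omega) (J l.succ)

/-- `[x]_σ`: positive part of `x` for `σ = 1`, negative part for `σ = -1`. -/
def signedPart (σ : ℤˣ) (x : ℝ) : ℝ := max (((σ : ℤ) : ℝ) * x) 0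

/-- The measure `dω dv` on `S^{d-1} × ℝ^d` (surface measure times Lebesgue measure). -/
def adjMeasure (d : ℕ) : Measure (AdjParam d) :=
  (volume : Measure (Space d)).toSphere.prod volume

/-- Elementary Boltzmann term of type `(M_k, J_k)`, truncated to the adjunction times outside `U`,
to the adjunction parameters outside `E` and to adjunction times separated by at least `δ`, with
initial data `g`, as a function of the time `t` and of the configuration at time `t`. -/
def boltzmannTerm (δ : ℝ) (U : TimeFamily d) (E : ParamFamily d)
    (g : (m : ℕ) → Config d m → ℝ) :
    (k : ℕ) → {m : ℕ} → (Fin k → ℤˣ) → Labels m k → ℝ → Config d m → ℝ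
  | 0, m, _, _, t, Z => g m (freeBack t Z)
  | k + 1, m, M, J, t, Z =>
    if ((k : ℝ) + 1) * δ ≤ t then
      ∫ t₁ in (k * δ)..(t - δ),
        (U m J.head t Z)ᶜ.indicator (fun _ =>
          ∫ p : AdjParam d,
            (E m J.head (freeBack (t - t₁) Z))ᶜ.indicator (fun p =>
              (((M 0 : ℤˣ) : ℤ) : ℝ) * signedPart (M 0) (flux J.head p (freeBack (t - t₁) Z)) *
                boltzmannTerm δ U E g k (fun l => M l.succ) J.tail t₁
                  (adjoin 0 (M 0) J.head p (freeBack (t - t₁) Z))) p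
            ∂adjMeasure d) t₁
    else 0

/-- The hybrid term: same truncations, governed by the Boltzmann pseudo-trajectory (current
configuration `Z₀`), but the collision kernels and the final argument of the initial data are those
of the BBGKY pseudo-trajectory (current configuration `Zε`). -/
def hybridTermAux (ε δ : ℝ) (U : TimeFamily d) (E : ParamFamily d)
    (g : (m : ℕ) → Config d m → ℝ) :
    (k : ℕ) → {m : ℕ} → (Fin k → ℤˣ) → Labels m k → ℝ → Config d m → Config d m → ℝ
  | 0, m, _, _, t, _, Zε => g m (hardBack ε t Zε)
  | k + 1, m, M, J, t, Z₀, Zε =>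
    if ((k : ℝ) + 1) * δ ≤ t then
      ∫ t₁ in (k * δ)..(t - δ),
        (U m J.head t Z₀)ᶜ.indicator (fun _ =>
          ∫ p : AdjParam d,
            (E m J.head (freeBack (t - t₁) Z₀))ᶜ.indicator (fun p =>
              (((M 0 : ℤˣ) : ℤ) : ℝ) *
                signedPart (M 0) (flux J.head p (hardBack ε (t - t₁) Zε)) *
                hybridTermAux ε δ U E g k (fun l => M l.succ) J.tail t₁
                  (adjoin 0 (M 0) J.head p (freeBack (t - t₁) Z₀))
                  (adjoin ε (M 0) J.head p (hardBack ε (t - t₁) Zε))) p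
            ∂adjMeasure d) t₁
    else 0

/-- The hybrid elementary term: both pseudo-trajectories start from the same configuration. -/
def hybridTerm (ε δ : ℝ) (U : TimeFamily d) (E : ParamFamily d)
    (g : (m : ℕ) → Config d m → ℝ) (k : ℕ) {m : ℕ} (M : Fin k → ℤˣ) (J : Labels m k)
    (t : ℝ) (Z : Config d m) : ℝ :=
  hybridTermAux ε δ U E g k M J t Z Z

/-! ### Initial data and norms -/

/-- Tensorized data `f₀^{⊗ m}`. -/
def tensor {d : ℕ} (f₀ : Particle d → ℝ) (m : ℕ) (Z : Config d m) : ℝ := ∏ i, f₀ (Z i)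

open Classical in
/-- `f₀^{⊗ m} 1_{|V_m| ≤ R}`. -/
def cutTensor {d : ℕ} (f₀ : Particle d → ℝ) (R : ℝ) (m : ℕ) (Z : Config d m) : ℝ :=
  if velNorm Z ≤ R then tensor f₀ m Z else 0

/-- `|f|_{0,m,β} = sup |f(Z)| exp(β |V|² / 2)` over the closed phase space, in `[0,∞]`. -/
def gaussNorm {m : ℕ} (β : ℝ) (f : Config d m → ℝ) : ℝ≥0∞ :=
  ⨆ Z ∈ {Z : Config d m | ∀ i, Z i ∈ closedPhase d},
    ENNReal.ofReal (|f Z| * Real.exp (β / 2 * ∑ i, ‖(Z i).2‖ ^ 2))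

/-- `‖F‖_{0,β,μ} = sup_{m ≥ 1} |f^{(m)}|_{0,m,β} exp(m μ)`, in `[0,∞]`. -/
def seqNorm (β μ : ℝ) (F : (m : ℕ) → Config d m → ℝ) : ℝ≥0∞ :=
  ⨆ m ∈ {m : ℕ | 1 ≤ m}, gaussNorm β (F m) * ENNReal.ofReal (Real.exp (m * μ))

/-- `f₀ ∈ X_{0,1,β}`: continuous on the closed phase space, vanishing at infinity there, with finite
Gaussian norm, and satisfying the specular boundary condition. Values of `f₀` outside the closed
phase space play no role. -/
structure MemX (β : ℝ) (f₀ : Particle d → ℝ) : Prop where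
  continuousOn : ContinuousOn f₀ (closedPhase d)
  vanishing : Tendsto f₀ (cocompact (Particle d) ⊓ 𝓟 (closedPhase d)) (𝓝 0)
  finite : gaussNorm β (fun Z : Config d 1 => f₀ (Z 0)) < ∞
  boundary : ∀ x v : Space d, x 0 = 0 → f₀ (x, v) = f₀ (x, reflect v)

/-- `√f₀` is Lipschitz in the position, uniformly in the velocity. -/
def SqrtLipschitz (f₀ : Particle d → ℝ) : Prop :=
  ∃ L : ℝ≥0, ∀ v : Space d, LipschitzOnWith L (fun x => Real.sqrt (f₀ (x, v))) {x | 0 ≤ x 0}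

/-- `|∇_x √f₀|_∞`: essential supremum over the phase space of the norm of the gradient in `x`. -/
def gradSqrtNorm (f₀ : Particle d → ℝ) : ℝ≥0∞ :=
  eLpNorm (fun z : Particle d => fderiv ℝ (fun x => Real.sqrt (f₀ (x, z.2))) z.1) ∞
    (volume.restrict (openPhase d))

/-- The domain `Ω_m` of local uniform convergence, in the phase space of `m` particles in the open
half-space. -/
def convergenceDomain (d : ℕ) [NeZero d] (m : ℕ) : Set (Config d m) :=
  {Z | (∀ i, Z i ∈ openPhase d) ∧
    (∀ i j, i ≠ j → (Z i).1 ≠ (Z j).1) ∧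
    (∀ i, (Z i).2 0 ≠ 0) ∧
    (∀ i j, i ≠ j → (Z j).2 - (Z i).2 ∉ Submodule.span ℝ {(Z i).1 - (Z j).1}) ∧
    (∀ i j, i ≠ j →
      (Z j).2 - reflect (Z i).2 ∉ Submodule.span ℝ {reflect (Z i).1 - (Z j).1})}

end

end HalfSpaceLanford

open HalfSpaceLanford

/-! The hybrid and Boltzmann terms integrate over the same truncated set of parameters, and they
differ only through the two pseudo-trajectories. Outside the pathological sets, the hard sphere
trajectory has no recollision. Between adjunctions it is therefore the explicit free flow with the
wall moved to `{x · e₁ = ε / 2}` (`hardBack_eq_shiftFree`, `hybrid_pseudoTerm_eq`).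

The invariant `NearUpToReflection` compares the two trajectories of a particle: velocities agree up
to `reflect`, and positions are within `r` after the same reflection. Moving the wall adds at most
`ε` to `r`, whatever the duration (`NearUpToReflection.flow`), and an adjunction adds another `ε`.
At an adjunction time the chosen particle is at distance at least `ρ > r + ε` from the wall, so its
velocity is exactly the same on both sides. Hence the collision kernels coincide and the scattered
velocities agree. `GoodPair.adjoin` propagates the invariant together with the absence of
recollisions, starting from the separation that compactness of `K` provides
(`exists_good_threshold`).

The whole difference thus sits in the data at time zero. A reflected velocity costs nothing there:
the segment joining one position to the mirror image of the other crosses the wall, where the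
specular condition exchanges `v` and `reflect v` (`abs_sqrt_sub_sqrt_le_of_near`). Writing a
difference of data as a difference of squares makes `|∇_x √f₀|_∞` appear. Finiteness of the norm of
all tensor powers forces the normalized one-particle density below `1`, so that the norm enters the
product estimate only to the first power (`abs_tensor_sub_tensor_le`).

Gaussian weights control the collision kernels. Each term is at most a constant times `t ε |∇_x
√f₀|_∞ ‖F₀‖`, with a constant depending on `d, s, n, β₀, μ₀`. As `T'` may depend on these
quantities, a short time absorbs the sum of the constants, and `ε ≤ ε / α` gives the stated form
with `c = C = 1`. -/

namespace HalfSpaceLanford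

/-! ### Lipschitz constants and essential suprema of gradients -/

/-- A Lipschitz function on a finite dimensional space whose gradient is almost everywhere bounded
by `L` on an open convex set is `L`-Lipschitz on that set. -/
theorem abs_sub_le_of_ae_norm_fderiv_le {E : Type*} [NormedAddCommGroup E] [NormedSpace ℝ E]
    [FiniteDimensional ℝ E] [MeasureSpace E] [BorelSpace E]
    [(volume : Measure E).IsAddHaarMeasure] {f : E → ℝ} {C : ℝ≥0} (hf : LipschitzWith C f)
    {Ω : Set E} (ho : IsOpen Ω) (hc : Convex ℝ Ω) {L : ℝ}
    (hL : ∀ᵐ x : E, x ∈ Ω → ‖fderiv ℝ f x‖ ≤ L) {x y : E} (hx : x ∈ Ω) (hy : y ∈ Ω) :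
    |f y - f x| ≤ L * ‖y - x‖ := by
  set h := y - x with hh
  have hgood : ∀ᵐ z : E, DifferentiableAt ℝ f z ∧ (z ∈ Ω → ‖fderiv ℝ f z‖ ≤ L) :=
    hf.ae_differentiableAt.and hL
  obtain ⟨N, hN, hNm, hN0⟩ := exists_measurable_superset_of_null hgood
  -- The segment from `x` to `y` may lie inside the null set where the gradient is not controlled.
  -- By Fubini, almost every translate of it meets this set only at a null set of parameters.
  have hae : ∀ᵐ z : E, ∀ᵐ s : ℝ, x + z + s • h ∉ N := by
    rw [Measure.ae_ae_comm]
    · refine Eventually.of_forall fun s => ?_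
      have : (volume : Measure E) ((fun z => z + (x + s • h)) ⁻¹' N) = 0 := by
        rw [measure_preimage_add_right]; exact hN0
      rw [ae_iff]
      convert this using 2
      ext z
      simp only [not_not, mem_ofPred_eq, mem_preimage]
      rw [show x + z + s • h = z + (x + s • h) by abel]
    · exact (hNm.preimage (by fun_prop : Measurable fun q : E × ℝ => x + q.1 + q.2 • h)).compl
  by_contra! hcon
  -- The translations violating the bound form an open set. Integrating the derivative along good
  -- segments shows that it is null, hence empty, although it would contain `0`.
  set V : Set E := {z | x + z ∈ Ω ∧ y + z ∈ Ω ∧ L * ‖h‖ < |f (y + z) - f (x + z)|} with hV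
  have hVo : IsOpen V := by
    have hfc := hf.continuous
    refine (ho.preimage (by fun_prop : Continuous fun z : E => x + z)).inter
      ((ho.preimage (by fun_prop : Continuous fun z : E => y + z)).inter ?_)
    exact isOpen_lt continuous_const ((hfc.comp (continuous_const.add continuous_id)).sub
      (hfc.comp (continuous_const.add continuous_id))).abs
  have hV0 : (volume : Measure E) V = 0 := by
    refine measure_mono_null ?_ hae
    intro z hz hbad
    obtain ⟨hxz, hyz, hlt⟩ := hz
    refine absurd ?_ (not_le.2 hlt)
    set g : ℝ → ℝ := fun s => f (x + z + s • h) with hg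
    have hgL : LipschitzWith (C * ‖h‖₊) g := by
      refine hf.comp (LipschitzWith.of_dist_le_mul fun s t => ?_)
      rw [dist_add_left, dist_eq_norm, ← sub_smul, norm_smul, Real.dist_eq, mul_comm]
      simp
    have hint := (hgL.lipschitzOnWith (s := uIcc 0 1)).absolutelyContinuousOnInterval.integral_deriv_eq_sub
    have hg1 : g 1 = f (y + z) := by simp only [hg, hh]; congr 1; module
    have hg0 : g 0 = f (x + z) := by simp [hg]
    rw [← hg1, ← hg0, ← hint, ← Real.norm_eq_abs]
    have := intervalIntegral.norm_integral_le_of_norm_le_const_ae (a := 0) (b := 1)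
      (f := deriv g) (C := L * ‖h‖) ?_
    · simpa using this
    filter_upwards [hbad] with s hs hs01
    rw [uIoc_of_le zero_le_one] at hs01
    have hs' : x + z + s • h ∉ {z | ¬ (DifferentiableAt ℝ f z ∧ (z ∈ Ω → ‖fderiv ℝ f z‖ ≤ L))} :=
      fun hmem => hs (hN hmem)
    simp only [mem_ofPred_eq, not_not] at hs'
    have hmem : x + z + s • h ∈ Ω := by
      have := hc hxz hyz (sub_nonneg.2 hs01.2) hs01.1.le (by ring)
      convert this using 1
      simp only [hh]; module
    have hline : HasDerivAt (fun s : ℝ => x + z + s • h) h s := by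
      simpa using ((hasDerivAt_id s).smul_const h).const_add (x + z)
    have hd : HasDerivAt g (fderiv ℝ f (x + z + s • h) h) s :=
      hs'.1.hasFDerivAt.comp_hasDerivAt s hline
    rw [hd.deriv]
    exact (ContinuousLinearMap.le_opNorm _ _).trans
      (mul_le_mul_of_nonneg_right (hs'.2 hmem) (norm_nonneg _))
  have := (hVo.measure_eq_zero_iff volume).1 hV0
  have h0 : (0 : E) ∈ V := ⟨by simpa using hx, by simpa using hy, by simpa using hcon⟩
  rw [this] at h0
  exact h0

theorem continuous_coord {d : ℕ} (i : Fin d) : Continuous fun x : Space d => x i := by fun_prop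

section

variable {d : ℕ} [NeZero d]

theorem isOpen_openHalfSpace : IsOpen {x : Space d | 0 < x 0} :=
  isOpen_lt continuous_const (continuous_coord 0)

theorem gradSqrtNorm_ne_top {f₀ : Particle d → ℝ} (hs : SqrtLipschitz f₀) :
    gradSqrtNorm f₀ ≠ ∞ := by
  obtain ⟨L, hL⟩ := hs
  unfold gradSqrtNorm
  rw [eLpNorm_exponent_top]
  refine ne_top_of_le_ne_top (ENNReal.coe_ne_top (r := L))
    (eLpNormEssSup_le_of_ae_nnnorm_bound ?_)
  have hmeas : MeasurableSet (openPhase d) :=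
    (isOpen_lt continuous_const ((continuous_coord 0).comp continuous_fst)).measurableSet
  filter_upwards [ae_restrict_mem hmeas] with z hz
  rw [← NNReal.coe_le_coe, coe_nnnorm]
  have hz' : 0 < z.1 0 := hz
  refine norm_fderiv_le_of_lipschitzOn ℝ (s := {x | 0 ≤ x 0}) ?_ (hL z.2)
  filter_upwards [isOpen_openHalfSpace.mem_nhds hz'] with x hx using le_of_lt hx

/-- The essential supremum over `(x, v)` first gives the bound for almost every `v` in the open
half-space, by Fubini. Continuity in `v` extends it to every `v`, and continuity in `x`, approaching
along `e1`, extends it to the wall. -/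
theorem abs_sqrt_sub_sqrt_le {β : ℝ} {f₀ : Particle d → ℝ} (hX : MemX β f₀)
    (hs : SqrtLipschitz f₀) (v : Space d) {x y : Space d} (hx : 0 ≤ x 0) (hy : 0 ≤ y 0) :
    |Real.sqrt (f₀ (y, v)) - Real.sqrt (f₀ (x, v))| ≤ (gradSqrtNorm f₀).toReal * ‖y - x‖ := by
  have hfin := gradSqrtNorm_ne_top hs
  obtain ⟨L, hL⟩ := hs
  have hcont : ∀ x : Space d, 0 ≤ x 0 → Continuous fun v => Real.sqrt (f₀ (x, v)) := by
    intro x hx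
    have : Continuous fun v => f₀ (x, v) :=
      hX.continuousOn.comp_continuous (by fun_prop) (fun v => hx)
    exact this.sqrt
  have hmeas : MeasurableSet (openPhase d) :=
    (isOpen_lt continuous_const ((continuous_coord 0).comp continuous_fst)).measurableSet
  have hae : ∀ᵐ z : Particle d, z ∈ openPhase d →
      ‖fderiv ℝ (fun x => Real.sqrt (f₀ (x, z.2))) z.1‖ ≤ (gradSqrtNorm f₀).toReal := by
    rw [← ae_restrict_iff' hmeas]
    have := ae_le_eLpNormEssSup (μ := (volume : Measure (Particle d)).restrict (openPhase d))
      (f := fun z : Particle d => fderiv ℝ (fun x => Real.sqrt (f₀ (x, z.2))) z.1)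
    filter_upwards [this] with z hz
    rw [← eLpNorm_exponent_top] at hz
    have := ENNReal.toReal_mono hfin hz
    simpa [toReal_enorm] using this
  have hswap : ∀ᵐ v : Space d, ∀ᵐ x : Space d, 0 < x 0 →
      ‖fderiv ℝ (fun x => Real.sqrt (f₀ (x, v))) x‖ ≤ (gradSqrtNorm f₀).toReal := by
    have h := (Measure.measurePreserving_swap (μ := (volume : Measure (Space d)))
      (ν := (volume : Measure (Space d)))).quasiMeasurePreserving.ae hae
    exact Measure.ae_ae_of_ae_prod h
  have hopen : ∀ᵐ v : Space d, ∀ x y : Space d, 0 < x 0 → 0 < y 0 →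
      |Real.sqrt (f₀ (y, v)) - Real.sqrt (f₀ (x, v))| ≤ (gradSqrtNorm f₀).toReal * ‖y - x‖ := by
    filter_upwards [hswap] with v hv x y hx hy
    -- Almost everywhere differentiability is used for a function that is Lipschitz on the whole
    -- space. The extension has the same gradient on the open half-space.
    obtain ⟨F, hF, hFe⟩ := (hL v).extend_real
    have hc : Convex ℝ {x : Space d | 0 < x 0} := by
      intro x hx y hy a b ha hb hab
      simp only [mem_ofPred_eq, PiLp.add_apply, PiLp.smul_apply, smul_eq_mul] at *
      rcases ha.eq_or_lt with rfl | ha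
      · simp at hab; subst hab; simpa using hy
      · positivity
    have := abs_sub_le_of_ae_norm_fderiv_le hF isOpen_openHalfSpace hc
      (L := (gradSqrtNorm f₀).toReal) ?_ hx hy
    · rwa [← hFe (le_of_lt hx), ← hFe (le_of_lt hy)] at this
    filter_upwards [hv] with z hz hz0
    have heq : F =ᶠ[𝓝 z] fun x => Real.sqrt (f₀ (x, v)) := by
      filter_upwards [isOpen_openHalfSpace.mem_nhds hz0] with x hx using (hFe (le_of_lt hx)).symm
    rw [heq.fderiv_eq]
    exact hz hz0
  have hallv : ∀ v : Space d, ∀ x y : Space d, 0 < x 0 → 0 < y 0 →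
      |Real.sqrt (f₀ (y, v)) - Real.sqrt (f₀ (x, v))| ≤ (gradSqrtNorm f₀).toReal * ‖y - x‖ := by
    intro v x y hx hy
    have hcl : IsClosed {v : Space d | |Real.sqrt (f₀ (y, v)) - Real.sqrt (f₀ (x, v))| ≤
        (gradSqrtNorm f₀).toReal * ‖y - x‖} :=
      isClosed_le ((hcont y hy.le).sub (hcont x hx.le)).abs continuous_const
    have hd : Dense {v : Space d | |Real.sqrt (f₀ (y, v)) - Real.sqrt (f₀ (x, v))| ≤
        (gradSqrtNorm f₀).toReal * ‖y - x‖} := by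
      refine Measure.dense_of_ae (μ := volume) ?_
      filter_upwards [hopen] with v hv using hv x y hx hy
    exact hcl.closure_eq.subset (hd v)
  have hcx : ∀ x : Space d, 0 ≤ x 0 →
      Tendsto (fun s : ℝ => Real.sqrt (f₀ (x + s • e1, v))) (𝓝[>] 0)
        (𝓝 (Real.sqrt (f₀ (x, v)))) := by
    intro x hx
    have hcc : ContinuousWithinAt (fun x => Real.sqrt (f₀ (x, v))) {x : Space d | 0 ≤ x 0} x :=
      (hL v).continuousOn x hx
    refine hcc.tendsto.comp (tendsto_nhdsWithin_iff.2 ⟨?_, ?_⟩)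
    · have : Continuous fun s : ℝ => x + s • (e1 : Space d) := by fun_prop
      simpa using (this.tendsto 0).mono_left nhdsWithin_le_nhds
    · filter_upwards [self_mem_nhdsWithin] with s hs
      have hs : 0 < s := hs
      simp [e1]; positivity
  refine le_of_tendsto (((hcx y hy).sub (hcx x hx)).abs) ?_
  filter_upwards [self_mem_nhdsWithin] with s hs
  have hs : 0 < s := hs
  have := hallv v (x + s • e1) (y + s • e1) (by simp [e1]; positivity) (by simp [e1]; positivity)
  simpa using this

end

/-! ### The specular reflection -/

section

variable {d : ℕ} [NeZero d]

theorem reflect_apply_zero (x : Space d) : reflect x 0 = - x 0 := by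
  simp [reflect, e1]; ring

theorem reflect_sub (x y : Space d) : reflect (x - y) = reflect x - reflect y := by
  simp only [reflect, PiLp.sub_apply]; module

theorem reflect_smul (r : ℝ) (x : Space d) : reflect (r • x) = r • reflect x := by
  simp only [reflect, PiLp.smul_apply, smul_eq_mul]; module

theorem reflect_reflect (x : Space d) : reflect (reflect x) = x := by
  conv_lhs => rw [reflect]
  rw [reflect_apply_zero, reflect]; module

theorem reflect_of_coord_eq_zero {x : Space d} (hx : x 0 = 0) : reflect x = x := by
  simp [reflect, hx]

theorem norm_reflect (x : Space d) : ‖reflect x‖ = ‖x‖ := by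
  have h : ‖reflect x‖ ^ 2 = ‖x‖ ^ 2 := by
    have hi : inner ℝ x (e1 : Space d) = x 0 := by simp [e1, EuclideanSpace.inner_single_right]
    have hn : ‖(e1 : Space d)‖ = 1 := by simp [e1]
    rw [reflect, norm_sub_sq_real, inner_smul_right, norm_smul, hi, hn, Real.norm_eq_abs, mul_one,
      sq_abs]
    ring
  exact (pow_left_inj₀ (norm_nonneg _) (norm_nonneg _) two_ne_zero).1 h

theorem norm_reflect_sub_reflect (x y : Space d) : ‖reflect x - reflect y‖ = ‖x - y‖ := by
  rw [← reflect_sub, norm_reflect]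

theorem norm_e1 : ‖(e1 : Space d)‖ = 1 := by simp [e1]

theorem e1_apply_zero : (e1 : Space d) 0 = 1 := by simp [e1]

theorem continuous_reflect : Continuous (reflect : Space d → Space d) := by
  unfold reflect; fun_prop

theorem abs_coord_le_norm (x : Space d) : |x 0| ≤ ‖x‖ := by
  simpa using PiLp.norm_apply_le x 0

/-! ### Free flows -/

/-- Backward free transport of one particle during a time `τ ≥ 0` with specular reflection against
the wall `{x · e₁ = ε / 2}`; at the instant of a contact the velocity is already reflected. -/
noncomputable def shiftFreeParticle (ε τ : ℝ) (z : Particle d) : Particle d :=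
  if ε / 2 < (z.1 - τ • z.2) 0 ∨ ((z.1 - τ • z.2) 0 = ε / 2 ∧ z.2 0 ≤ 0) then
    (z.1 - τ • z.2, z.2)
  else (reflect (z.1 - τ • z.2) + ε • e1, reflect z.2)

/-- Backward free flow of `m` particles with specular reflection against the wall
`{x · e₁ = ε / 2}`. -/
noncomputable def shiftFree (ε : ℝ) {m : ℕ} (τ : ℝ) (Z : Config d m) : Config d m :=
  fun i => shiftFreeParticle ε τ (Z i)

/-- `|V_m|²`. -/
noncomputable def energy {d m : ℕ} (Z : Config d m) : ℝ := ∑ i, ‖(Z i).2‖ ^ 2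

theorem energy_nonneg {d m : ℕ} (Z : Config d m) : 0 ≤ energy Z :=
  Finset.sum_nonneg fun _ _ => sq_nonneg _

theorem norm_freeBackParticle_snd (τ : ℝ) (z : Particle d) : ‖(freeBackParticle τ z).2‖ = ‖z.2‖ := by
  unfold freeBackParticle; split_ifs <;> simp [norm_reflect]

theorem norm_shiftFreeParticle_snd (ε τ : ℝ) (z : Particle d) :
    ‖(shiftFreeParticle ε τ z).2‖ = ‖z.2‖ := by
  unfold shiftFreeParticle; split_ifs <;> simp [norm_reflect]

theorem energy_freeBack {m : ℕ} (τ : ℝ) (Z : Config d m) : energy (freeBack τ Z) = energy Z := by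
  simp [energy, freeBack, norm_freeBackParticle_snd]

theorem energy_shiftFree {m : ℕ} (ε τ : ℝ) (Z : Config d m) :
    energy (shiftFree ε τ Z) = energy Z := by
  simp [energy, shiftFree, norm_shiftFreeParticle_snd]

theorem freeBackParticle_mem_closedPhase (τ : ℝ) (z : Particle d) :
    freeBackParticle τ z ∈ closedPhase d := by
  unfold freeBackParticle closedPhase
  split_ifs with h
  · exact h
  · simp only [mem_ofPred_eq, reflect_apply_zero]; linarith

theorem le_coord_shiftFreeParticle (ε τ : ℝ) (z : Particle d) :
    ε / 2 ≤ (shiftFreeParticle ε τ z).1 0 := by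
  unfold shiftFreeParticle
  split_ifs with h
  · rcases h with h | h
    · exact h.le
    · exact h.1.ge
  · push Not at h
    simp only [PiLp.add_apply, PiLp.smul_apply, reflect_apply_zero, e1_apply_zero, smul_eq_mul,
      mul_one]
    linarith [h.1]

/-- A straight line issued from the closed half-space and found outside stays outside, so at most
one reflection occurs. -/
theorem freeBackParticle_add {a b : ℝ} (ha : 0 ≤ a) (hb : 0 ≤ b) {z : Particle d}
    (hz : z ∈ closedPhase d) :
    freeBackParticle a (freeBackParticle b z) = freeBackParticle (a + b) z := by
  have hz : 0 ≤ z.1 0 := hz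
  have e : z.1 - b • z.2 - a • z.2 = z.1 - (a + b) • z.2 := by module
  by_cases h1 : 0 ≤ (z.1 - b • z.2) 0
  · simp only [freeBackParticle, h1, if_true, e]
  · have h2 : ¬ 0 ≤ (z.1 - (a + b) • z.2) 0 := by
      simp only [PiLp.sub_apply, PiLp.smul_apply, smul_eq_mul, not_le] at h1 ⊢
      have : 0 < z.2 0 := by
        by_contra! hc
        nlinarith
      nlinarith
    have e' : reflect (z.1 - b • z.2) - a • reflect z.2 = reflect (z.1 - (a + b) • z.2) := by
      rw [← reflect_smul, ← reflect_sub, e]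
    have h3 : 0 ≤ (reflect (z.1 - (a + b) • z.2)) 0 := by
      rw [reflect_apply_zero]; linarith
    simp only [freeBackParticle, h1, if_false, e', h3, h2, if_true]

theorem freeBack_add {m : ℕ} {a b : ℝ} (ha : 0 ≤ a) (hb : 0 ≤ b) {Z : Config d m}
    (hZ : ∀ i, Z i ∈ closedPhase d) : freeBack a (freeBack b Z) = freeBack (a + b) Z :=
  funext fun i => freeBackParticle_add ha hb (hZ i)

/-! ### Uniqueness of the hard sphere trajectories -/

/-- Continuous induction through the infimum of the counterexamples. It suits trajectories that are
only described locally, on each side of each instant. -/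
theorem real_induction {P : ℝ → Prop} (h0 : P 0)
    (hr : ∀ τ, 0 ≤ τ → P τ → ∃ h > 0, ∀ u ∈ Ioo 0 h, P (τ + u))
    (hl : ∀ τ, 0 < τ → (∀ u, 0 ≤ u → u < τ → P u) → P τ) : ∀ τ, 0 ≤ τ → P τ := by
  by_contra! hcon
  set S := {τ : ℝ | 0 ≤ τ ∧ ¬ P τ} with hS
  have hne : S.Nonempty := hcon
  have hbd : BddBelow S := ⟨0, fun x hx => hx.1⟩
  set c := sInf S
  have hc0 : 0 ≤ c := le_csInf hne fun x hx => hx.1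
  have hlt : ∀ u, 0 ≤ u → u < c → P u := fun u hu huc => by
    by_contra hP
    exact absurd (csInf_le hbd (show u ∈ S from ⟨hu, hP⟩)) (not_le.2 huc)
  have hPc : P c := by
    rcases hc0.eq_or_lt with h | h
    · rwa [← h]
    · exact hl c h hlt
  obtain ⟨h, hh, hP⟩ := hr c hc0 hPc
  have : c + h ≤ c := by
    refine le_csInf hne fun x hx => ?_
    by_contra! hxc
    have hcx : c ≤ x := csInf_le hbd hx
    rcases hcx.eq_or_lt with h' | h'
    · exact hx.2 (h' ▸ hPc)
    · exact hx.2 (by simpa using hP (x - c) ⟨by linarith, by linarith⟩)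
  linarith

theorem straight_injective_of_eventually {d m : ℕ} {W W' : Config d m} {h : ℝ} (hh : 0 < h)
    (heq : ∀ u ∈ Ioo 0 h, straight u W = straight u W') : W = W' := by
  have h1 := heq (h / 2) ⟨by linarith, by linarith⟩
  have h2 := heq (h / 3) ⟨by linarith, by linarith⟩
  funext i
  have a1 := congrFun h1 i
  have a2 := congrFun h2 i
  simp only [straight, Prod.mk.injEq] at a1 a2
  refine Prod.ext ?_ a1.2
  have := a1.1
  rw [a1.2] at this
  exact add_right_cancel this

theorem EventLaw.unique {ε : ℝ} {m : ℕ} {W W₁ W₂ : Config d m} (h₁ : EventLaw ε W W₁)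
    (h₂ : EventLaw ε W W₂) : W₁ = W₂ := by
  funext i
  refine Prod.ext ((h₁.position i).trans (h₂.position i).symm) ?_
  by_cases hw : (W i).1 0 = ε / 2
  · exact (h₁.wall i hw).2.trans (h₂.wall i hw).2.symm
  · by_cases hc : ∃ j, j ≠ i ∧ ‖(W i).1 - (W j).1‖ = ε
    · obtain ⟨j, hj, hc⟩ := hc
      exact (h₁.collision i j hj.symm hc).2.2.trans (h₂.collision i j hj.symm hc).2.2.symm
    · push Not at hc
      exact (h₁.free i hw hc).trans (h₂.free i hw hc).symm

/-- Equality spreads forward by `after`. It passes to a limit instant because the incoming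
configuration is determined by the earlier straight motion and the event law is deterministic. -/
theorem IsBackwardTrajectory.unique {ε : ℝ} {m : ℕ} {Z : Config d m} {γ γ' : ℝ → Config d m}
    (h : IsBackwardTrajectory ε Z γ) (h' : IsBackwardTrajectory ε Z γ') :
    ∀ τ, 0 ≤ τ → γ τ = γ' τ := by
  refine real_induction (h.initial.trans h'.initial.symm) ?_ ?_
  · intro τ hτ he
    obtain ⟨a, ha, hγ⟩ := h.after τ hτ
    obtain ⟨b, hb, hγ'⟩ := h'.after τ hτ
    refine ⟨min a b, lt_min ha hb, fun u hu => ?_⟩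
    rw [hγ u ⟨hu.1.le, hu.2.trans_le (min_le_left _ _)⟩,
      hγ' u ⟨hu.1.le, hu.2.trans_le (min_le_right _ _)⟩, he]
  · intro τ hτ he
    obtain ⟨a, ha, W, hW, hγ⟩ := h.before τ hτ
    obtain ⟨b, hb, W', hW', hγ'⟩ := h'.before τ hτ
    have : W = W' := by
      refine straight_injective_of_eventually (h := min τ (min a b))
        (lt_min hτ (lt_min ha hb)) fun u hu => ?_
      obtain ⟨hu0, hu⟩ := hu
      simp only [lt_min_iff] at hu
      rw [← hγ u ⟨hu0, hu.2.1⟩, ← hγ' u ⟨hu0, hu.2.2⟩]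
      exact he _ (by linarith) (by linarith)
    subst this
    exact hW.unique hW'

theorem hardBack_eq {ε : ℝ} {m : ℕ} {Z : Config d m} {γ : ℝ → Config d m}
    (h : IsBackwardTrajectory ε Z γ) {τ : ℝ} (hτ : 0 ≤ τ) : hardBack ε τ Z = γ τ := by
  have hex : ∃ γ, IsBackwardTrajectory ε Z γ := ⟨γ, h⟩
  rw [hardBack, dif_pos hex]
  exact hex.choose_spec.unique h τ hτ

theorem IsBackwardTrajectory.shift {ε : ℝ} {m : ℕ} {Z : Config d m} {γ : ℝ → Config d m}
    (h : IsBackwardTrajectory ε Z γ) {τ : ℝ} (hτ : 0 ≤ τ) :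
    IsBackwardTrajectory ε (γ τ) fun u => γ (τ + u) where
  initial := by simp
  mem u hu := h.mem _ (by linarith)
  after u hu := by
    obtain ⟨a, ha, hγ⟩ := h.after (τ + u) (by linarith)
    exact ⟨a, ha, fun w hw => by rw [← hγ w hw, add_assoc]⟩
  before u hu := by
    obtain ⟨a, ha, W, hW, hγ⟩ := h.before (τ + u) (by linarith)
    exact ⟨a, ha, W, hW, fun w hw => by rw [← hγ w hw, add_sub_assoc]⟩

theorem hardBack_mem_goodHard {ε c : ℝ} {m : ℕ} {Z : Config d m} (h : Z ∈ goodHard d ε c m)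
    {τ : ℝ} (hτ : 0 ≤ τ) : hardBack ε τ Z ∈ goodHard d ε c m := by
  obtain ⟨γ, hγ, hs⟩ := h
  rw [hardBack_eq hγ hτ]
  exact ⟨_, hγ.shift hτ, fun u hu => hs _ (by linarith)⟩

/-! ### Conservation of energy -/

/-- A particle has at most one contact, so colliding particles are matched by an involution along
which the energy changes cancel in pairs. Wall reflections are isometric. -/
theorem EventLaw.energy_eq {ε : ℝ} (hε : 0 < ε) {m : ℕ} {W W' : Config d m}
    (h : EventLaw ε W W') : energy W' = energy W := by
  classical
  rw [← sub_eq_zero, energy, energy, ← Finset.sum_sub_distrib]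
  set P : Fin m → Fin m → Prop := fun i j => j ≠ i ∧ ‖(W i).1 - (W j).1‖ = ε with hP
  set g : Fin m → Fin m := fun i => if hi : ∃ j, P i j then hi.choose else i with hg
  have hPsymm : ∀ {i j}, P i j → P j i := fun {i j} hij => ⟨hij.1.symm, by
    rw [norm_sub_rev]; exact hij.2⟩
  have huniq : ∀ {i j l}, P i j → P i l → l = j := by
    intro i j l hij hil
    by_contra hlj
    exact (h.collision i j hij.1.symm hij.2).2.1 l hil.1 hlj hil.2
  have hgP : ∀ {i j}, P i j → g i = j := by
    intro i j hij
    have hi : ∃ j, P i j := ⟨j, hij⟩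
    simp only [hg, dif_pos hi]
    exact huniq hij hi.choose_spec
  have hgN : ∀ {i}, (¬ ∃ j, P i j) → g i = i := by
    intro i hi
    simp only [hg, dif_neg hi]
  have hN : ∀ {i}, (¬ ∃ j, P i j) → ‖(W' i).2‖ ^ 2 - ‖(W i).2‖ ^ 2 = 0 := by
    intro i hi
    by_cases hw : (W i).1 0 = ε / 2
    · rw [(h.wall i hw).2, norm_reflect, sub_self]
    · rw [h.free i hw fun j hj hji => hi ⟨j, hj, hji⟩, sub_self]
  refine Finset.sum_involution (fun i _ => g i) ?_ ?_ (fun _ _ => Finset.mem_univ _) ?_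
  · intro i _
    by_cases hi : ∃ j, P i j
    · obtain ⟨j, hj⟩ := hi
      rw [hgP hj]
      have h1 := (h.collision i j hj.1.symm hj.2).2.2
      have h2 := (h.collision j i hj.1 (hPsymm hj).2).2.2
      set n := (W i).1 - (W j).1 with hn
      set w := (W i).2 - (W j).2 with hw
      have hn' : (W j).1 - (W i).1 = -n := by rw [hn]; abel
      have hw' : (W j).2 - (W i).2 = -w := by rw [hw]; abel
      rw [hn', hw', inner_neg_neg, smul_neg, sub_neg_eq_add] at h2
      rw [h1, h2, norm_sub_sq_real, norm_add_sq_real, inner_smul_right, inner_smul_right, norm_smul,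
        show ‖n‖ = ε from hj.2, mul_pow, Real.norm_eq_abs, sq_abs]
      have hin : inner ℝ w n = inner ℝ (W i).2 n - inner ℝ (W j).2 n := by
        rw [hw, inner_sub_left]
      rw [hin]
      field_simp
      ring
    · rw [hgN hi, hN hi, add_zero]
  · intro i _ hi
    by_cases hi' : ∃ j, P i j
    · obtain ⟨j, hj⟩ := hi'
      rw [hgP hj]; exact hj.1
    · exact absurd (hN hi') hi
  · intro i _
    by_cases hi : ∃ j, P i j
    · obtain ⟨j, hj⟩ := hi
      simp only [hgP hj]
      exact hgP (hPsymm hj)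
    · simp only [hgN hi]

/-- Configurations without a trajectory are left fixed by convention, so conservation holds for
every `Z` and the later energy cutoffs need no case distinction. -/
theorem energy_hardBack {ε : ℝ} (hε : 0 < ε) {m : ℕ} {τ : ℝ} (hτ : 0 ≤ τ) (Z : Config d m) :
    energy (hardBack ε τ Z) = energy Z := by
  by_cases hex : ∃ γ, IsBackwardTrajectory ε Z γ
  · obtain ⟨γ, h⟩ := hex
    rw [hardBack_eq h hτ]
    refine real_induction (P := fun τ => energy (γ τ) = energy Z) ?_ ?_ ?_ τ hτ
    · rw [h.initial]
    · intro τ hτ he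
      obtain ⟨a, ha, hγ⟩ := h.after τ hτ
      refine ⟨a, ha, fun u hu => ?_⟩
      rw [hγ u ⟨hu.1.le, hu.2⟩, ← he]
      rfl
    · intro τ hτ he
      obtain ⟨a, ha, W, hW, hγ⟩ := h.before τ hτ
      have hm : 0 < min a τ := lt_min ha hτ
      have h1 : min a τ / 2 < a := by linarith [min_le_left a τ]
      have h2 : min a τ / 2 < τ := by linarith [min_le_right a τ]
      have := hγ (min a τ / 2) ⟨by linarith, h1⟩
      rw [hW.energy_eq hε, ← he (τ - min a τ / 2) (by linarith) (by linarith), this]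
      rfl
  · rw [hardBack, dif_neg hex]

/-! ### Good hard sphere trajectories -/

/-- Without contacts between particles at positive times, the only events are those with the wall,
and each particle evolves independently. -/
theorem IsBackwardTrajectory.eq_shiftFree {ε : ℝ} {m : ℕ} {Z : Config d m}
    {γ : ℝ → Config d m} (h : IsBackwardTrajectory ε Z γ)
    (hs : ∀ τ, 0 < τ → ∀ i j, i ≠ j → ε < ‖(γ τ i).1 - (γ τ j).1‖) :
    ∀ τ, 0 ≤ τ → γ τ = shiftFree ε τ Z := by
  have hZ : ∀ i, ε / 2 ≤ (Z i).1 0 := by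
    have := (h.mem 0 le_rfl).1
    rwa [h.initial] at this
  refine real_induction ?_ ?_ ?_
  · rw [h.initial]
    funext i
    obtain ⟨a, ha, hγ⟩ := h.after 0 le_rfl
    have h1 := (h.mem (0 + a / 2) (by linarith)).1 i
    rw [hγ (a / 2) ⟨by linarith, by linarith⟩, h.initial] at h1
    simp only [straight, PiLp.add_apply, PiLp.smul_apply, smul_eq_mul] at h1
    -- A particle starting on the wall remains in the phase space just afterwards, which fixes the
    -- sign of its normal velocity and excludes an immediate reflection.
    have : ε / 2 < (Z i).1 0 ∨ ((Z i).1 0 = ε / 2 ∧ (Z i).2 0 ≤ 0) := by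
      rcases (hZ i).eq_or_lt with h' | h'
      · refine Or.inr ⟨h'.symm, ?_⟩
        nlinarith
      · exact Or.inl h'
    simp [shiftFree, shiftFreeParticle, this]
  · intro τ hτ he
    obtain ⟨a, ha, hγ⟩ := h.after τ hτ
    refine ⟨a, ha, fun u hu => ?_⟩
    have hw : ∀ w ∈ Ico 0 a, ∀ i, ε / 2 ≤ ((γ τ i).1 - w • (γ τ i).2) 0 := by
      intro w hw i
      have := (h.mem (τ + w) (by linarith [hw.1])).1 i
      rw [hγ w hw] at this
      simpa [straight, sub_eq_add_neg] using this
    rw [hγ u ⟨hu.1.le, hu.2⟩]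
    funext i
    have h1 := hw u ⟨hu.1.le, hu.2⟩ i
    have h2 := hw ((u + a) / 2) ⟨by linarith [hu.1], by linarith [hu.2]⟩ i
    have h0 := hw 0 ⟨le_rfl, ha⟩ i
    have hZi := hZ i
    rw [he] at h1 h2 h0
    simp only [straight, he]
    simp only [shiftFree, shiftFreeParticle] at h1 h2 h0 ⊢
    by_cases hc : ε / 2 < ((Z i).1 - τ • (Z i).2) 0 ∨
        (((Z i).1 - τ • (Z i).2) 0 = ε / 2 ∧ (Z i).2 0 ≤ 0)
    · simp only [hc, if_true] at h1 h2 h0 ⊢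
      have e : (Z i).1 - τ • (Z i).2 - u • (Z i).2 = (Z i).1 - (τ + u) • (Z i).2 := by module
      have hc' : ε / 2 < ((Z i).1 - (τ + u) • (Z i).2) 0 ∨
          (((Z i).1 - (τ + u) • (Z i).2) 0 = ε / 2 ∧ (Z i).2 0 ≤ 0) := by
        rw [e] at h1
        rcases h1.eq_or_lt with h' | h'
        · refine Or.inr ⟨h'.symm, ?_⟩
          simp only [PiLp.sub_apply, PiLp.smul_apply, smul_eq_mul] at h' h2
          nlinarith [hu.1, hu.2]
        · exact Or.inl h'
      simp only [hc', if_true]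
      refine Prod.ext ?_ rfl
      simp only; module
    · have hc' : ¬ (ε / 2 < ((Z i).1 - (τ + u) • (Z i).2) 0 ∨
          (((Z i).1 - (τ + u) • (Z i).2) 0 = ε / 2 ∧ (Z i).2 0 ≤ 0)) := by
        push Not at hc ⊢
        simp only [PiLp.sub_apply, PiLp.smul_apply, smul_eq_mul] at hc ⊢
        have hv : 0 < (Z i).2 0 := by
          by_contra! hv
          have : τ * (Z i).2 0 ≤ 0 := mul_nonpos_of_nonneg_of_nonpos hτ hv
          have := hc.2 (by linarith [hc.1])
          linarith
        have : 0 < u * (Z i).2 0 := mul_pos hu.1 hv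
        exact ⟨by linarith [hc.1], fun _ => hv⟩
      simp only [hc, hc', if_false]
      refine Prod.ext ?_ rfl
      simp only [reflect_sub, reflect_smul]; module
  · intro τ hτ he
    obtain ⟨a, ha, W, hW, hγ⟩ := h.before τ hτ
    set u := min a τ / 2 with hu
    have hm : 0 < min a τ := lt_min ha hτ
    have hu0 : 0 < u := by rw [hu]; linarith
    have hua : u < a := by rw [hu]; linarith [min_le_left a τ]
    have huτ : u < τ := by rw [hu]; linarith [min_le_right a τ]
    have hWu : straight u W = shiftFree ε (τ - u) Z := by
      rw [← hγ u ⟨hu0, hua⟩]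
      exact he _ (by linarith) (by linarith)
    funext i
    have hWi := congrFun hWu i
    have hpos := hW.position i
    have hwall : ε / 2 ≤ (W i).1 0 := by
      have := (h.mem τ hτ.le).1 i
      rwa [hpos] at this
    have hnc : ∀ j, j ≠ i → ‖(W i).1 - (W j).1‖ ≠ ε := by
      intro j hj
      rw [← hW.position i, ← hW.position j]
      exact (hs τ hτ i j hj.symm).ne'
    have hZi := hZ i
    simp only [straight, shiftFree, shiftFreeParticle] at hWi ⊢
    by_cases hc : ε / 2 < ((Z i).1 - (τ - u) • (Z i).2) 0 ∨
        (((Z i).1 - (τ - u) • (Z i).2) 0 = ε / 2 ∧ (Z i).2 0 ≤ 0)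
    · simp only [hc, if_true, Prod.mk.injEq] at hWi
      have hW1 : (W i).1 = (Z i).1 - τ • (Z i).2 := by
        have := eq_sub_of_add_eq hWi.1
        rw [this, hWi.2]; module
      rcases hwall.eq_or_lt with h' | h'
      · have hv := (hW.wall i h'.symm).2
        rw [hWi.2] at hv
        rw [hW1] at h' hpos
        by_cases hz : (Z i).2 0 ≤ 0
        · rw [if_pos (Or.inr ⟨h'.symm, hz⟩)]
          refine Prod.ext hpos ?_
          rw [hv]
          -- A contact at a positive time with nonpositive normal velocity can only be a sliding
          -- motion along the wall: the normal velocity is zero and the reflection acts trivially.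
          refine reflect_of_coord_eq_zero ?_
          simp only [PiLp.sub_apply, PiLp.smul_apply, smul_eq_mul] at h'
          nlinarith
        · rw [if_neg (by push Not; exact ⟨h'.ge, fun _ => not_le.1 hz⟩)]
          refine Prod.ext ?_ hv
          simp only [hpos, reflect]
          rw [← h']; module
      · rw [hW1] at h'
        rw [if_pos (Or.inl h')]
        refine Prod.ext (hpos.trans hW1) ?_
        rw [hW.free i (by rw [hW1]; exact h'.ne') hnc, hWi.2]
    · simp only [hc, if_false, Prod.mk.injEq] at hWi
      have hW1 : (W i).1 = reflect ((Z i).1 - τ • (Z i).2) + ε • e1 := by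
        have := eq_sub_of_add_eq hWi.1
        rw [this, hWi.2]
        simp only [reflect_sub, reflect_smul]; module
      push Not at hc
      have hlt : ((Z i).1 - τ • (Z i).2) 0 < ε / 2 := by
        simp only [PiLp.sub_apply, PiLp.smul_apply, smul_eq_mul] at hc ⊢
        have hv : 0 < (Z i).2 0 := by
          by_contra! hv
          have : (τ - u) * (Z i).2 0 ≤ 0 :=
            mul_nonpos_of_nonneg_of_nonpos (by linarith) hv
          have := hc.2 (by linarith [hc.1])
          linarith
        have : 0 < u * (Z i).2 0 := mul_pos hu0 hv
        linarith [hc.1]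
      rw [if_neg (by push Not; exact ⟨hlt.le, fun h => absurd h hlt.ne⟩)]
      refine Prod.ext (hpos.trans hW1) ?_
      rw [hW.free i ?_ hnc, hWi.2]
      rw [hW1]
      simp only [PiLp.add_apply, PiLp.smul_apply, reflect_apply_zero, e1_apply_zero, smul_eq_mul,
        mul_one]
      intro hcon
      linarith

/-- This replaces a flow defined by choice by an explicit formula, for which both measurability and
the distance to the Boltzmann flow can be computed. -/
theorem hardBack_eq_shiftFree {ε : ℝ} {m : ℕ} {Z : Config d m} (h : Z ∈ goodHard d ε ε m)
    {τ : ℝ} (hτ : 0 ≤ τ) : hardBack ε τ Z = shiftFree ε τ Z := by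
  obtain ⟨γ, hγ, hs⟩ := h
  rw [hardBack_eq hγ hτ, hγ.eq_shiftFree hs τ hτ]


/-! ### Existence of hard sphere trajectories without collisions -/

theorem shiftFreeParticle_of_reflected {ε τ : ℝ} {z : Particle d}
    (h : ((z.1 - τ • z.2) 0 : ℝ) < ε / 2) :
    shiftFreeParticle ε τ z = (reflect (z.1 - τ • z.2) + ε • e1, reflect z.2) :=
  if_neg (by push Not; exact ⟨h.le, fun h' => absurd h' h.ne⟩)

theorem eventually_shiftFreeParticle_after {ε τ : ℝ} (hτ : 0 ≤ τ) {z : Particle d}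
    (hz : ε / 2 < z.1 0) :
    ∀ᶠ u in 𝓝[≥] (0 : ℝ), shiftFreeParticle ε (τ + u) z =
      ((shiftFreeParticle ε τ z).1 + (-u) • (shiftFreeParticle ε τ z).2,
        (shiftFreeParticle ε τ z).2) := by
  have hcont : Continuous fun u : ℝ => (z.1 - (τ + u) • z.2) 0 := by fun_prop
  by_cases hc : ε / 2 < (z.1 - τ • z.2) 0 ∨ ((z.1 - τ • z.2) 0 = ε / 2 ∧ z.2 0 ≤ 0)
  · have hev : ∀ᶠ u in 𝓝[≥] (0 : ℝ), ε / 2 < (z.1 - (τ + u) • z.2) 0 ∨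
        ((z.1 - (τ + u) • z.2) 0 = ε / 2 ∧ z.2 0 ≤ 0) := by
      rcases hc with h | ⟨h, hv⟩
      · have := (hcont.tendsto 0).eventually (lt_mem_nhds (by simpa using h))
        exact (this.filter_mono nhdsWithin_le_nhds).mono fun u hu => Or.inl hu
      · filter_upwards [self_mem_nhdsWithin] with u hu
        have hu : 0 ≤ u := hu
        have h1 : u * z.2 0 ≤ 0 := mul_nonpos_of_nonneg_of_nonpos hu hv
        simp only [PiLp.sub_apply, PiLp.smul_apply, smul_eq_mul] at h ⊢
        rcases h1.eq_or_lt with h2 | h2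
        · exact Or.inr ⟨by linarith, hv⟩
        · exact Or.inl (by linarith)
    filter_upwards [hev] with u hu
    simp only [shiftFreeParticle, hc, hu, if_true]
    refine Prod.ext ?_ rfl
    simp only; module
  · filter_upwards [self_mem_nhdsWithin] with u hu
    have hu : 0 ≤ u := hu
    have hc' : ¬ (ε / 2 < (z.1 - (τ + u) • z.2) 0 ∨
        ((z.1 - (τ + u) • z.2) 0 = ε / 2 ∧ z.2 0 ≤ 0)) := by
      push Not at hc ⊢
      simp only [PiLp.sub_apply, PiLp.smul_apply, smul_eq_mul] at hc ⊢
      have hv : 0 < z.2 0 := by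
        by_contra! hv
        have : τ * z.2 0 ≤ 0 := mul_nonpos_of_nonneg_of_nonpos hτ hv
        linarith [hc.1]
      have : 0 ≤ u * z.2 0 := mul_nonneg hu hv.le
      exact ⟨by linarith [hc.1], fun _ => hv⟩
    simp only [shiftFreeParticle, hc, hc', if_false]
    refine Prod.ext ?_ rfl
    simp only [reflect_sub, reflect_smul]; module

open Classical in
/-- Left limit of the shifted free flow. -/
noncomputable def shiftFreeBefore (ε τ : ℝ) (z : Particle d) : Particle d :=
  if ε / 2 ≤ (z.1 - τ • z.2) 0 then (z.1 - τ • z.2, z.2)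
  else (reflect (z.1 - τ • z.2) + ε • e1, reflect z.2)

theorem eventually_shiftFreeParticle_before {ε τ : ℝ} (hτ : 0 < τ) {z : Particle d}
    (hz : ε / 2 < z.1 0) :
    ∀ᶠ u in 𝓝[>] (0 : ℝ), shiftFreeParticle ε (τ - u) z =
      ((shiftFreeBefore ε τ z).1 + u • (shiftFreeBefore ε τ z).2,
        (shiftFreeBefore ε τ z).2) := by
  have hcont : Continuous fun u : ℝ => (z.1 - (τ - u) • z.2) 0 := by fun_prop
  by_cases hc : ε / 2 ≤ (z.1 - τ • z.2) 0
  · filter_upwards [Ioo_mem_nhdsGT hτ] with u hu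
    have hlt : ε / 2 < (z.1 - (τ - u) • z.2) 0 := by
      simp only [PiLp.sub_apply, PiLp.smul_apply, smul_eq_mul] at hc ⊢
      -- The coordinate at time `τ - u` is the convex combination, with weights `u / τ` and `(τ - u)
      -- / τ`, of the coordinates at times `0` and `τ` of the unreflected line.
      nlinarith [mul_pos hu.1 (sub_pos.2 hz), mul_nonneg (sub_nonneg.2 hu.2.le) (sub_nonneg.2 hc)]
    simp only [shiftFreeParticle, shiftFreeBefore, hc, hlt, if_true, true_or]
    refine Prod.ext ?_ rfl
    simp only; module
  · have := (hcont.tendsto 0).eventually (gt_mem_nhds (by simpa using hc))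
    filter_upwards [this.filter_mono nhdsWithin_le_nhds] with u hu
    rw [shiftFreeParticle_of_reflected hu]
    simp only [shiftFreeBefore, hc, if_false]
    refine Prod.ext ?_ rfl
    simp only [reflect_sub, reflect_smul]; module

theorem shiftFreeBefore_fst {ε τ : ℝ} (z : Particle d) :
    (shiftFreeParticle ε τ z).1 = (shiftFreeBefore ε τ z).1 := by
  by_cases h1 : ε / 2 < (z.1 - τ • z.2) 0
  · simp only [shiftFreeParticle, shiftFreeBefore, h1, h1.le, true_or, if_true]
  · by_cases h2 : (z.1 - τ • z.2) 0 = ε / 2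
    · have : reflect (z.1 - τ • z.2) + ε • e1 = z.1 - τ • z.2 := by
        rw [reflect, h2]; module
      simp only [shiftFreeParticle, shiftFreeBefore, h2.ge, if_true]
      split_ifs
      · rfl
      · exact this
    · have h3 : (z.1 - τ • z.2) 0 < ε / 2 := lt_of_le_of_ne (not_lt.1 h1) h2
      rw [shiftFreeParticle_of_reflected h3, shiftFreeBefore, if_neg (not_le.2 h3)]

/-- Converse of the preceding identification: the explicit flow is itself an admissible trajectory
once it keeps particles more than `ε` apart. Starting strictly off the wall guarantees a positive
normal velocity at every contact, hence a genuine reflection. -/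
theorem mem_goodHard_of_shiftFree {ε : ℝ} {m : ℕ} {Z : Config d m}
    (hZ : ∀ i, ε / 2 < (Z i).1 0)
    (hs : ∀ τ, 0 ≤ τ → ∀ i j, i ≠ j → ε < ‖(shiftFree ε τ Z i).1 - (shiftFree ε τ Z j).1‖) :
    Z ∈ goodHard d ε ε m := by
  refine ⟨fun τ => shiftFree ε τ Z, ⟨?_, ?_, ?_, ?_⟩, fun τ hτ => hs τ hτ.le⟩
  · funext i
    simp [shiftFree, shiftFreeParticle, hZ i]
  · exact fun τ hτ => ⟨fun i => le_coord_shiftFreeParticle _ _ _,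
      fun i j hij => (hs τ hτ i j hij).le⟩
  · intro τ hτ
    have := eventually_all.2 fun i => eventually_shiftFreeParticle_after hτ (hZ i)
    obtain ⟨h, hh, hsub⟩ := (mem_nhdsGE_iff_exists_Ico_subset).1 this
    exact ⟨h, hh, fun u hu => funext fun i => hsub hu i⟩
  · intro τ hτ
    have := eventually_all.2 fun i => eventually_shiftFreeParticle_before hτ (hZ i)
    obtain ⟨h, hh, hsub⟩ := (mem_nhdsGT_iff_exists_Ioo_subset).1 this
    refine ⟨h, hh, fun i => shiftFreeBefore ε τ (Z i), ?_, fun u hu => funext fun i => hsub hu i⟩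
    have hnc : ∀ i j, i ≠ j →
        ‖(shiftFreeBefore ε τ (Z i)).1 - (shiftFreeBefore ε τ (Z j)).1‖ ≠ ε := by
      intro i j hij
      rw [← shiftFreeBefore_fst, ← shiftFreeBefore_fst]
      exact (hs τ hτ.le i j hij).ne'
    refine ⟨fun i => shiftFreeBefore_fst _, ?_, ?_, fun i j hij hc => absurd hc (hnc i j hij)⟩
    · intro i hi _
      rw [← shiftFreeBefore_fst] at hi
      by_cases h1 : ε / 2 < ((Z i).1 - τ • (Z i).2) 0
      · simp only [shiftFree, shiftFreeParticle, shiftFreeBefore, h1, h1.le, true_or, if_true]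
      · by_cases h2 : ((Z i).1 - τ • (Z i).2) 0 = ε / 2
        · rw [shiftFreeBefore_fst] at hi
          simp only [shiftFreeBefore, h2.ge, if_true] at hi
          exact absurd h2 hi
        · have h3 := lt_of_le_of_ne (not_lt.1 h1) h2
          rw [shiftFree, shiftFreeParticle_of_reflected h3, shiftFreeBefore,
            if_neg (not_le.2 h3)]
    · intro i hi
      refine ⟨fun j hj => hnc i j hj.symm, ?_⟩
      by_cases h1 : ε / 2 ≤ ((Z i).1 - τ • (Z i).2) 0
      · simp only [shiftFreeBefore, h1, if_true] at hi ⊢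
        have hv : 0 < (Z i).2 0 := by
          have := hZ i
          simp only [PiLp.sub_apply, PiLp.smul_apply, smul_eq_mul] at hi
          by_contra! hv
          nlinarith
        rw [shiftFree, shiftFreeParticle, if_neg]
        push Not
        exact ⟨hi.le, fun _ => hv⟩
      · simp only [shiftFreeBefore, h1, if_false, PiLp.add_apply, PiLp.smul_apply,
          reflect_apply_zero, e1_apply_zero, smul_eq_mul, mul_one] at hi
        exact absurd (by linarith) h1

/-! ### Uniform separation on compact sets -/

/-- Strict Cauchy–Schwarz, whose equality case is collinearity. -/
theorem sq_inner_lt_of_notMem_span {E : Type*} [NormedAddCommGroup E] [InnerProductSpace ℝ E]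
    {p w : E} (hp : p ≠ 0) (h : w ∉ Submodule.span ℝ {p}) :
    0 < ‖p‖ ^ 2 * ‖w‖ ^ 2 - (inner ℝ p w) ^ 2 ∧ 0 < ‖w‖ := by
  have hw : w ≠ 0 := fun h0 => h (h0 ▸ Submodule.zero_mem _)
  refine ⟨?_, by positivity⟩
  have h1 := abs_real_inner_le_norm p w
  have h2 : |inner ℝ p w| ≠ ‖p‖ * ‖w‖ := by
    intro h3
    obtain ⟨-, r, -, hr⟩ := (abs_real_inner_div_norm_mul_norm_eq_one_iff p w).1 (by
      rw [abs_div, h3, abs_of_nonneg (by positivity : 0 ≤ ‖p‖ * ‖w‖)]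
      exact div_self (by positivity))
    exact h (hr ▸ Submodule.smul_mem _ _ (Submodule.mem_span_singleton_self p))
  have h3 := lt_of_le_of_ne h1 h2
  nlinarith [sq_abs (inner ℝ p w), abs_nonneg (inner ℝ p w)]

/-- Lines avoiding the origin stay uniformly away from it when their parameters vary in a compact
set. -/
theorem exists_le_norm_sub_smul {X E : Type*} [TopologicalSpace X] [NormedAddCommGroup E]
    [InnerProductSpace ℝ E] {K : Set X} (hK : IsCompact K) {p w : X → E} (hp : ContinuousOn p K)
    (hw : ContinuousOn w K) (h0 : ∀ x ∈ K, p x ≠ 0)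
    (h : ∀ x ∈ K, w x ∉ Submodule.span ℝ {p x}) :
    ∃ c > 0, ∀ x ∈ K, ∀ τ : ℝ, c ≤ ‖p x - τ • w x‖ := by
  have hpos := fun x hx => sq_inner_lt_of_notMem_span (h0 x hx) (h x hx)
  -- The minimized quantity is the Gram determinant divided by `‖w‖²`, that is, the squared distance
  -- from the origin to the line `p + ℝ w`.
  obtain ⟨c, hc, hle⟩ := hK.exists_forall_le' (a := 0)
    (f := fun x => (‖p x‖ ^ 2 * ‖w x‖ ^ 2 - (inner ℝ (p x) (w x)) ^ 2) / ‖w x‖ ^ 2)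
    (ContinuousOn.div (by fun_prop) (by fun_prop) fun x hx => (pow_pos (hpos x hx).2 2).ne')
    fun x hx => div_pos (hpos x hx).1 (pow_pos (hpos x hx).2 2)
  refine ⟨Real.sqrt c, Real.sqrt_pos.2 hc, fun x hx τ => ?_⟩
  refine Real.sqrt_le_iff.2 ⟨norm_nonneg _, (hle x hx).trans ?_⟩
  rw [div_le_iff₀ (pow_pos (hpos x hx).2 2), norm_sub_sq_real, inner_smul_right, norm_smul, mul_pow,
    Real.norm_eq_abs, sq_abs]
  nlinarith [sq_nonneg (τ * ‖w x‖ ^ 2 - inner ℝ (p x) (w x))]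

/-- The two non-collinearity conditions defining `convergenceDomain` say that the relative lines of
a pair, direct and with one particle reflected, avoid the origin. Compactness makes the distances
uniform over all times. -/
theorem exists_uniform_separation {m : ℕ} {K : Set (Config d m)} (hK : IsCompact K)
    (hKΩ : K ⊆ convergenceDomain d m) :
    ∃ c > 0, ∀ Z ∈ K, (∀ i, c ≤ (Z i).1 0) ∧ ∀ i j, i ≠ j → ∀ τ : ℝ,
      c ≤ ‖((Z i).1 - τ • (Z i).2) - ((Z j).1 - τ • (Z j).2)‖ ∧
      c ≤ ‖reflect ((Z i).1 - τ • (Z i).2) - ((Z j).1 - τ • (Z j).2)‖ := by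
  have hr := continuous_reflect (d := d)
  have h1 : ∀ i : Fin m, ∀ᶠ c in 𝓝[>] (0 : ℝ), ∀ Z ∈ K, c ≤ (Z i).1 0 := by
    intro i
    obtain ⟨c, hc, hle⟩ := hK.exists_forall_le' (a := 0) (f := fun Z => (Z i).1 0)
      (by fun_prop) fun Z hZ => (hKΩ hZ).1 i
    filter_upwards [Ioo_mem_nhdsGT hc] with b hb Z hZ using hb.2.le.trans (hle Z hZ)
  have h2 : ∀ i j : Fin m, ∀ᶠ c in 𝓝[>] (0 : ℝ), ∀ Z ∈ K, i ≠ j → ∀ τ : ℝ,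
      c ≤ ‖((Z i).1 - τ • (Z i).2) - ((Z j).1 - τ • (Z j).2)‖ ∧
      c ≤ ‖reflect ((Z i).1 - τ • (Z i).2) - ((Z j).1 - τ • (Z j).2)‖ := by
    intro i j
    by_cases hij : i = j
    · exact Eventually.of_forall fun c Z _ h => absurd hij h
    have hneg : ∀ {a b : Space d} {S : Submodule ℝ (Space d)}, a - b ∉ S → b - a ∉ S :=
      fun h h' => h (by simpa using neg_mem h')
    obtain ⟨c₁, hc₁, hle₁⟩ := exists_le_norm_sub_smul hK (p := fun Z => (Z i).1 - (Z j).1)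
      (w := fun Z => (Z i).2 - (Z j).2) (by fun_prop) (by fun_prop)
      (fun Z hZ => sub_ne_zero.2 ((hKΩ hZ).2.1 i j hij))
      (fun Z hZ => hneg ((hKΩ hZ).2.2.2.1 i j hij))
    obtain ⟨c₂, hc₂, hle₂⟩ := exists_le_norm_sub_smul hK
      (p := fun Z => reflect (Z i).1 - (Z j).1)
      (w := fun Z => reflect (Z i).2 - (Z j).2)
      (by fun_prop) (by fun_prop)
      (fun Z hZ h0 => by
        have h3 := congrArg (fun x : Space d => x 0) h0
        have h4 : 0 < (Z i).1 0 := (hKΩ hZ).1 i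
        have h5 : 0 < (Z j).1 0 := (hKΩ hZ).1 j
        simp only [PiLp.sub_apply, reflect_apply_zero, PiLp.zero_apply] at h3
        linarith)
      (fun Z hZ => hneg ((hKΩ hZ).2.2.2.2 i j hij))
    filter_upwards [Ioo_mem_nhdsGT hc₁, Ioo_mem_nhdsGT hc₂] with b hb₁ hb₂ Z hZ _ τ
    refine ⟨(hb₁.2.le.trans (hle₁ Z hZ τ)).trans_eq ?_, (hb₂.2.le.trans (hle₂ Z hZ τ)).trans_eq ?_⟩
    · congr 1; module
    · rw [reflect_sub, reflect_smul]; congr 1; module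
  have h3 := (eventually_all.2 h1).and (eventually_all.2 fun i => eventually_all.2 fun j => h2 i j)
  obtain ⟨c, ⟨hc1, hc2⟩, hc⟩ := (h3.and self_mem_nhdsWithin).exists
  exact ⟨c, hc, fun Z hZ => ⟨fun i => hc1 i Z hZ, fun i j => hc2 i j Z hZ⟩⟩

/-- Each particle may or may not have been reflected. As `reflect` is an isometric involution, the
four cases reduce to two. -/
theorem le_norm_sub_of_eq_or_reflect {c : ℝ} {y y' x x' : Space d} (h1 : c ≤ ‖y - y'‖)
    (h2 : c ≤ ‖reflect y - y'‖) (hx : x = y ∨ x = reflect y) (hx' : x' = y' ∨ x' = reflect y') :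
    c ≤ ‖x - x'‖ := by
  rcases hx with rfl | rfl <;> rcases hx' with rfl | rfl
  · exact h1
  · rwa [← norm_reflect_sub_reflect, reflect_reflect]
  · exact h2
  · rwa [norm_reflect_sub_reflect]

theorem freeBackParticle_fst (τ : ℝ) (z : Particle d) :
    (freeBackParticle τ z).1 = z.1 - τ • z.2 ∨
      (freeBackParticle τ z).1 = reflect (z.1 - τ • z.2) := by
  unfold freeBackParticle; split_ifs <;> simp

theorem exists_norm_shiftFreeParticle_fst_sub_le {ε : ℝ} (hε : 0 ≤ ε) (τ : ℝ) (z : Particle d) :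
    ∃ x, (x = z.1 - τ • z.2 ∨ x = reflect (z.1 - τ • z.2)) ∧
      ‖(shiftFreeParticle ε τ z).1 - x‖ ≤ ε := by
  unfold shiftFreeParticle
  split_ifs
  · exact ⟨_, Or.inl rfl, by simpa using hε⟩
  · refine ⟨_, Or.inr rfl, ?_⟩
    rw [add_sub_cancel_left, norm_smul, norm_e1, mul_one, Real.norm_eq_abs, abs_of_nonneg hε]

/-- For configurations in a compact subset of the domain, the backward free flow keeps the
particles apart, and the backward hard sphere flow is free of collisions. -/
theorem exists_good_threshold {m : ℕ} {K : Set (Config d m)} (hK : IsCompact K)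
    (hKΩ : K ⊆ convergenceDomain d m) :
    ∃ c > 0, ∀ Z ∈ K, (∀ τ i j, i ≠ j → c ≤ ‖(freeBack τ Z i).1 - (freeBack τ Z j).1‖) ∧
      ∀ ε, 0 < ε → ε ≤ c → Z ∈ goodHard d ε ε m := by
  obtain ⟨c, hc, h⟩ := exists_uniform_separation hK hKΩ
  -- Each position in the shifted flow is within `ε` of the line or of its mirror image, so two
  -- particles stay at distance at least `c - 2 * ε`, which exceeds `ε` when `ε ≤ c / 4`.
  refine ⟨c / 4, by positivity, fun Z hZ => ⟨fun τ i j hij => ?_, fun ε hε hεc => ?_⟩⟩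
  · obtain ⟨h1, h2⟩ := (h Z hZ).2 i j hij τ
    have := le_norm_sub_of_eq_or_reflect h1 h2 (freeBackParticle_fst τ (Z i))
      (freeBackParticle_fst τ (Z j))
    exact le_trans (by linarith) this
  · refine mem_goodHard_of_shiftFree (fun i => ?_) fun τ _ i j hij => ?_
    · linarith [(h Z hZ).1 i]
    · obtain ⟨h1, h2⟩ := (h Z hZ).2 i j hij τ
      obtain ⟨x, hx, hxl⟩ := exists_norm_shiftFreeParticle_fst_sub_le hε.le τ (Z i)
      obtain ⟨x', hx', hxl'⟩ := exists_norm_shiftFreeParticle_fst_sub_le hε.le τ (Z j)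
      have h3 := le_norm_sub_of_eq_or_reflect h1 h2 hx hx'
      have h4 : ‖x - x'‖ ≤ ‖(shiftFree ε τ Z i).1 - x‖ +
          ‖(shiftFree ε τ Z i).1 - (shiftFree ε τ Z j).1‖ + ‖(shiftFree ε τ Z j).1 - x'‖ := by
        have : x - x' = -((shiftFree ε τ Z i).1 - x) +
          ((shiftFree ε τ Z i).1 - (shiftFree ε τ Z j).1) + ((shiftFree ε τ Z j).1 - x') := by abel
        rw [this]
        refine (norm_add₃_le).trans_eq ?_
        rw [norm_neg]
      have h5 : ‖(shiftFree ε τ Z i).1 - x‖ ≤ ε := hxl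
      have h6 : ‖(shiftFree ε τ Z j).1 - x'‖ ≤ ε := hxl'
      linarith

/-- A line starting off the wall meets it at most once. Since `goodFree` lives in the open
half-space, the adjunction times at which a particle is on the wall have to be discarded. -/
theorem ae_freeBackParticle_mem_openPhase {z : Particle d} (hz : z ∈ openPhase d) :
    ∀ᵐ τ : ℝ, freeBackParticle τ z ∈ openPhase d := by
  have hz : 0 < z.1 0 := hz
  have hsub : {τ : ℝ | z.1 0 = τ * z.2 0}.Subsingleton := by
    intro a ha b hb
    have ha : z.1 0 = a * z.2 0 := ha
    have hb : z.1 0 = b * z.2 0 := hb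
    have : z.2 0 ≠ 0 := fun h => by rw [h, mul_zero] at ha; linarith
    exact mul_right_cancel₀ this (ha.symm.trans hb)
  have hnull := hsub.countable.measure_zero (volume : Measure ℝ)
  filter_upwards [measure_eq_zero_iff_ae_notMem.1 hnull] with τ hτ
  have hτ : z.1 0 ≠ τ * z.2 0 := hτ
  unfold freeBackParticle openPhase
  split_ifs with h
  · simp only [PiLp.sub_apply, PiLp.smul_apply, smul_eq_mul, mem_ofPred_eq] at h ⊢
    exact lt_of_le_of_ne h fun h' => hτ (by linarith)
  · simp only [PiLp.sub_apply, PiLp.smul_apply, smul_eq_mul, mem_ofPred_eq,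
      reflect_apply_zero] at h ⊢
    linarith

/-! ### Divergence of the two pseudo-trajectories of one particle -/

/-- The velocities coincide up to the reflection, and the positions are at distance at most `r`
after the same reflection. -/
def NearUpToReflection (r : ℝ) (z w : Particle d) : Prop :=
  (w.2 = z.2 ∧ ‖w.1 - z.1‖ ≤ r) ∨ (w.2 = reflect z.2 ∧ ‖w.1 - reflect z.1‖ ≤ r)

theorem NearUpToReflection.mono {r r' : ℝ} {z w : Particle d} (h : NearUpToReflection r z w)
    (hr : r ≤ r') : NearUpToReflection r' z w :=
  h.imp (fun h => ⟨h.1, h.2.trans hr⟩) fun h => ⟨h.1, h.2.trans hr⟩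

theorem NearUpToReflection.norm_snd {r : ℝ} {z w : Particle d} (h : NearUpToReflection r z w) :
    ‖w.2‖ = ‖z.2‖ := by
  rcases h with h | h <;> rw [h.1]
  rw [norm_reflect]

/-- Reflecting one of two points lying on the same side adds `4 * (x 0 * y 0)` to the squared
distance. -/
theorem norm_sub_le_norm_sub_reflect {x y : Space d} (hx : 0 ≤ x 0) (hy : 0 ≤ y 0) :
    ‖y - x‖ ≤ ‖y - reflect x‖ := by
  have hi : inner ℝ (y - x) (e1 : Space d) = y 0 - x 0 := by
    simp [e1, EuclideanSpace.inner_single_right]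
  have h : ‖y - reflect x‖ ^ 2 = ‖y - x‖ ^ 2 + 4 * (x 0 * y 0) := by
    rw [show y - reflect x = (y - x) + (2 * x 0) • e1 by rw [reflect]; module, norm_add_sq_real,
      inner_smul_right, hi, norm_smul, norm_e1, mul_one, Real.norm_eq_abs, sq_abs]
    ring
  refine (pow_le_pow_iff_left₀ (norm_nonneg _) (norm_nonneg _) two_ne_zero).1 ?_
  rw [h]
  have := mul_nonneg hx hy
  linarith

theorem NearUpToReflection.norm_fst_sub_le {r : ℝ} {z w : Particle d}
    (h : NearUpToReflection r z w) (hz : 0 ≤ z.1 0) (hw : 0 ≤ w.1 0) : ‖w.1 - z.1‖ ≤ r := by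
  rcases h with h | h
  · exact h.2
  · exact (norm_sub_le_norm_sub_reflect hz hw).trans h.2

/-- In the reflected alternative, `w` would lie within `r` of a point at depth more than `r` behind
the wall, hence outside the half-space. This is what makes the collision kernels equal away from the
wall. -/
theorem NearUpToReflection.snd_eq {r : ℝ} {z w : Particle d}
    (h : NearUpToReflection r z w) (hz : r < z.1 0) (hw : 0 ≤ w.1 0) : w.2 = z.2 := by
  rcases h with h | h
  · exact h.1
  · exfalso
    have h1 := (abs_coord_le_norm (w.1 - reflect z.1)).trans h.2
    rw [PiLp.sub_apply, reflect_apply_zero] at h1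
    linarith [le_abs_self (w.1 0 - -z.1 0)]

/-- The unfolded lines are parallel after the same reflection, so their distance does not grow with
time. Only the translation `ε • e1` of the mirror adds to it. The two particles may reflect at
different times, which merely switches the alternative. -/
theorem NearUpToReflection.flow {ε r : ℝ} (hε : 0 ≤ ε) {z w : Particle d}
    (h : NearUpToReflection r z w) (τ : ℝ) :
    NearUpToReflection (r + ε) (freeBackParticle τ z) (shiftFreeParticle ε τ w) := by
  have hadd : ∀ x : Space d, ‖x‖ ≤ r → ‖x + ε • e1‖ ≤ r + ε := fun x hx => by
    refine (norm_add_le _ _).trans (add_le_add hx ?_)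
    rw [norm_smul, norm_e1, mul_one, Real.norm_eq_abs, abs_of_nonneg hε]
  have hsub : ∀ x y : Space d, x + ε • e1 - y = (x - y) + ε • e1 := fun x y => by abel
  unfold freeBackParticle shiftFreeParticle NearUpToReflection
  rcases h with ⟨hv, hx⟩ | ⟨hv, hx⟩
  · have hy : ‖(w.1 - τ • w.2) - (z.1 - τ • z.2)‖ ≤ r := by
      rw [hv, sub_sub_sub_cancel_right]; exact hx
    have hy' : ‖reflect (w.1 - τ • w.2) - reflect (z.1 - τ • z.2)‖ ≤ r := by
      rwa [norm_reflect_sub_reflect]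
    split_ifs
    · exact Or.inl ⟨hv, hy.trans (by linarith)⟩
    · exact Or.inr ⟨by rw [hv, reflect_reflect], by rw [reflect_reflect]; exact hy.trans (by linarith)⟩
    · exact Or.inr ⟨by rw [hv], by rw [hsub]; exact hadd _ hy'⟩
    · exact Or.inl ⟨by rw [hv], by rw [hsub]; exact hadd _ hy'⟩
  · have hy : ‖(w.1 - τ • w.2) - reflect (z.1 - τ • z.2)‖ ≤ r := by
      rw [hv, reflect_sub, reflect_smul, sub_sub_sub_cancel_right]; exact hx
    have hy' : ‖reflect (w.1 - τ • w.2) - (z.1 - τ • z.2)‖ ≤ r := by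
      rwa [← norm_reflect_sub_reflect, reflect_reflect]
    split_ifs
    · exact Or.inr ⟨hv, hy.trans (by linarith)⟩
    · exact Or.inl ⟨by rw [hv], hy.trans (by linarith)⟩
    · exact Or.inl ⟨by rw [hv, reflect_reflect], by rw [hsub]; exact hadd _ hy'⟩
    · exact Or.inr ⟨by rw [hv], by rw [hsub, reflect_reflect]; exact hadd _ hy'⟩

/-! ### Adjunctions -/

theorem adjoin_castSucc {d m : ℕ} (r : ℝ) (σ : ℤˣ) (j : Fin m) (p : AdjParam d) (Z : Config d m)
    (i : Fin m) : adjoin r σ j p Z i.castSucc =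
      if σ = 1 ∧ i = j then ((Z j).1, scatterFst (p.1 : Space d) (Z j).2 p.2) else Z i := by
  unfold adjoin
  by_cases hσ : σ = 1
  · simp only [hσ, if_true, Fin.snoc_castSucc, Function.update_apply, true_and]
  · simp only [hσ, if_false, Fin.snoc_castSucc, false_and]

theorem adjoin_last {d m : ℕ} (r : ℝ) (σ : ℤˣ) (j : Fin m) (p : AdjParam d) (Z : Config d m) :
    adjoin r σ j p Z (Fin.last m) = ((Z j).1 + r • (p.1 : Space d),
      if σ = 1 then scatterSnd (p.1 : Space d) (Z j).2 p.2 else p.2) := by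
  unfold adjoin
  split_ifs <;> simp only [Fin.snoc_last]

theorem scatter_energy {d : ℕ} {ω v w : Space d} (hω : ‖ω‖ = 1) :
    ‖scatterFst ω v w‖ ^ 2 + ‖scatterSnd ω v w‖ ^ 2 = ‖v‖ ^ 2 + ‖w‖ ^ 2 := by
  unfold scatterFst scatterSnd
  rw [norm_sub_sq_real, norm_add_sq_real, inner_smul_right, inner_smul_right, norm_smul, hω,
    inner_sub_left, Real.norm_eq_abs, mul_one, sq_abs]
  ring

theorem energy_adjoin {d m : ℕ} (r : ℝ) (σ : ℤˣ) (j : Fin m) (p : AdjParam d) (Z : Config d m) :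
    energy (adjoin r σ j p Z) = energy Z + ‖p.2‖ ^ 2 := by
  have hω : ‖(p.1 : Space d)‖ = 1 := by simp
  unfold energy
  rw [Fin.sum_univ_castSucc, adjoin_last]
  simp only [adjoin_castSucc]
  by_cases hσ : σ = 1
  · simp only [hσ, true_and, if_true]
    rw [← Finset.add_sum_erase _ _ (Finset.mem_univ j),
      ← Finset.add_sum_erase (a := j) (f := fun i => ‖(Z i).2‖ ^ 2) _ (Finset.mem_univ j)]
    have : ∑ i ∈ Finset.univ.erase j, ‖(if i = j then
        ((Z j).1, scatterFst (p.1 : Space d) (Z j).2 p.2) else Z i).2‖ ^ 2 =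
        ∑ i ∈ Finset.univ.erase j, ‖(Z i).2‖ ^ 2 :=
      Finset.sum_congr rfl fun i hi => by rw [if_neg (Finset.ne_of_mem_erase hi)]
    rw [this]
    simp only [if_true]
    linarith [scatter_energy (v := (Z j).2) (w := p.2) hω]
  · simp only [hσ, false_and, if_false]

/-- Exact equality of the velocities of `j` is essential: scattering does not commute with
reflecting a single velocity. The extra `ε` is the offset of the new particle. -/
theorem NearUpToReflection.adjoin {m : ℕ} {r ε : ℝ} (hε : 0 ≤ ε) (σ : ℤˣ) {j : Fin m}
    (p : AdjParam d) {Z W : Config d m} (h : ∀ i, NearUpToReflection r (Z i) (W i))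
    (hv : (W j).2 = (Z j).2) (hx : ‖(W j).1 - (Z j).1‖ ≤ r) (i : Fin (m + 1)) :
    NearUpToReflection (r + ε) (adjoin 0 σ j p Z i) (adjoin ε σ j p W i) := by
  have hω : ‖(p.1 : Space d)‖ = 1 := by simp
  refine Fin.lastCases ?_ (fun i => ?_) i
  · rw [adjoin_last, adjoin_last]
    refine Or.inl ⟨by simp only [hv], ?_⟩
    rw [zero_smul, add_zero, add_sub_right_comm]
    refine (norm_add_le _ _).trans (add_le_add hx ?_)
    rw [norm_smul, hω, mul_one, Real.norm_eq_abs, abs_of_nonneg hε]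
  · rw [adjoin_castSucc, adjoin_castSucc]
    split_ifs
    · exact Or.inl ⟨by simp only [hv], hx.trans (by linarith)⟩
    · exact (h i).mono (by linarith)

theorem adjoin_zero_mem_closedPhase {m : ℕ} (σ : ℤˣ) (j : Fin m) (p : AdjParam d)
    {Z : Config d m} (h : ∀ i, Z i ∈ closedPhase d) (i : Fin (m + 1)) :
    adjoin 0 σ j p Z i ∈ closedPhase d := by
  have hj : 0 ≤ (Z j).1 0 := h j
  refine Fin.lastCases ?_ (fun i => ?_) i
  · rw [adjoin_last]
    simpa [closedPhase] using hj
  · rw [adjoin_castSucc]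
    split_ifs
    · exact hj
    · exact h i


/-! ### Elementary terms along a general flow -/

/-- Integrand of one adjunction: the truncation is evaluated along `Z`, the collision kernel
along `W`. -/
noncomputable def stepIntegrand {m : ℕ} (Φ : ℝ → Config d m → Config d m) (r : ℝ)
    (E : ParamFamily d) (σ : ℤˣ) (j : Fin m)
    (H : ℝ → Config d (m + 1) → Config d (m + 1) → ℝ) (t : ℝ) (Z W : Config d m) (t₁ : ℝ) :
    AdjParam d → ℝ :=
  (E m j (freeBack (t - t₁) Z))ᶜ.indicator fun p =>
    ((σ : ℤ) : ℝ) * signedPart σ (flux j p (Φ (t - t₁) W)) *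
      H t₁ (adjoin 0 σ j p (freeBack (t - t₁) Z)) (adjoin r σ j p (Φ (t - t₁) W))

/-- Integration over the time and the parameters of one adjunction. -/
noncomputable def stepIntegral {m : ℕ} (Φ : ℝ → Config d m → Config d m) (r δ : ℝ)
    (U : TimeFamily d) (E : ParamFamily d) (lo : ℝ) (σ : ℤˣ) (j : Fin m)
    (H : ℝ → Config d (m + 1) → Config d (m + 1) → ℝ) (t : ℝ) (Z W : Config d m) : ℝ :=
  ∫ t₁ in lo..(t - δ), (U m j t Z)ᶜ.indicator
    (fun _ => ∫ p, stepIntegrand Φ r E σ j H t Z W t₁ p ∂adjMeasure d) t₁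

/-- Common form of the Boltzmann and hybrid terms: the truncations are evaluated along `Z`, which
follows the free flow; the rest along `W`, which follows the flow `Φ` with adjunctions at
distance `r`. -/
noncomputable def pseudoTerm (Φ : (m : ℕ) → ℝ → Config d m → Config d m) (r δ : ℝ)
    (U : TimeFamily d) (E : ParamFamily d) (g : (m : ℕ) → Config d m → ℝ) :
    (k : ℕ) → {m : ℕ} → (Fin k → ℤˣ) → Labels m k → ℝ → Config d m → Config d m → ℝ
  | 0, m, _, _, t, _, W => g m (Φ m t W)
  | k + 1, m, M, J, t, Z, W =>
    if ((k : ℝ) + 1) * δ ≤ t then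
      stepIntegral (Φ m) r δ U E (k * δ) (M 0) J.head
        (fun t₁ Z' W' => pseudoTerm Φ r δ U E g k (fun l => M l.succ) J.tail t₁ Z' W') t Z W
    else 0

theorem boltzmannTerm_eq_pseudoTerm (δ : ℝ) (U : TimeFamily d) (E : ParamFamily d)
    (g : (m : ℕ) → Config d m → ℝ) (k : ℕ) {m : ℕ} (M : Fin k → ℤˣ) (J : Labels m k) (t : ℝ)
    (Z : Config d m) :
    boltzmannTerm δ U E g k M J t Z = pseudoTerm (fun _ => freeBack) 0 δ U E g k M J t Z Z := by
  induction k generalizing m t with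
  | zero => rfl
  | succ k ih => simp only [boltzmannTerm, pseudoTerm, stepIntegral, stepIntegrand, ih]

theorem hybridTermAux_eq_pseudoTerm (ε δ : ℝ) (U : TimeFamily d) (E : ParamFamily d)
    (g : (m : ℕ) → Config d m → ℝ) (k : ℕ) {m : ℕ} (M : Fin k → ℤˣ) (J : Labels m k) (t : ℝ)
    (Z W : Config d m) :
    hybridTermAux ε δ U E g k M J t Z W =
      pseudoTerm (fun _ => hardBack ε) ε δ U E g k M J t Z W := by
  induction k generalizing m t with
  | zero => rfl
  | succ k ih => simp only [hybridTermAux, pseudoTerm, stepIntegral, stepIntegrand, ih]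

/-! ### Measurability -/

instance sFinite_adjMeasure (d : ℕ) : SFinite (adjMeasure d) := by
  exact Measure.prod.instSFinite

theorem measurable_coord {d : ℕ} (i : Fin d) : Measurable fun x : Space d => x i :=
  (continuous_coord i).measurable

theorem measurable_freeBackParticle :
    Measurable fun q : ℝ × Particle d => freeBackParticle q.1 q.2 := by
  have hr := (continuous_reflect (d := d)).measurable
  have hx : Measurable fun q : ℝ × Particle d => q.2.1 - q.1 • q.2.2 := by fun_prop
  unfold freeBackParticle
  refine Measurable.ite (measurableSet_le measurable_const ((measurable_coord 0).comp hx))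
    (by fun_prop) (by fun_prop)

theorem measurable_shiftFreeParticle (ε : ℝ) :
    Measurable fun q : ℝ × Particle d => shiftFreeParticle ε q.1 q.2 := by
  have hr := (continuous_reflect (d := d)).measurable
  have hx : Measurable fun q : ℝ × Particle d => q.2.1 - q.1 • q.2.2 := by fun_prop
  have hc := (measurable_coord 0).comp hx
  have hv : Measurable fun q : ℝ × Particle d => q.2.2 0 :=
    (measurable_coord 0).comp (by fun_prop)
  unfold shiftFreeParticle
  refine Measurable.ite ((measurableSet_lt measurable_const hc).union
    ((measurableSet_eq_fun hc measurable_const).inter (measurableSet_le hv measurable_const)))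
    (by fun_prop) (by fun_prop)

theorem measurable_freeBack {m : ℕ} :
    Measurable fun q : ℝ × Config d m => freeBack q.1 q.2 :=
  measurable_pi_lambda _ fun i => measurable_freeBackParticle.comp
    (by fun_prop : Measurable fun q : ℝ × Config d m => (q.1, q.2 i))

theorem measurable_shiftFree (ε : ℝ) {m : ℕ} :
    Measurable fun q : ℝ × Config d m => shiftFree ε q.1 q.2 :=
  measurable_pi_lambda _ fun i => (measurable_shiftFreeParticle ε).comp
    (by fun_prop : Measurable fun q : ℝ × Config d m => (q.1, q.2 i))

theorem measurable_flux {d m : ℕ} (j : Fin m) :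
    Measurable fun q : AdjParam d × Config d m => flux j q.1 q.2 := by
  unfold flux
  exact Measurable.inner (by fun_prop) (by fun_prop)

theorem measurable_adjoin {d m : ℕ} (r : ℝ) (σ : ℤˣ) (j : Fin m) :
    Measurable fun q : AdjParam d × Config d m => adjoin r σ j q.1 q.2 := by
  refine measurable_pi_lambda _ fun i => ?_
  have hin : Measurable fun q : AdjParam d × Config d m =>
      (inner ℝ ((q.2 j).2 - q.1.2) (q.1.1 : Space d) : ℝ) :=
    Measurable.inner (by fun_prop) (by fun_prop)
  refine Fin.lastCases ?_ (fun i => ?_) i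
  · simp only [adjoin_last, scatterSnd]
    split_ifs <;> fun_prop
  · simp only [adjoin_castSucc, scatterFst]
    split_ifs <;> fun_prop

theorem measurable_adjoin_comp {d m : ℕ} {α : Type*} [MeasurableSpace α] (r : ℝ) (σ : ℤˣ)
    (j : Fin m) {f : α → AdjParam d} {Z : α → Config d m} (hf : Measurable f)
    (hZ : Measurable Z) : Measurable fun q => adjoin r σ j (f q) (Z q) :=
  (measurable_adjoin r σ j).comp (hf.prodMk hZ)

theorem measurable_flux_comp {d m : ℕ} {α : Type*} [MeasurableSpace α]
    (j : Fin m) {f : α → AdjParam d} {Z : α → Config d m} (hf : Measurable f)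
    (hZ : Measurable Z) : Measurable fun q => flux j (f q) (Z q) := by
  have h := (measurable_flux j).comp (hf.prodMk hZ)
  exact h

theorem measurable_signedPart (σ : ℤˣ) : Measurable (signedPart σ) := by
  unfold signedPart; fun_prop

theorem measurable_stepIntegrand {m : ℕ} {Φ : ℝ → Config d m → Config d m}
    (hΦ : Measurable fun q : ℝ × Config d m => Φ q.1 q.2) (r : ℝ) {E : ParamFamily d} (σ : ℤˣ)
    (j : Fin m) (hE : MeasurableSet {q : Config d m × AdjParam d | q.2 ∈ E m j q.1})
    {H : ℝ → Config d (m + 1) → Config d (m + 1) → ℝ}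
    (hH : Measurable fun q : ℝ × Config d (m + 1) × Config d (m + 1) => H q.1 q.2.1 q.2.2) :
    Measurable fun q : ((ℝ × Config d m × Config d m) × ℝ) × AdjParam d =>
      stepIntegrand Φ r E σ j H q.1.1.1 q.1.1.2.1 q.1.1.2.2 q.1.2 q.2 := by
  have hZ : Measurable fun q : ((ℝ × Config d m × Config d m) × ℝ) × AdjParam d =>
      freeBack (q.1.1.1 - q.1.2) q.1.1.2.1 := measurable_freeBack.comp
    (by fun_prop : Measurable fun q : ((ℝ × Config d m × Config d m) × ℝ) × AdjParam d =>
      (q.1.1.1 - q.1.2, q.1.1.2.1))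
  have hW : Measurable fun q : ((ℝ × Config d m × Config d m) × ℝ) × AdjParam d =>
      Φ (q.1.1.1 - q.1.2) q.1.1.2.2 := hΦ.comp
    (by fun_prop : Measurable fun q : ((ℝ × Config d m × Config d m) × ℝ) × AdjParam d =>
      (q.1.1.1 - q.1.2, q.1.1.2.2))
  have hmain : Measurable fun q : ((ℝ × Config d m × Config d m) × ℝ) × AdjParam d =>
      ((σ : ℤ) : ℝ) * signedPart σ (flux j q.2 (Φ (q.1.1.1 - q.1.2) q.1.1.2.2)) *
      H q.1.2 (adjoin 0 σ j q.2 (freeBack (q.1.1.1 - q.1.2) q.1.1.2.1))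
        (adjoin r σ j q.2 (Φ (q.1.1.1 - q.1.2) q.1.1.2.2)) := by
    have h1 : Measurable fun q : ((ℝ × Config d m × Config d m) × ℝ) × AdjParam d =>
        flux j q.2 (Φ (q.1.1.1 - q.1.2) q.1.1.2.2) :=
      measurable_flux_comp j measurable_snd hW
    have h2 : Measurable fun q : ((ℝ × Config d m × Config d m) × ℝ) × AdjParam d =>
        adjoin 0 σ j q.2 (freeBack (q.1.1.1 - q.1.2) q.1.1.2.1) :=
      measurable_adjoin_comp 0 σ j measurable_snd hZ
    have h3 : Measurable fun q : ((ℝ × Config d m × Config d m) × ℝ) × AdjParam d =>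
        adjoin r σ j q.2 (Φ (q.1.1.1 - q.1.2) q.1.1.2.2) :=
      measurable_adjoin_comp r σ j measurable_snd hW
    have h4 : Measurable fun q : ((ℝ × Config d m × Config d m) × ℝ) × AdjParam d => q.1.2 :=
      measurable_snd.comp measurable_fst
    have h5 := hH.comp (h4.prodMk (h2.prodMk h3))
    exact (measurable_const.mul ((measurable_signedPart σ).comp h1)).mul h5
  have hS : MeasurableSet {q : ((ℝ × Config d m × Config d m) × ℝ) × AdjParam d |
      q.2 ∈ (E m j (freeBack (q.1.1.1 - q.1.2) q.1.1.2.1))ᶜ} :=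
    (hE.preimage (hZ.prodMk measurable_snd)).compl
  classical
  simp only [stepIntegrand, Set.indicator_apply]
  exact Measurable.ite hS hmain measurable_const

theorem measurable_adjIntegral {m : ℕ} {Φ : ℝ → Config d m → Config d m}
    (hΦ : Measurable fun q : ℝ × Config d m => Φ q.1 q.2) (r : ℝ) {U : TimeFamily d}
    {E : ParamFamily d} (σ : ℤˣ) (j : Fin m)
    (hU : MeasurableSet {q : ℝ × ℝ × Config d m | q.1 ∈ U m j q.2.1 q.2.2})
    (hE : MeasurableSet {q : Config d m × AdjParam d | q.2 ∈ E m j q.1})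
    {H : ℝ → Config d (m + 1) → Config d (m + 1) → ℝ}
    (hH : Measurable fun q : ℝ × Config d (m + 1) × Config d (m + 1) => H q.1 q.2.1 q.2.2) :
    Measurable fun q : (ℝ × Config d m × Config d m) × ℝ =>
      (U m j q.1.1 q.1.2.1)ᶜ.indicator
        (fun _ => ∫ p, stepIntegrand Φ r E σ j H q.1.1 q.1.2.1 q.1.2.2 q.2 p ∂adjMeasure d)
        q.2 := by
  have h1 := ((measurable_stepIntegrand hΦ r σ j hE hH).stronglyMeasurable.integral_prod_right'
    (ν := adjMeasure d)).measurable
  have hS : MeasurableSet {q : (ℝ × Config d m × Config d m) × ℝ |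
      q.2 ∈ (U m j q.1.1 q.1.2.1)ᶜ} :=
    (hU.preimage (by fun_prop : Measurable fun q : (ℝ × Config d m × Config d m) × ℝ =>
      (q.2, q.1.1, q.1.2.1))).compl
  classical
  simp only [Set.indicator_apply]
  exact Measurable.ite hS h1 measurable_const

theorem measurable_stepIntegral {m : ℕ} {Φ : ℝ → Config d m → Config d m}
    (hΦ : Measurable fun q : ℝ × Config d m => Φ q.1 q.2) (r δ : ℝ) {U : TimeFamily d}
    {E : ParamFamily d} (lo : ℝ) (σ : ℤˣ) (j : Fin m)
    (hU : MeasurableSet {q : ℝ × ℝ × Config d m | q.1 ∈ U m j q.2.1 q.2.2})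
    (hE : MeasurableSet {q : Config d m × AdjParam d | q.2 ∈ E m j q.1})
    {H : ℝ → Config d (m + 1) → Config d (m + 1) → ℝ}
    (hH : Measurable fun q : ℝ × Config d (m + 1) × Config d (m + 1) => H q.1 q.2.1 q.2.2) :
    Measurable fun q : ℝ × Config d m × Config d m =>
      stepIntegral Φ r δ U E lo σ j H q.1 q.2.1 q.2.2 := by
  have h1 := measurable_adjIntegral hΦ r σ j hU hE hH
  -- The endpoint of integration depends on the parameter `t`. Putting it in an indicator turns this
  -- into an integral over a fixed space.
  have key : ∀ a b : ℝ × Config d m × Config d m → ℝ, Measurable a → Measurable b →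
      Measurable fun q : ℝ × Config d m × Config d m => ∫ t₁ in Ioc (a q) (b q),
        (U m j q.1 q.2.1)ᶜ.indicator
        (fun _ => ∫ p, stepIntegrand Φ r E σ j H q.1 q.2.1 q.2.2 t₁ p ∂adjMeasure d) t₁ := by
    intro a b ha hb
    simp_rw [← integral_indicator measurableSet_Ioc]
    have hS : MeasurableSet {q : (ℝ × Config d m × Config d m) × ℝ |
        q.2 ∈ Ioc (a q.1) (b q.1)} :=
      (measurableSet_lt (ha.comp measurable_fst) measurable_snd).inter
        (measurableSet_le measurable_snd (hb.comp measurable_fst))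
    exact ((h1.indicator hS).stronglyMeasurable.integral_prod_right' (ν := volume)).measurable
  unfold stepIntegral intervalIntegral
  exact (key _ _ (by fun_prop) (by fun_prop)).sub (key _ _ (by fun_prop) (by fun_prop))

/-- Measurability, with the Gaussian bounds, gives the integrability required to write a difference
of integrals as the integral of the difference. -/
theorem measurable_pseudoTerm {Φ : (m : ℕ) → ℝ → Config d m → Config d m}
    (hΦ : ∀ m, Measurable fun q : ℝ × Config d m => Φ m q.1 q.2) (r δ : ℝ) {U : TimeFamily d}
    {E : ParamFamily d}
    (hU : ∀ m (j : Fin m), MeasurableSet {q : ℝ × ℝ × Config d m | q.1 ∈ U m j q.2.1 q.2.2})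
    (hE : ∀ m (j : Fin m), MeasurableSet {q : Config d m × AdjParam d | q.2 ∈ E m j q.1})
    {g : (m : ℕ) → Config d m → ℝ} (hg : ∀ m, Measurable (g m)) (k : ℕ) {m : ℕ}
    (M : Fin k → ℤˣ) (J : Labels m k) :
    Measurable fun q : ℝ × Config d m × Config d m =>
      pseudoTerm Φ r δ U E g k M J q.1 q.2.1 q.2.2 := by
  induction k generalizing m with
  | zero =>
    exact (hg m).comp ((hΦ m).comp (by fun_prop :
      Measurable fun q : ℝ × Config d m × Config d m => (q.1, q.2.2)))
  | succ k ih =>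
    simp only [pseudoTerm]
    exact Measurable.ite (measurableSet_le measurable_const measurable_fst)
      (measurable_stepIntegral (hΦ m) r δ _ _ _ (hU m _) (hE m _) (ih _ _)) measurable_const

/-! ### Gaussian bounds -/

theorem integrable_exp_neg_mul_norm_sq {d : ℕ} {b : ℝ} (hb : 0 < b) :
    Integrable (fun p : AdjParam d => Real.exp (-b * ‖p.2‖ ^ 2)) (adjMeasure d) := by
  have h1 : Integrable (fun v : Space d => Real.exp (-b * ‖v‖ ^ 2)) := by
    have := (GaussianFourier.integrable_cexp_neg_mul_sq_norm_add (V := Space d) (b := (b : ℂ))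
      (by simpa using hb) 0 0).norm
    refine this.congr (Eventually.of_forall fun v => ?_)
    simp [Complex.norm_exp, ← Complex.ofReal_pow]
  exact h1.comp_snd _

/-- Bound on one integration over the adjunction parameters with Gaussian weight `b`. -/
noncomputable def stepConst (d : ℕ) (b : ℝ) : ℝ :=
  (1 + 1 / b) * ∫ p : AdjParam d, Real.exp (-(b / 2) * ‖p.2‖ ^ 2) ∂adjMeasure d

theorem stepConst_nonneg {d : ℕ} {b : ℝ} (hb : 0 < b) : 0 ≤ stepConst d b :=
  mul_nonneg (by positivity) (integral_nonneg fun _ => (Real.exp_pos _).le)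

/-- Half of the Gaussian decay absorbs the linear growth of the collision kernel, so every
adjunction halves the weight. -/
theorem add_mul_exp_le {b : ℝ} (hb : 0 < b) {x y : ℝ} :
    (x + y) * Real.exp (-b * (x ^ 2 + y ^ 2)) ≤
      (1 + 1 / b) * Real.exp (-(b / 2) * (x ^ 2 + y ^ 2)) := by
  have h1 : x + y ≤ (1 + 1 / b) * (1 + b / 2 * (x ^ 2 + y ^ 2)) := by
    have : (1 + 1 / b) * (1 + b / 2 * (x ^ 2 + y ^ 2)) =
        1 + (x ^ 2 + y ^ 2) / 2 + (1 / b + b / 2 * (x ^ 2 + y ^ 2)) := by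
      field_simp; ring
    have h2 : 0 ≤ 1 / b + b / 2 * (x ^ 2 + y ^ 2) := by positivity
    rw [this]
    nlinarith [sq_nonneg (x - 1), sq_nonneg (y - 1)]
  have h2 : 1 + b / 2 * (x ^ 2 + y ^ 2) ≤ Real.exp (b / 2 * (x ^ 2 + y ^ 2)) := by
    linarith [Real.add_one_le_exp (b / 2 * (x ^ 2 + y ^ 2))]
  have h3 : Real.exp (b / 2 * (x ^ 2 + y ^ 2)) * Real.exp (-b * (x ^ 2 + y ^ 2)) =
      Real.exp (-(b / 2) * (x ^ 2 + y ^ 2)) := by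
    rw [← Real.exp_add]; congr 1; ring
  rw [← h3, ← mul_assoc]
  refine mul_le_mul_of_nonneg_right (h1.trans ?_) (Real.exp_pos _).le
  exact mul_le_mul_of_nonneg_left h2 (by positivity)

/-- The Gaussian majorant of the integrand of an adjunction to a configuration of energy `e`. -/
noncomputable def stepMajorant {d : ℕ} (b A e : ℝ) (p : AdjParam d) : ℝ :=
  (‖p.2‖ + Real.sqrt e) * (A * Real.exp (-b * (e + ‖p.2‖ ^ 2)))

theorem stepMajorant_le {d : ℕ} {b A e : ℝ} (hb : 0 < b) (hA : 0 ≤ A) (he : 0 ≤ e) (p : AdjParam d) :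
    stepMajorant b A e p ≤ A * (1 + 1 / b) * Real.exp (-(b / 2) * e) *
      Real.exp (-(b / 2) * ‖p.2‖ ^ 2) := by
  have h := mul_le_mul_of_nonneg_left (add_mul_exp_le hb (x := ‖p.2‖) (y := Real.sqrt e)) hA
  rw [Real.sq_sqrt he] at h
  unfold stepMajorant
  calc _ = A * ((‖p.2‖ + Real.sqrt e) * Real.exp (-b * (‖p.2‖ ^ 2 + e))) := by
        rw [add_comm e]; ring
    _ ≤ _ := h
    _ = _ := by rw [mul_add, Real.exp_add]; ring

theorem integral_norm_le_of_le_stepMajorant {d : ℕ} {b A e : ℝ} (hb : 0 < b) (hA : 0 ≤ A) (he : 0 ≤ e)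
    {F : AdjParam d → ℝ} (hF : ∀ p, |F p| ≤ stepMajorant b A e p) :
    |∫ p, F p ∂adjMeasure d| ≤ A * stepConst d b * Real.exp (-(b / 2) * e) := by
  have := norm_integral_le_of_norm_le (f := F)
    ((integrable_exp_neg_mul_norm_sq (d := d) (half_pos hb)).const_mul
      (A * (1 + 1 / b) * Real.exp (-(b / 2) * e)))
    (Eventually.of_forall fun p => (hF p).trans (stepMajorant_le hb hA he p))
  rw [integral_const_mul] at this
  refine this.trans_eq ?_
  unfold stepConst; ring

theorem integrable_of_le_stepMajorant {d : ℕ} {b A e : ℝ} (hb : 0 < b) (hA : 0 ≤ A) (he : 0 ≤ e)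
    {F : AdjParam d → ℝ} (hFm : Measurable F) (hF : ∀ p, |F p| ≤ stepMajorant b A e p) :
    Integrable F (adjMeasure d) :=
  ((integrable_exp_neg_mul_norm_sq (d := d) (half_pos hb)).const_mul
      (A * (1 + 1 / b) * Real.exp (-(b / 2) * e))).mono' hFm.aestronglyMeasurable
    (Eventually.of_forall fun p => (hF p).trans (stepMajorant_le hb hA he p))

/-! ### Bounds and comparison for a single adjunction -/

theorem abs_mul_signedPart_le (σ : ℤˣ) (x : ℝ) : |((σ : ℤ) : ℝ) * signedPart σ x| ≤ |x| := by
  unfold signedPart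
  rcases Int.units_eq_one_or σ with rfl | rfl
  · simp only [Units.val_one, Int.cast_one, one_mul]
    rw [abs_of_nonneg (le_max_right _ _)]
    exact max_le (le_abs_self _) (abs_nonneg _)
  · simp only [Units.val_neg, Units.val_one, Int.cast_neg, Int.cast_one, neg_mul, one_mul, abs_neg]
    rw [abs_of_nonneg (le_max_right _ _)]
    exact max_le (neg_le_abs _) (abs_nonneg _)

theorem abs_flux_le {d m : ℕ} (j : Fin m) (p : AdjParam d) (Z : Config d m) :
    |flux j p Z| ≤ ‖p.2‖ + Real.sqrt (energy Z) := by
  have hω : ‖(p.1 : Space d)‖ = 1 := by simp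
  have h1 : ‖(Z j).2‖ ≤ Real.sqrt (energy Z) :=
    Real.le_sqrt_of_sq_le (Finset.single_le_sum (f := fun i => ‖(Z i).2‖ ^ 2)
      (fun _ _ => sq_nonneg _) (Finset.mem_univ j))
  refine (abs_real_inner_le_norm _ _).trans ?_
  rw [hω, one_mul]
  exact (norm_sub_le _ _).trans (by linarith)

theorem abs_kernel_mul_le {d m : ℕ} {b A e : ℝ} (σ : ℤˣ) (j : Fin m) (p : AdjParam d)
    {W : Config d m} (he : energy W = e) {h : ℝ}
    (hh : |h| ≤ A * Real.exp (-b * (e + ‖p.2‖ ^ 2))) :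
    |((σ : ℤ) : ℝ) * signedPart σ (flux j p W) * h| ≤ stepMajorant b A e p := by
  rw [abs_mul]
  refine mul_le_mul ((abs_mul_signedPart_le _ _).trans (he ▸ abs_flux_le j p W)) hh
    (abs_nonneg _) (by positivity)


theorem stepMajorant_nonneg {d : ℕ} {b A e : ℝ} (hA : 0 ≤ A) (p : AdjParam d) :
    0 ≤ stepMajorant b A e p :=
  mul_nonneg (by positivity) (mul_nonneg hA (Real.exp_pos _).le)

theorem abs_stepIntegrand_le {m : ℕ} {Φ : ℝ → Config d m → Config d m} {r b B e : ℝ}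
    (hB : 0 ≤ B) {E : ParamFamily d} (σ : ℤˣ) (j : Fin m)
    {H : ℝ → Config d (m + 1) → Config d (m + 1) → ℝ} {t t₁ : ℝ} {Z W : Config d m}
    (hΦ : energy (Φ (t - t₁) W) = e)
    (hH : ∀ Z' W', |H t₁ Z' W'| ≤ B * Real.exp (-b * energy W')) (p : AdjParam d) :
    |stepIntegrand Φ r E σ j H t Z W t₁ p| ≤ stepMajorant b B e p := by
  unfold stepIntegrand
  by_cases hp : p ∈ (E m j (freeBack (t - t₁) Z))ᶜ
  · rw [Set.indicator_of_mem hp]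
    refine abs_kernel_mul_le σ j p hΦ ((hH _ _).trans_eq ?_)
    rw [energy_adjoin, hΦ]
  · rw [Set.indicator_of_notMem hp, abs_zero]
    exact stepMajorant_nonneg hB p

theorem abs_adjIntegral_le {m : ℕ} {Φ : ℝ → Config d m → Config d m} {r b B e : ℝ}
    (hb : 0 < b) (hB : 0 ≤ B) (he : 0 ≤ e) {U : TimeFamily d} {E : ParamFamily d} (σ : ℤˣ)
    (j : Fin m) {H : ℝ → Config d (m + 1) → Config d (m + 1) → ℝ} {t t₁ : ℝ} {Z W : Config d m}
    (hΦ : energy (Φ (t - t₁) W) = e)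
    (hH : ∀ Z' W', |H t₁ Z' W'| ≤ B * Real.exp (-b * energy W')) :
    |(U m j t Z)ᶜ.indicator (fun _ => ∫ p, stepIntegrand Φ r E σ j H t Z W t₁ p ∂adjMeasure d) t₁|
      ≤ B * stepConst d b * Real.exp (-(b / 2) * e) := by
  by_cases hU : t₁ ∈ (U m j t Z)ᶜ
  · rw [Set.indicator_of_mem hU]
    exact integral_norm_le_of_le_stepMajorant hb hB he (abs_stepIntegrand_le hB σ j hΦ hH)
  · rw [Set.indicator_of_notMem hU, abs_zero]
    exact mul_nonneg (mul_nonneg hB (stepConst_nonneg hb)) (Real.exp_pos _).le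

theorem abs_stepIntegral_le {m : ℕ} {Φ : ℝ → Config d m → Config d m} {r δ lo b B : ℝ}
    (hb : 0 < b) (hB : 0 ≤ B) (hlo : 0 ≤ lo) (hδ : 0 ≤ δ) (U : TimeFamily d) (E : ParamFamily d)
    (σ : ℤˣ) (j : Fin m) {H : ℝ → Config d (m + 1) → Config d (m + 1) → ℝ} {t : ℝ}
    {Z W : Config d m} (hΦ : ∀ τ, 0 ≤ τ → energy (Φ τ W) = energy W) (hlt : lo ≤ t - δ)
    (hH : ∀ t₁ ∈ Ioc lo (t - δ), ∀ Z' W', |H t₁ Z' W'| ≤ B * Real.exp (-b * energy W')) :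
    |stepIntegral Φ r δ U E lo σ j H t Z W| ≤
      t * (B * stepConst d b * Real.exp (-(b / 2) * energy W)) := by
  have hC : 0 ≤ B * stepConst d b * Real.exp (-(b / 2) * energy W) :=
    mul_nonneg (mul_nonneg hB (stepConst_nonneg hb)) (Real.exp_pos _).le
  rw [← Real.norm_eq_abs, stepIntegral]
  refine (intervalIntegral.norm_integral_le_of_norm_le_const
    (C := B * stepConst d b * Real.exp (-(b / 2) * energy W)) fun t₁ ht₁ => ?_).trans ?_
  · rw [uIoc_of_le hlt] at ht₁
    exact abs_adjIntegral_le hb hB (energy_nonneg W) σ j (hΦ _ (by linarith [ht₁.2]))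
      (hH t₁ ht₁)
  · rw [mul_comm, abs_of_nonneg (by linarith)]
    exact mul_le_mul_of_nonneg_right (by linarith) hC

theorem stepIntegral_congr {m : ℕ} {Φ Φ' : ℝ → Config d m → Config d m} {r r' δ lo : ℝ}
    {U : TimeFamily d} {E : ParamFamily d} {σ : ℤˣ} {j : Fin m}
    {H H' : ℝ → Config d (m + 1) → Config d (m + 1) → ℝ} {t : ℝ}
    {Z W W' : Config d m} (hlt : lo ≤ t - δ)
    (h : ∀ᵐ t₁ : ℝ, t₁ ∈ Ioc lo (t - δ) → t₁ ∉ U m j t Z → ∀ p,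
      stepIntegrand Φ r E σ j H t Z W t₁ p = stepIntegrand Φ' r' E σ j H' t Z W' t₁ p) :
    stepIntegral Φ r δ U E lo σ j H t Z W = stepIntegral Φ' r' δ U E lo σ j H' t Z W' := by
  refine intervalIntegral.integral_congr_ae ?_
  filter_upwards [h] with t₁ h ht₁
  rw [uIoc_of_le hlt] at ht₁
  by_cases hU : t₁ ∈ (U m j t Z)ᶜ
  · rw [Set.indicator_of_mem hU, Set.indicator_of_mem hU]
    exact integral_congr_ae (Eventually.of_forall (h ht₁ hU))
  · rw [Set.indicator_of_notMem hU, Set.indicator_of_notMem hU]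

/-- The two constants have different roles: `B` bounds each integrand everywhere and only serves
integrability, while `A` bounds the difference outside the truncated sets and is the only one left
in the conclusion. -/
theorem abs_stepIntegral_sub_le {m : ℕ} {Φ Φ' : ℝ → Config d m → Config d m}
    {r r' δ lo b A B e : ℝ} (hb : 0 < b) (hA : 0 ≤ A) (hB : 0 ≤ B) (hlo : 0 ≤ lo) (hδ : 0 ≤ δ)
    (hΦm : Measurable fun q : ℝ × Config d m => Φ q.1 q.2)
    (hΦm' : Measurable fun q : ℝ × Config d m => Φ' q.1 q.2)
    {U : TimeFamily d} {E : ParamFamily d} (σ : ℤˣ) (j : Fin m)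
    (hU : MeasurableSet {q : ℝ × ℝ × Config d m | q.1 ∈ U m j q.2.1 q.2.2})
    (hE : MeasurableSet {q : Config d m × AdjParam d | q.2 ∈ E m j q.1})
    {H H' : ℝ → Config d (m + 1) → Config d (m + 1) → ℝ}
    (hHm : Measurable fun q : ℝ × Config d (m + 1) × Config d (m + 1) => H q.1 q.2.1 q.2.2)
    (hHm' : Measurable fun q : ℝ × Config d (m + 1) × Config d (m + 1) => H' q.1 q.2.1 q.2.2)
    {t : ℝ} {Z W W' : Config d m} (hlt : lo ≤ t - δ)
    (hΦ : ∀ τ, 0 ≤ τ → energy (Φ τ W) = e) (hΦ' : ∀ τ, 0 ≤ τ → energy (Φ' τ W') = e)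
    (hH : ∀ t₁ ∈ Ioc lo (t - δ), ∀ Z' W', |H t₁ Z' W'| ≤ B * Real.exp (-b * energy W'))
    (hH' : ∀ t₁ ∈ Ioc lo (t - δ), ∀ Z' W', |H' t₁ Z' W'| ≤ B * Real.exp (-b * energy W'))
    (hdiff : ∀ᵐ t₁ : ℝ, t₁ ∈ Ioc lo (t - δ) → t₁ ∉ U m j t Z → ∀ p,
      |stepIntegrand Φ r E σ j H t Z W t₁ p - stepIntegrand Φ' r' E σ j H' t Z W' t₁ p|
        ≤ stepMajorant b A e p) :
    |stepIntegral Φ r δ U E lo σ j H t Z W - stepIntegral Φ' r' δ U E lo σ j H' t Z W'| ≤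
      t * (A * stepConst d b * Real.exp (-(b / 2) * e)) := by
  have he : 0 ≤ e := hΦ 0 le_rfl ▸ energy_nonneg _
  have hC : 0 ≤ A * stepConst d b * Real.exp (-(b / 2) * e) :=
    mul_nonneg (mul_nonneg hA (stepConst_nonneg hb)) (Real.exp_pos _).le
  have hint : ∀ {Φ : ℝ → Config d m → Config d m} {r : ℝ}
      {H : ℝ → Config d (m + 1) → Config d (m + 1) → ℝ} {W : Config d m},
      (Measurable fun q : ℝ × Config d m => Φ q.1 q.2) →
      (Measurable fun q : ℝ × Config d (m + 1) × Config d (m + 1) => H q.1 q.2.1 q.2.2) →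
      (∀ τ, 0 ≤ τ → energy (Φ τ W) = e) →
      (∀ t₁ ∈ Ioc lo (t - δ), ∀ Z' W', |H t₁ Z' W'| ≤ B * Real.exp (-b * energy W')) →
      IntervalIntegrable (fun t₁ => (U m j t Z)ᶜ.indicator
        (fun _ => ∫ p, stepIntegrand Φ r E σ j H t Z W t₁ p ∂adjMeasure d) t₁)
        volume lo (t - δ) := by
    intro Φ r H W hΦm hHm hΦ hH
    rw [intervalIntegrable_iff_integrableOn_Ioc_of_le hlt]
    refine Measure.integrableOn_of_bounded (M := B * stepConst d b * Real.exp (-(b / 2) * e))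
      measure_Ioc_lt_top.ne ?_ ?_
    · have h1 : Measurable fun t₁ : ℝ => ((t, Z, W), t₁) := measurable_prodMk_left
      have h2 := (measurable_adjIntegral hΦm r σ j hU hE hHm).comp h1
      exact h2.aestronglyMeasurable
    · filter_upwards [ae_restrict_mem measurableSet_Ioc] with t₁ ht₁
      exact abs_adjIntegral_le hb hB he σ j (hΦ _ (by linarith [ht₁.2])) (hH t₁ ht₁)
  have hintp : ∀ {Φ : ℝ → Config d m → Config d m} {r : ℝ}
      {H : ℝ → Config d (m + 1) → Config d (m + 1) → ℝ} {W : Config d m},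
      (Measurable fun q : ℝ × Config d m => Φ q.1 q.2) →
      (Measurable fun q : ℝ × Config d (m + 1) × Config d (m + 1) => H q.1 q.2.1 q.2.2) →
      (∀ τ, 0 ≤ τ → energy (Φ τ W) = e) →
      (∀ t₁ ∈ Ioc lo (t - δ), ∀ Z' W', |H t₁ Z' W'| ≤ B * Real.exp (-b * energy W')) →
      ∀ t₁ ∈ Ioc lo (t - δ),
      Integrable (stepIntegrand Φ r E σ j H t Z W t₁) (adjMeasure d) := by
    intro Φ r H W hΦm hHm hΦ hH t₁ ht₁
    refine integrable_of_le_stepMajorant hb hB he ?_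
      (abs_stepIntegrand_le hB σ j (hΦ _ (by linarith [ht₁.2])) (hH t₁ ht₁))
    have h1 : Measurable fun p : AdjParam d => (((t, Z, W), t₁), p) := measurable_prodMk_left
    have h2 := (measurable_stepIntegrand hΦm r σ j hE hHm).comp h1
    exact h2
  unfold stepIntegral
  rw [← intervalIntegral.integral_sub (hint hΦm hHm hΦ hH) (hint hΦm' hHm' hΦ' hH'), ← Real.norm_eq_abs]
  refine (intervalIntegral.norm_integral_le_of_norm_le_const_ae
    (C := A * stepConst d b * Real.exp (-(b / 2) * e)) ?_).trans ?_
  · filter_upwards [hdiff] with t₁ hd ht₁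
    rw [uIoc_of_le hlt] at ht₁
    by_cases hU : t₁ ∈ (U m j t Z)ᶜ
    · rw [Set.indicator_of_mem hU, Set.indicator_of_mem hU,
        ← integral_sub (hintp hΦm hHm hΦ hH t₁ ht₁) (hintp hΦm' hHm' hΦ' hH' t₁ ht₁)]
      exact integral_norm_le_of_le_stepMajorant hb hA he (hd ht₁ hU)
    · rw [Set.indicator_of_notMem hU, Set.indicator_of_notMem hU, sub_zero, norm_zero]
      exact hC
  · rw [mul_comm, abs_of_nonneg (by linarith)]
    exact mul_le_mul_of_nonneg_right (by linarith) hC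

/-! ### Bounds on terms with several adjunctions -/

/-- Constant in the bound on the terms with `k` adjunctions. -/
noncomputable def chainConst (d : ℕ) (b : ℝ) : ℕ → ℝ
  | 0 => 1
  | k + 1 => chainConst d b k * stepConst d (b / 2 ^ k)

theorem chainConst_nonneg {d : ℕ} {b : ℝ} (hb : 0 < b) (k : ℕ) : 0 ≤ chainConst d b k := by
  induction k with
  | zero => exact zero_le_one
  | succ k ih => exact mul_nonneg ih (stepConst_nonneg (by positivity))

/-- Each adjunction contributes a factor `t` and a Gaussian integral, and halves the exponent,
whence `b / 2 ^ k`. -/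
theorem abs_pseudoTerm_le {Φ : (m : ℕ) → ℝ → Config d m → Config d m} {r δ b : ℝ} (hb : 0 < b)
    (hδ : 0 ≤ δ) (U : TimeFamily d) (E : ParamFamily d) {g : (m : ℕ) → Config d m → ℝ}
    (hΦ : ∀ m τ Z, 0 ≤ τ → energy (Φ m τ Z) = energy Z) {A : ℕ → ℝ} (hA : ∀ m, 0 ≤ A m)
    (hg : ∀ m Z, |g m Z| ≤ A m * Real.exp (-b * energy Z)) (k : ℕ) {m : ℕ} (M : Fin k → ℤˣ)
    (J : Labels m k) {t : ℝ} (ht : 0 ≤ t) (Z W : Config d m) :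
    |pseudoTerm Φ r δ U E g k M J t Z W| ≤
      A (m + k) * chainConst d b k * t ^ k * Real.exp (-(b / 2 ^ k) * energy W) := by
  induction k generalizing m t with
  | zero =>
    have := hg m (Φ m t W)
    rw [hΦ m t W ht] at this
    simpa [pseudoTerm, chainConst] using this
  | succ k ih =>
    have hAm := hA (m + (k + 1))
    have hQ := chainConst_nonneg (d := d) hb k
    have hQ' := chainConst_nonneg (d := d) hb (k + 1)
    simp only [pseudoTerm]
    split_ifs with h
    · refine (abs_stepIntegral_le (b := b / 2 ^ k)
        (B := A (m + (k + 1)) * chainConst d b k * t ^ k) (by positivity) (by positivity)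
        (by positivity) hδ U E _ _ (fun τ hτ => hΦ m τ W hτ) (by linarith) ?_).trans_eq ?_
      · intro t₁ ht₁ Z' W'
        have h0 : 0 ≤ t₁ := (by positivity : (0 : ℝ) ≤ k * δ).trans ht₁.1.le
        refine (ih _ _ h0 Z' W').trans ?_
        rw [show m + 1 + k = m + (k + 1) by ring]
        gcongr
        linarith [ht₁.2]
      · rw [chainConst, pow_succ (2 : ℝ) k, div_div]; ring
    · rw [abs_zero]; positivity

/-- Energy is conserved by the flow and cannot decrease at an adjunction, so a configuration beyond
the cutoff only reaches data equal to zero. This disposes of velocities larger than `R`, about which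
the pathological sets say nothing. -/
theorem pseudoTerm_eq_zero {Φ : (m : ℕ) → ℝ → Config d m → Config d m} {r δ R : ℝ}
    (hδ : 0 ≤ δ) (U : TimeFamily d) (E : ParamFamily d) {g : (m : ℕ) → Config d m → ℝ}
    (hΦ : ∀ m τ Z, 0 ≤ τ → energy (Φ m τ Z) = energy Z)
    (hg : ∀ m Z, R < energy Z → g m Z = 0) (k : ℕ) {m : ℕ} (M : Fin k → ℤˣ)
    (J : Labels m k) {t : ℝ} (ht : 0 ≤ t) (Z : Config d m) {W : Config d m}
    (hW : R < energy W) : pseudoTerm Φ r δ U E g k M J t Z W = 0 := by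
  induction k generalizing m t with
  | zero => exact hg m _ (by rwa [hΦ m t W ht])
  | succ k ih =>
    simp only [pseudoTerm]
    split_ifs with h
    · have hlo : (0 : ℝ) ≤ k * δ := by positivity
      rw [stepIntegral_congr (Φ' := Φ m) (r' := r) (H' := fun _ _ _ => 0) (W' := W)
        (by linarith)]
      · simp [stepIntegral, stepIntegrand]
      · refine Eventually.of_forall fun t₁ ht₁ _ p => ?_
        simp only [stepIntegrand]
        refine congrFun (congrArg _ (funext fun p => ?_)) p
        rw [ih _ _ (hlo.trans ht₁.1.le)]
        rw [energy_adjoin, hΦ _ _ _ (by linarith [ht₁.2])]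
        linarith [sq_nonneg ‖p.2‖]
    · rfl

/-! ### Pairs of pseudo-trajectories -/

/-- `Z` and `W` are the current configurations of a Boltzmann and of a hard sphere
pseudo-trajectory which are close to one another and whose backward evolutions are good. -/
structure GoodPair (ε δ ε₀ r : ℝ) {m : ℕ} (Z W : Config d m) : Prop where
  near : ∀ i, NearUpToReflection r (Z i) (W i)
  closed : ∀ i, Z i ∈ closedPhase d
  hard : W ∈ goodHard d ε ε m
  separated : ∀ τ, δ < τ → ∀ i j, i ≠ j → ε₀ < ‖(freeBack τ Z i).1 - (freeBack τ Z j).1‖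
  ae_open : ∀ᵐ τ : ℝ, δ ≤ τ → ∀ i, freeBack τ Z i ∈ openPhase d

theorem GoodPair.energy_eq {ε δ ε₀ r : ℝ} {m : ℕ} {Z W : Config d m}
    (h : GoodPair ε δ ε₀ r Z W) : energy W = energy Z :=
  Finset.sum_congr rfl fun i _ => by rw [(h.near i).norm_snd]

theorem le_coord_of_notMem {R δ ε a ε₀ ρ α : ℝ} {U : TimeFamily d} {E : ParamFamily d}
    (hUE : IsPathologicalFamily R δ ε a ε₀ ρ α U E) {m : ℕ} {j : Fin m} {t t₁ : ℝ}
    {Z : Config d m} (ht₁ : t₁ ∈ Icc 0 t) (hU : t₁ ∉ U m j t Z) :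
    ρ ≤ (freeBack (t - t₁) Z j).1 0 := by
  have h1 : t₁ ∉ nearWallTimes ρ j t Z := fun h => hU (hUE.times m j t Z h)
  have h2 : ¬ |(freeBack (t - t₁) Z j).1 0| < ρ := fun h => h1 ⟨ht₁, h⟩
  have h3 : 0 ≤ (freeBack (t - t₁) Z j).1 0 := freeBackParticle_mem_closedPhase _ _
  rw [abs_of_nonneg h3] at h2
  exact not_lt.1 h2

theorem near_flow {ε r : ℝ} (hε : 0 ≤ ε) {m : ℕ} {Z W : Config d m}
    (h : ∀ i, NearUpToReflection r (Z i) (W i)) (τ : ℝ) (i : Fin m) :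
    NearUpToReflection (r + ε) (freeBack τ Z i) (shiftFree ε τ W i) :=
  (h i).flow hε τ

theorem velocity_eq_of_far {ε r ρ τ : ℝ} (hε : 0 ≤ ε) {m : ℕ} {Z W : Config d m}
    (h : ∀ i, NearUpToReflection r (Z i) (W i)) {j : Fin m} (hr : r + ε < ρ)
    (hfar : ρ ≤ (freeBack τ Z j).1 0) : (shiftFree ε τ W j).2 = (freeBack τ Z j).2 :=
  (near_flow hε h τ j).snd_eq (hr.trans_le hfar)
    ((by positivity : 0 ≤ ε / 2).trans (le_coord_shiftFreeParticle ε τ (W j)))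

theorem norm_fst_sub_flow_le {ε r τ : ℝ} (hε : 0 ≤ ε) {m : ℕ} {Z W : Config d m}
    (h : ∀ i, NearUpToReflection r (Z i) (W i)) (i : Fin m) :
    ‖(shiftFree ε τ W i).1 - (freeBack τ Z i).1‖ ≤ r + ε :=
  (near_flow hε h τ i).norm_fst_sub_le (freeBackParticle_mem_closedPhase _ _)
    ((by positivity : 0 ≤ ε / 2).trans (le_coord_shiftFreeParticle ε τ (W i)))

/-- Inductive step of the comparison: the flow and the adjunction each add `ε`. The new Boltzmann
particle starts on top of `j`, so separation is only recovered after a further time `δ`, which the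
spacing of the adjunctions grants. -/
theorem GoodPair.adjoin {R δ ε a ε₀ ρ α r : ℝ} (hε : 0 ≤ ε) (hδ : 0 ≤ δ) (hra : r + ε ≤ a)
    (haρ : a < ρ) {U : TimeFamily d} {E : ParamFamily d}
    (hUE : IsPathologicalFamily R δ ε a ε₀ ρ α U E) {m : ℕ} {Z W : Config d m}
    (h : GoodPair ε δ ε₀ r Z W) {σ : ℤˣ} {j : Fin m} {t t₁ : ℝ} (ht₁ : t₁ ∈ Icc 0 (t - δ))
    (hU : t₁ ∉ U m j t Z) (hopen : ∀ i, freeBack (t - t₁) Z i ∈ openPhase d) {p : AdjParam d}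
    (hp : p ∉ E m j (freeBack (t - t₁) Z)) (hpR : ‖p.2‖ ≤ R)
    (hflux : signedPart σ (flux j p (freeBack (t - t₁) Z)) ≠ 0) :
    GoodPair ε δ ε₀ (r + 2 * ε) (adjoin 0 σ j p (freeBack (t - t₁) Z))
      (adjoin ε σ j p (shiftFree ε (t - t₁) W)) := by
  have hτ : δ ≤ t - t₁ := by linarith [ht₁.2]
  have hfar := le_coord_of_notMem hUE ⟨ht₁.1, by linarith [ht₁.2]⟩ hU
  have hv := velocity_eq_of_far hε h.near (by linarith : r + ε < ρ) hfar
  have hpos := norm_fst_sub_flow_le (τ := t - t₁) hε h.near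
  have hWgood := hardBack_mem_goodHard h.hard (hδ.trans hτ)
  rw [hardBack_eq_shiftFree h.hard (hδ.trans hτ)] at hWgood
  have hclosed : ∀ i, freeBack (t - t₁) Z i ∈ closedPhase d :=
    fun i => freeBackParticle_mem_closedPhase _ _
  have hgood : freeBack (t - t₁) Z ∈ goodFree d ε₀ m := by
    refine ⟨hopen, fun τ hτ' i j hij => ?_⟩
    rw [freeBack_add hτ'.le (hδ.trans hτ) h.closed]
    exact h.separated _ (by linarith) i j hij
  have hclose : CloseConfig a j (freeBack (t - t₁) Z) (shiftFree ε (t - t₁) W) := by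
    refine ⟨fun i => ?_, hv, fun i _ => ?_⟩
    · rw [norm_sub_rev]; exact (hpos i).trans hra
    · exact (near_flow hε h.near (t - t₁) i).imp (fun h => h.1) (fun h => h.1)
  -- A nonzero signed part means that the flux has sign `σ`, so instability would place `p` in
  -- `unstableSet`, hence in `E`.
  have hstable : StableAdjunction δ ε a ε₀ σ j (freeBack (t - t₁) Z) p := by
    have hp' : p ∉ unstableSet R δ ε a ε₀ j (freeBack (t - t₁) Z) :=
      fun hmem => hp (hUE.params m j _ hgood hfar (Or.inl hmem))
    by_contra hcon
    refine hp' ⟨hpR, ?_⟩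
    unfold signedPart at hflux
    rcases Int.units_eq_one_or σ with rfl | rfl
    · refine Or.inr ⟨?_, hcon⟩
      by_contra! hle
      exact hflux (max_eq_right (by simpa using hle))
    · refine Or.inl ⟨?_, hcon⟩
      by_contra! hle
      exact hflux (max_eq_right (by simpa using hle))
  have hcl' := adjoin_zero_mem_closedPhase σ j p hclosed
  obtain ⟨hst1, hst2, hst3⟩ := hstable
  refine ⟨fun i => ?_, hcl', hst1 _ hWgood hclose, fun τ hτ' i j hij => ?_, ?_⟩
  · rw [show r + 2 * ε = (r + ε) + ε by ring]
    exact NearUpToReflection.adjoin hε σ p (near_flow hε h.near _) hv (hpos j) i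
  · have := hst3 (τ - δ) (by linarith) i j hij
    rwa [freeBack_add (by linarith) hδ hcl', sub_add_cancel] at this
  -- The stability condition puts the Boltzmann configuration in the open half-space at time `δ`.
  -- From then on each particle meets the wall at most once.
  · have h1 : ∀ᵐ τ : ℝ, ∀ i, freeBackParticle τ
        (freeBack δ (HalfSpaceLanford.adjoin 0 σ j p (freeBack (t - t₁) Z)) i) ∈ openPhase d :=
      ae_all_iff.2 fun i => ae_freeBackParticle_mem_openPhase (hst2 i)
    filter_upwards [(measurePreserving_sub_right volume δ).quasiMeasurePreserving.ae h1]
      with τ hτ hδτ i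
    have := hτ i
    rwa [freeBack, freeBackParticle_add (by linarith) hδ (hcl' i), sub_add_cancel] at this


/-! ### Tensorized data -/

/-- The data extended by zero outside the closed phase space. -/
noncomputable def extendZero (f₀ : Particle d → ℝ) : Particle d → ℝ := (closedPhase d).indicator f₀

theorem measurableSet_closedPhase : MeasurableSet (closedPhase d) :=
  (isClosed_le continuous_const ((continuous_coord 0).comp continuous_fst)).measurableSet

theorem measurable_extendZero {β : ℝ} {f₀ : Particle d → ℝ} (hX : MemX β f₀) :
    Measurable (extendZero f₀) := by
  classical
  rw [extendZero, ← Set.piecewise_eq_indicator]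
  exact hX.continuousOn.measurable_piecewise continuousOn_const measurableSet_closedPhase

theorem velNorm_eq {d m : ℕ} (Z : Config d m) : velNorm Z = Real.sqrt (energy Z) := rfl

theorem measurable_energy {d m : ℕ} : Measurable (energy : Config d m → ℝ) := by
  unfold energy; fun_prop

theorem measurable_cutTensor {d : ℕ} {f : Particle d → ℝ} (hf : Measurable f) (R : ℝ) (m : ℕ) :
    Measurable (cutTensor f R m) := by
  classical
  have h : MeasurableSet {Z : Config d m | velNorm Z ≤ R} :=
    measurableSet_le measurable_energy.sqrt measurable_const
  have ht : Measurable (tensor f m) :=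
    Finset.measurable_prod _ fun i _ => hf.comp (measurable_pi_apply i)
  exact Measurable.ite h ht measurable_const

/-- The values of `f₀` outside the closed phase space are arbitrary and could be non-measurable. The
extension by zero is measurable and agrees where the trajectories end. -/
theorem cutTensor_extendZero {f₀ : Particle d → ℝ} {R : ℝ} {m : ℕ} {Z : Config d m}
    (hZ : ∀ i, Z i ∈ closedPhase d) : cutTensor (extendZero f₀) R m Z = cutTensor f₀ R m Z := by
  have : tensor (extendZero f₀) m Z = tensor f₀ m Z :=
    Finset.prod_congr rfl fun i _ => Set.indicator_of_mem (hZ i) f₀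
  simp only [cutTensor, this]

theorem cutTensor_eq_zero {d : ℕ} {f : Particle d → ℝ} {R : ℝ} (hR : 0 ≤ R) {m : ℕ}
    {Z : Config d m} (hZ : R ^ 2 < energy Z) : cutTensor f R m Z = 0 :=
  if_neg (not_le.2 ((Real.lt_sqrt hR).2 hZ))

/-- The bound `N` depends on `f₀`, which is harmless: it only provides integrability and does not
enter the final estimate. -/
theorem exists_gaussian_bound {β : ℝ} {f₀ : Particle d → ℝ} (hX : MemX β f₀) :
    ∃ N, 0 ≤ N ∧ ∀ z, |extendZero f₀ z| ≤ N * Real.exp (-(β / 2) * ‖z.2‖ ^ 2) := by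
  set N := (gaussNorm β (fun Z : Config d 1 => f₀ (Z 0))).toReal
  refine ⟨N, ENNReal.toReal_nonneg, fun z => ?_⟩
  by_cases hz : z ∈ closedPhase d
  · have h1 : ENNReal.ofReal (|f₀ z| * Real.exp (β / 2 * ‖z.2‖ ^ 2)) ≤
        gaussNorm β (fun Z : Config d 1 => f₀ (Z 0)) := by
      have := le_iSup₂_of_le (f := fun (Z : Config d 1)
        (_ : Z ∈ {Z : Config d 1 | ∀ i, Z i ∈ closedPhase d}) =>
        ENNReal.ofReal (|f₀ (Z 0)| * Real.exp (β / 2 * ∑ i, ‖(Z i).2‖ ^ 2)))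
        (fun _ => z) (fun _ => hz) le_rfl
      simpa [gaussNorm] using this
    have h2 := (ENNReal.ofReal_le_iff_le_toReal hX.finite.ne).1 h1
    rw [extendZero, Set.indicator_of_mem hz, neg_mul, Real.exp_neg, ← div_eq_mul_inv,
      le_div_iff₀ (Real.exp_pos _)]
    exact h2
  · rw [extendZero, Set.indicator_of_notMem hz, abs_zero]
    have : 0 ≤ N := ENNReal.toReal_nonneg
    positivity

theorem abs_cutTensor_le {d : ℕ} {f : Particle d → ℝ} {N b : ℝ} (hN : 0 ≤ N)
    (hf : ∀ z, |f z| ≤ N * Real.exp (-b * ‖z.2‖ ^ 2)) (R : ℝ) (m : ℕ) (Z : Config d m) :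
    |cutTensor f R m Z| ≤ N ^ m * Real.exp (-b * energy Z) := by
  unfold cutTensor
  split_ifs
  · unfold tensor energy
    rw [Finset.abs_prod, Finset.mul_sum, Real.exp_sum]
    refine (Finset.prod_le_prod (fun _ _ => abs_nonneg _) fun i _ => hf (Z i)).trans_eq ?_
    rw [Finset.prod_mul_distrib]
    simp
  · rw [abs_zero]; positivity

/-- `f₀(z) exp(β₀ |v|² / 4) exp μ₀`. -/
noncomputable def normalizedData {d : ℕ} (β₀ μ₀ : ℝ) (f₀ : Particle d → ℝ) (z : Particle d) : ℝ :=
  f₀ z * Real.exp (β₀ / 4 * ‖z.2‖ ^ 2) * Real.exp μ₀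

theorem normalizedData_pow_le {β₀ μ₀ : ℝ} {f₀ : Particle d → ℝ}
    (hpos : ∀ z ∈ closedPhase d, 0 ≤ f₀ z) (hS : seqNorm (β₀ / 2) μ₀ (tensor f₀) ≠ ∞)
    {z : Particle d} (hz : z ∈ closedPhase d) {m : ℕ} (hm : 1 ≤ m) :
    normalizedData β₀ μ₀ f₀ z ^ m ≤ (seqNorm (β₀ / 2) μ₀ (tensor f₀)).toReal := by
  refine (ENNReal.ofReal_le_iff_le_toReal hS).1 ?_
  refine le_trans ?_ (le_iSup₂_of_le (f := fun (m : ℕ) (_ : m ∈ {m : ℕ | 1 ≤ m}) =>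
    gaussNorm (β₀ / 2) (tensor f₀ m) * ENNReal.ofReal (Real.exp (m * μ₀))) m hm le_rfl)
  have h1 := le_iSup₂_of_le (f := fun (Z : Config d m)
        (_ : Z ∈ {Z : Config d m | ∀ i, Z i ∈ closedPhase d}) =>
        ENNReal.ofReal (|tensor f₀ m Z| * Real.exp (β₀ / 2 / 2 * ∑ i, ‖(Z i).2‖ ^ 2)))
        (fun _ => z) (fun _ => hz) le_rfl
  refine le_trans ?_ (mul_le_mul_left h1 _)
  rw [← ENNReal.ofReal_mul (by positivity)]
  refine ENNReal.ofReal_le_ofReal (le_of_eq ?_)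
  simp only [tensor, Finset.prod_const, Finset.card_univ, Fintype.card_fin, Finset.sum_const,
    nsmul_eq_mul]
  rw [abs_of_nonneg (pow_nonneg (hpos z hz) m), normalizedData, mul_pow, mul_pow, ← Real.exp_nat_mul,
    ← Real.exp_nat_mul]
  congr 3
  ring

/-- Evaluating the norm on `m` copies of one particle bounds all powers of the normalized density by
the same number. It is thus at most `1`, and `m = 1` gives the other bound. -/
theorem normalizedData_le_min {β₀ μ₀ : ℝ} {f₀ : Particle d → ℝ}
    (hpos : ∀ z ∈ closedPhase d, 0 ≤ f₀ z) (hS : seqNorm (β₀ / 2) μ₀ (tensor f₀) ≠ ∞)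
    {z : Particle d} (hz : z ∈ closedPhase d) :
    normalizedData β₀ μ₀ f₀ z ≤ min 1 (seqNorm (β₀ / 2) μ₀ (tensor f₀)).toReal := by
  refine le_min ?_ (by simpa using normalizedData_pow_le hpos hS hz le_rfl)
  by_contra! hlt
  obtain ⟨n, hn⟩ := pow_unbounded_of_one_lt (seqNorm (β₀ / 2) μ₀ (tensor f₀)).toReal hlt
  have h1 := normalizedData_pow_le hpos hS hz (Nat.le_add_left 1 n)
  have h2 := pow_le_pow_right₀ hlt.le (Nat.le_add_right n 1)
  linarith

/-- Telescoping one factor at a time. The extra factor `θ` avoids the exponent `s.card - 1`. -/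
theorem mul_abs_prod_sub_prod_le {ι : Type*} (s : Finset ι) {A B : ι → ℝ} {θ D : ℝ}
    (hA : ∀ i, 0 ≤ A i ∧ A i ≤ θ) (hB : ∀ i, 0 ≤ B i ∧ B i ≤ θ) (hD : ∀ i, |A i - B i| ≤ D) :
    θ * |∏ i ∈ s, A i - ∏ i ∈ s, B i| ≤ s.card * D * θ ^ s.card := by
  classical
  induction s using Finset.induction_on with
  | empty => simp
  | insert i s hi ih =>
    have hθ : 0 ≤ θ := (hA i).1.trans (hA i).2
    have hD0 : 0 ≤ D := (abs_nonneg _).trans (hD i)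
    rw [Finset.prod_insert hi, Finset.prod_insert hi, Finset.card_insert_of_notMem hi]
    have h1 : A i * ∏ i ∈ s, A i - B i * ∏ i ∈ s, B i =
        (A i - B i) * ∏ i ∈ s, A i + B i * (∏ i ∈ s, A i - ∏ i ∈ s, B i) := by ring
    have h2 : |∏ i ∈ s, A i| ≤ θ ^ s.card := by
      rw [Finset.abs_prod, ← Finset.prod_const]
      exact Finset.prod_le_prod (fun _ _ => abs_nonneg _) fun i _ => by
        rw [abs_of_nonneg (hA i).1]; exact (hA i).2
    have h3 : |A i * ∏ i ∈ s, A i - B i * ∏ i ∈ s, B i| ≤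
        D * θ ^ s.card + θ * |∏ i ∈ s, A i - ∏ i ∈ s, B i| := by
      rw [h1]
      refine (abs_add_le _ _).trans ?_
      rw [abs_mul, abs_mul, abs_of_nonneg (hB i).1]
      exact add_le_add (mul_le_mul (hD i) h2 (abs_nonneg _) hD0)
        (mul_le_mul_of_nonneg_right (hB i).2 (abs_nonneg _))
    calc _ ≤ θ * (D * θ ^ s.card + θ * |∏ i ∈ s, A i - ∏ i ∈ s, B i|) :=
          mul_le_mul_of_nonneg_left h3 hθ
      _ ≤ θ * (D * θ ^ s.card + s.card * D * θ ^ s.card) := by gcongr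
      _ = _ := by push_cast; ring

/-- Of the `m - 1` remaining factors, one is bounded by `S` and the others by `1`; at least one
exists because `2 ≤ m`. -/
theorem abs_prod_sub_prod_le {m : ℕ} (hm : 2 ≤ m) {A B : Fin m → ℝ} {S D : ℝ}
    (hA : ∀ i, 0 ≤ A i ∧ A i ≤ min 1 S) (hB : ∀ i, 0 ≤ B i ∧ B i ≤ min 1 S)
    (hD : ∀ i, |A i - B i| ≤ D) : |∏ i, A i - ∏ i, B i| ≤ m * D * S := by
  have i0 : Fin m := ⟨0, by omega⟩
  set θ := min 1 S
  have hθ : 0 ≤ θ := (hA i0).1.trans (hA i0).2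
  have hD0 : 0 ≤ D := (abs_nonneg _).trans (hD i0)
  have hθS : θ ≤ S := min_le_right _ _
  rcases hθ.eq_or_lt with h0 | h0
  -- When `θ = 0` all factors vanish; this case is separate because `θ` is cancelled afterwards.
  · have : A = B := funext fun i => by
      have := hA i; have := hB i
      linarith
    rw [this, sub_self, abs_zero]
    have := hθ.trans hθS
    positivity
  · have h1 := mul_abs_prod_sub_prod_le Finset.univ hA hB hD
    rw [Finset.card_univ, Fintype.card_fin] at h1
    obtain ⟨n, rfl⟩ : ∃ n, m = n + 2 := ⟨m - 2, by omega⟩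
    have h2 : θ ^ (n + 2) ≤ θ * S := by
      rw [show n + 2 = 1 + 1 + n by ring, pow_add, pow_add, pow_one]
      calc θ * θ * θ ^ n ≤ θ * S * 1 := by
            have : θ ^ n ≤ 1 := pow_le_one₀ hθ (min_le_left _ _)
            have : 0 ≤ S := hθ.trans hθS
            gcongr
        _ = _ := mul_one _
    refine le_of_mul_le_mul_left (h1.trans ?_) h0
    calc _ ≤ ((n + 2 : ℕ) : ℝ) * D * (θ * S) := by gcongr
      _ = _ := by ring

/-! ### Comparison of the data at close configurations -/

theorem exists_wall_point {x y : Space d} (hx : 0 ≤ x 0) (hy : y 0 ≤ 0) :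
    ∃ q : Space d, q 0 = 0 ∧ ‖y - q‖ + ‖q - x‖ = ‖y - x‖ := by
  obtain ⟨s, hs0, hs1, hs⟩ : ∃ s : ℝ, 0 ≤ s ∧ s ≤ 1 ∧ (1 - s) * y 0 + s * x 0 = 0 := by
    rcases (sub_nonneg.2 (hy.trans hx)).eq_or_lt with h | h
    · exact ⟨0, le_rfl, zero_le_one, by linarith⟩
    · refine ⟨-y 0 / (x 0 - y 0), div_nonneg (by linarith) h.le, ?_, ?_⟩
      · rw [div_le_one h]; linarith
      · field_simp; ring
  refine ⟨(1 - s) • y + s • x, by simpa using hs, ?_⟩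
  have e1 : y - ((1 - s) • y + s • x) = s • (y - x) := by module
  have e2 : (1 - s) • y + s • x - x = (1 - s) • (y - x) := by module
  rw [e1, e2, norm_smul, norm_smul, Real.norm_eq_abs, Real.norm_eq_abs, abs_of_nonneg hs0,
    abs_of_nonneg (by linarith)]
  ring

/-- In the reflected case, the segment from `w` to the mirror image of `z` crosses the wall at `q`.
The specular condition exchanges the two velocities at `q`, and unfolding the second piece gives a
path from `w` to `z` of total length at most `r`. -/
theorem abs_sqrt_sub_sqrt_le_of_near {β : ℝ} {f₀ : Particle d → ℝ} (hX : MemX β f₀)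
    (hs : SqrtLipschitz f₀) {r : ℝ} {z w : Particle d} (hz : z ∈ closedPhase d)
    (hw : w ∈ closedPhase d) (h : NearUpToReflection r z w) :
    |Real.sqrt (f₀ z) - Real.sqrt (f₀ w)| ≤ (gradSqrtNorm f₀).toReal * r := by
  obtain ⟨x, v⟩ := z
  obtain ⟨y, u⟩ := w
  have hx : 0 ≤ x 0 := hz
  have hy : 0 ≤ y 0 := hw
  have hL : 0 ≤ (gradSqrtNorm f₀).toReal := ENNReal.toReal_nonneg
  rcases h with ⟨hu, hr⟩ | ⟨hu, hr⟩
  · simp only at hu hr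
    subst hu
    refine (abs_sqrt_sub_sqrt_le hX hs u hy hx).trans ?_
    rw [norm_sub_rev]
    exact mul_le_mul_of_nonneg_left hr hL
  · simp only at hu hr
    subst hu
    obtain ⟨q, hq, hlen⟩ := exists_wall_point hy (y := reflect x)
      (by rw [reflect_apply_zero]; linarith)
    have h1 := abs_sqrt_sub_sqrt_le hX hs v hq.ge hx
    have h2 := abs_sqrt_sub_sqrt_le hX hs (reflect v) hy hq.ge
    rw [← hX.boundary q v hq] at h2
    rw [← norm_reflect_sub_reflect, reflect_of_coord_eq_zero hq] at h1
    refine (abs_sub_le _ (Real.sqrt (f₀ (q, v))) _).trans ((add_le_add h1 h2).trans ?_)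
    rw [← mul_add, hlen, norm_sub_rev]
    exact mul_le_mul_of_nonneg_left hr hL

/-- Constant in the comparison of the data along two close configurations. -/
noncomputable def dataConst (μ₀ : ℝ) (m : ℕ) : ℝ := 2 * m * Real.exp ((m + 1) * |μ₀|)

/-- Factor `f₀` as a normalized density times the weight `w`, which is the same for both
configurations since speeds agree. The identity `x² - y² = (x - y)(x + y)` on square roots gives the
Lipschitz gain at the price of `w ^ (-1/2)` for one particle, leaving the Gaussian exponent `β₀ /
8`. -/
theorem abs_tensor_sub_tensor_le {β₀ μ₀ : ℝ} (hβ : 0 ≤ β₀) {f₀ : Particle d → ℝ}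
    (hX : MemX β₀ f₀) (hpos : ∀ z ∈ closedPhase d, 0 ≤ f₀ z) (hs : SqrtLipschitz f₀)
    (hS : seqNorm (β₀ / 2) μ₀ (tensor f₀) ≠ ∞) {m : ℕ} (hm : 2 ≤ m) {r : ℝ} (hr : 0 ≤ r)
    {Z W : Config d m} (hZ : ∀ i, Z i ∈ closedPhase d) (hW : ∀ i, W i ∈ closedPhase d)
    (h : ∀ i, NearUpToReflection r (Z i) (W i)) :
    |tensor f₀ m Z - tensor f₀ m W| ≤ dataConst μ₀ m * r * (gradSqrtNorm f₀).toReal *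
      (seqNorm (β₀ / 2) μ₀ (tensor f₀)).toReal * Real.exp (-(β₀ / 8) * energy Z) := by
  set L := (gradSqrtNorm f₀).toReal with hLdef
  set S := (seqNorm (β₀ / 2) μ₀ (tensor f₀)).toReal with hSdef
  have hL : 0 ≤ L := ENNReal.toReal_nonneg
  have hS0 : 0 ≤ S := ENNReal.toReal_nonneg
  set w : Fin m → ℝ := fun i => Real.exp (-(β₀ / 4 * ‖(Z i).2‖ ^ 2) - μ₀) with hw
  have hq : ∀ z, f₀ z = normalizedData β₀ μ₀ f₀ z *
      Real.exp (-(β₀ / 4 * ‖z.2‖ ^ 2) - μ₀) := by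
    intro z
    rw [normalizedData, mul_assoc, mul_assoc, ← Real.exp_add, ← Real.exp_add]
    ring_nf
    simp
  have hqZ : ∀ i, f₀ (Z i) = normalizedData β₀ μ₀ f₀ (Z i) * w i := fun i => hq _
  have hqW : ∀ i, f₀ (W i) = normalizedData β₀ μ₀ f₀ (W i) * w i := fun i => by
    rw [hq (W i), (h i).norm_snd]
  have hq0 : ∀ z ∈ closedPhase d, 0 ≤ normalizedData β₀ μ₀ f₀ z := fun z hz =>
    mul_nonneg (mul_nonneg (hpos z hz) (Real.exp_pos _).le) (Real.exp_pos _).le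
  have hq1 := fun z hz => normalizedData_le_min (μ₀ := μ₀) (β₀ := β₀) hpos hS (z := z) hz
  have hE : ∀ i, ‖(Z i).2‖ ^ 2 ≤ energy Z := fun i =>
    Finset.single_le_sum (f := fun i => ‖(Z i).2‖ ^ 2) (fun _ _ => sq_nonneg _) (Finset.mem_univ i)
  have hD : ∀ i, |normalizedData β₀ μ₀ f₀ (Z i) - normalizedData β₀ μ₀ f₀ (W i)| ≤
      2 * (L * r) * Real.exp (|μ₀| + β₀ / 8 * energy Z) := by
    intro i
    have hwpos : 0 < w i := Real.exp_pos _
    have h1 := abs_sqrt_sub_sqrt_le_of_near hX hs (hZ i) (hW i) (h i)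
    have hsq : ∀ z ∈ closedPhase d, f₀ z = normalizedData β₀ μ₀ f₀ z * w i →
        Real.sqrt (f₀ z) ≤ Real.sqrt (w i) := fun z hz he => by
      rw [he]
      exact Real.sqrt_le_sqrt (mul_le_of_le_one_left hwpos.le
        ((hq1 z hz).trans (min_le_left _ _)))
    have h2 := hsq _ (hZ i) (hqZ i)
    have h3 := hsq _ (hW i) (hqW i)
    have h4 : |f₀ (Z i) - f₀ (W i)| ≤ (L * r) * (2 * Real.sqrt (w i)) := by
      have : f₀ (Z i) - f₀ (W i) = (Real.sqrt (f₀ (Z i)) - Real.sqrt (f₀ (W i))) *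
          (Real.sqrt (f₀ (Z i)) + Real.sqrt (f₀ (W i))) := by
        nth_rewrite 1 [← Real.sq_sqrt (hpos _ (hZ i)), ← Real.sq_sqrt (hpos _ (hW i))]
        ring
      rw [this, abs_mul]
      refine mul_le_mul h1 ?_ (abs_nonneg _) (by positivity)
      rw [abs_of_nonneg (by positivity)]
      linarith
    have h5 : |f₀ (Z i) - f₀ (W i)| =
        |normalizedData β₀ μ₀ f₀ (Z i) - normalizedData β₀ μ₀ f₀ (W i)| * w i := by
      rw [hqZ i, hqW i, ← sub_mul, abs_mul, abs_of_pos hwpos]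
    have h6 : Real.sqrt (w i) ≤ Real.exp (|μ₀| + β₀ / 8 * energy Z) * w i := by
      rw [hw, Real.sqrt_eq_rpow, ← Real.exp_mul, ← Real.exp_add]
      refine Real.exp_le_exp.2 ?_
      have := mul_le_mul_of_nonneg_left (hE i) (by positivity : 0 ≤ β₀ / 8)
      have := le_abs_self μ₀
      have := abs_nonneg μ₀
      linarith
    rw [h5] at h4
    refine le_of_mul_le_mul_right (h4.trans ?_) hwpos
    calc _ = 2 * (L * r) * Real.sqrt (w i) := by ring
      _ ≤ 2 * (L * r) * (Real.exp (|μ₀| + β₀ / 8 * energy Z) * w i) := by gcongr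
      _ = _ := by ring
  have hmain := abs_prod_sub_prod_le hm (fun i => ⟨hq0 _ (hZ i), hq1 _ (hZ i)⟩)
    (fun i => ⟨hq0 _ (hW i), hq1 _ (hW i)⟩) hD
  have hprod : |tensor f₀ m Z - tensor f₀ m W| =
      |∏ i, normalizedData β₀ μ₀ f₀ (Z i) - ∏ i, normalizedData β₀ μ₀ f₀ (W i)| * ∏ i, w i := by
    have hwp : 0 < ∏ i, w i := Finset.prod_pos fun i _ => Real.exp_pos _
    rw [← abs_of_pos hwp, ← abs_mul, sub_mul, ← Finset.prod_mul_distrib, ← Finset.prod_mul_distrib]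
    simp only [tensor, hqZ, hqW]
  have hwprod : ∏ i, w i = Real.exp (-(β₀ / 4) * energy Z - m * μ₀) := by
    rw [hw, ← Real.exp_sum, energy, Finset.sum_sub_distrib, Finset.mul_sum]
    simp
  rw [hprod, hwprod]
  refine (mul_le_mul_of_nonneg_right hmain (Real.exp_pos _).le).trans ?_
  have hexp : Real.exp (|μ₀| + β₀ / 8 * energy Z) * Real.exp (-(β₀ / 4) * energy Z - m * μ₀) ≤
      Real.exp ((m + 1) * |μ₀|) * Real.exp (-(β₀ / 8) * energy Z) := by
    rw [← Real.exp_add, ← Real.exp_add]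
    refine Real.exp_le_exp.2 ?_
    have := mul_le_mul_of_nonneg_left (neg_abs_le μ₀) (Nat.cast_nonneg (α := ℝ) m)
    linarith
  calc _ = 2 * m * (r * L * S) * (Real.exp (|μ₀| + β₀ / 8 * energy Z) *
        Real.exp (-(β₀ / 4) * energy Z - m * μ₀)) := by ring
    _ ≤ 2 * m * (r * L * S) * (Real.exp ((m + 1) * |μ₀|) *
        Real.exp (-(β₀ / 8) * energy Z)) := by gcongr
    _ = _ := by unfold dataConst; ring

theorem energy_eq_of_near {r : ℝ} {m : ℕ} {Z W : Config d m}
    (h : ∀ i, NearUpToReflection r (Z i) (W i)) : energy W = energy Z :=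
  Finset.sum_congr rfl fun i _ => by rw [(h i).norm_snd]

theorem abs_cutTensor_sub_le {f : Particle d → ℝ} {R r : ℝ} {m : ℕ} {Z W : Config d m} {C : ℝ}
    (hC : |tensor f m Z - tensor f m W| ≤ C) (h : ∀ i, NearUpToReflection r (Z i) (W i)) :
    |cutTensor f R m Z - cutTensor f R m W| ≤ C := by
  have hv : velNorm W = velNorm Z := by rw [velNorm_eq, velNorm_eq, energy_eq_of_near h]
  unfold cutTensor
  rw [hv]
  split_ifs
  · exact hC
  · simpa using (abs_nonneg _).trans hC

/-! ### Comparison of the two terms -/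

theorem boltzmannTerm_congr {δ : ℝ} (U : TimeFamily d) (E : ParamFamily d)
    {g g' : (m : ℕ) → Config d m → ℝ}
    (hg : ∀ m Z, (∀ i, Z i ∈ closedPhase d) → g m Z = g' m Z) (k : ℕ) {m : ℕ} (M : Fin k → ℤˣ)
    (J : Labels m k) (t : ℝ) (Z : Config d m) :
    pseudoTerm (fun _ => freeBack) 0 δ U E g k M J t Z Z =
      pseudoTerm (fun _ => freeBack) 0 δ U E g' k M J t Z Z := by
  induction k generalizing m t with
  | zero => exact hg m _ fun i => freeBackParticle_mem_closedPhase _ _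
  | succ k ih => simp only [pseudoTerm, stepIntegral, stepIntegrand, ih]

/-- Wherever the integrand is nonzero, the hard sphere configuration stays good through each
adjunction, so its flow is the explicit one. The hybrid term thereby becomes an iterated integral of
measurable functions. -/
theorem hybrid_pseudoTerm_eq {R δ ε a ε₀ ρ α : ℝ} (hε : 0 < ε) (hδ : 0 ≤ δ) (haρ : a < ρ)
    {U : TimeFamily d} {E : ParamFamily d}
    (hUE : IsPathologicalFamily R δ ε a ε₀ ρ α U E) (hR : 0 ≤ R) {g g' : (m : ℕ) → Config d m → ℝ}
    (hg : ∀ m Z, (∀ i, Z i ∈ closedPhase d) → g m Z = g' m Z)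
    (hg0 : ∀ m Z, R ^ 2 < energy Z → g m Z = 0) (hg0' : ∀ m Z, R ^ 2 < energy Z → g' m Z = 0)
    (k : ℕ) {m : ℕ} (M : Fin k → ℤˣ) (J : Labels m k) {t r : ℝ} (ht : 0 ≤ t)
    (hr : r + 2 * k * ε ≤ a) {Z W : Config d m} (h : GoodPair ε δ ε₀ r Z W) :
    pseudoTerm (fun _ => hardBack ε) ε δ U E g k M J t Z W =
      pseudoTerm (fun _ => shiftFree ε) ε δ U E g' k M J t Z W := by
  induction k generalizing m t r with
  | zero =>
    simp only [pseudoTerm]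
    rw [hardBack_eq_shiftFree h.hard ht]
    refine hg m _ fun i => ?_
    exact (by positivity : 0 ≤ ε / 2).trans (le_coord_shiftFreeParticle ε t (W i))
  | succ k ih =>
    push_cast at hr
    have hkε : 0 ≤ k * ε := by positivity
    simp only [pseudoTerm]
    split_ifs with hkt
    · have hlo : (0 : ℝ) ≤ k * δ := by positivity
      refine stepIntegral_congr (by linarith) ?_
      -- `ae_open` concerns elapsed times `τ = t - t₁`; the reflection `t₁ ↦ t - t₁` preserves null
      -- sets.
      filter_upwards [(Measure.measurePreserving_sub_left volume t).quasiMeasurePreserving.ae h.ae_open]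
        with t₁ hopen ht₁ hU p
      have hτ : δ ≤ t - t₁ := by linarith [ht₁.2]
      have ht₁0 : 0 ≤ t₁ := hlo.trans ht₁.1.le
      simp only [stepIntegrand]
      rw [hardBack_eq_shiftFree h.hard (hδ.trans hτ)]
      by_cases hp : p ∈ (E m J.head (freeBack (t - t₁) Z))ᶜ
      · rw [Set.indicator_of_mem hp, Set.indicator_of_mem hp]
        by_cases hfl : signedPart (M 0) (flux J.head p (shiftFree ε (t - t₁) W)) = 0
        · rw [hfl]; ring
        congr 1
        by_cases hpR : ‖p.2‖ ≤ R
        · have hfar := le_coord_of_notMem hUE ⟨ht₁0, by linarith⟩ hU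
          have hv := velocity_eq_of_far hε.le h.near (by linarith : r + ε < ρ) hfar
          refine ih _ _ ht₁0 (r := r + 2 * ε) (by linarith) ?_
          refine h.adjoin hε.le hδ (by linarith) haρ hUE ⟨ht₁0, ht₁.2⟩ hU (hopen hτ) hp hpR ?_
          rwa [flux, ← hv]
        · have hE : R ^ 2 < energy (adjoin ε (M 0) J.head p (shiftFree ε (t - t₁) W)) := by
            rw [energy_adjoin]
            have := pow_lt_pow_left₀ (not_le.1 hpR) hR two_ne_zero
            linarith [energy_nonneg (shiftFree ε (t - t₁) W)]
          rw [pseudoTerm_eq_zero hδ U E (fun m τ Z hτ => energy_hardBack hε hτ Z) hg0 k _ _ ht₁0 _ hE,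
            pseudoTerm_eq_zero hδ U E (fun m τ Z hτ => energy_shiftFree ε τ Z) hg0' k _ _ ht₁0 _ hE]
      · rw [Set.indicator_of_notMem hp, Set.indicator_of_notMem hp]
    · rfl

/-- The kernels cancel exactly, so the recursion carries only the difference of data at the leaves.
The gap grows by `2 * ε` per adjunction, and the last free stretch adds one `ε`; `r'` dominates the
total. -/
theorem abs_pseudoTerm_sub_le {R δ ε a ε₀ ρ α b r' : ℝ} (hε : 0 < ε) (hδ : 0 ≤ δ) (hb : 0 < b)
    (haρ : a < ρ) {U : TimeFamily d} {E : ParamFamily d}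
    (hUE : IsPathologicalFamily R δ ε a ε₀ ρ α U E) (hR : 0 ≤ R) {g : (m : ℕ) → Config d m → ℝ}
    (hgm : ∀ m, Measurable (g m)) (hg0 : ∀ m Z, R ^ 2 < energy Z → g m Z = 0) {A B : ℕ → ℝ}
    (hA : ∀ m, 0 ≤ A m) (hB : ∀ m, 0 ≤ B m)
    (hgB : ∀ m Z, |g m Z| ≤ B m * Real.exp (-b * energy Z))
    (hgA : ∀ m, 2 ≤ m → ∀ Z W : Config d m, (∀ i, Z i ∈ closedPhase d) →
      (∀ i, W i ∈ closedPhase d) → (∀ i, NearUpToReflection r' (Z i) (W i)) →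
      |g m Z - g m W| ≤ A m * Real.exp (-b * energy Z))
    (k : ℕ) {m : ℕ} (hmk : 2 ≤ m + k) (M : Fin k → ℤˣ) (J : Labels m k) {t r : ℝ} (ht : 0 ≤ t)
    (hr : r + 2 * k * ε ≤ a) (hr' : r + 2 * k * ε + ε ≤ r') {Z W : Config d m}
    (h : GoodPair ε δ ε₀ r Z W) :
    |pseudoTerm (fun _ => freeBack) 0 δ U E g k M J t Z Z -
      pseudoTerm (fun _ => shiftFree ε) ε δ U E g k M J t Z W| ≤
      A (m + k) * chainConst d b k * t ^ k * Real.exp (-(b / 2 ^ k) * energy Z) := by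
  induction k generalizing m t r with
  | zero =>
    simp only [pseudoTerm]
    have := hgA m (by simpa using hmk) (freeBack t Z) (shiftFree ε t W)
      (fun i => freeBackParticle_mem_closedPhase _ _)
      (fun i => (by positivity : 0 ≤ ε / 2).trans (le_coord_shiftFreeParticle ε t (W i)))
      (fun i => (near_flow hε.le h.near t i).mono (by simpa using hr'))
    rw [energy_freeBack] at this
    simpa [chainConst] using this
  | succ k ih =>
    push_cast at hr hr'
    have hkε : 0 ≤ k * ε := by positivity
    have hAm := hA (m + (k + 1))
    have hBm := hB (m + (k + 1))
    have hQ := chainConst_nonneg (d := d) hb k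
    have hQ' := chainConst_nonneg (d := d) hb (k + 1)
    have he : energy W = energy Z := h.energy_eq
    simp only [pseudoTerm]
    split_ifs with hkt
    · have hlo : (0 : ℝ) ≤ k * δ := by positivity
      have hH : ∀ {Φ : (m : ℕ) → ℝ → Config d m → Config d m} {r : ℝ},
          (∀ m τ Z, 0 ≤ τ → energy (Φ m τ Z) = energy Z) →
          ∀ t₁ ∈ Ioc (k * δ) (t - δ), ∀ Z' W',
          |pseudoTerm Φ r δ U E g k (fun l => M l.succ) J.tail t₁ Z' W'| ≤
            B (m + (k + 1)) * chainConst d b k * t ^ k * Real.exp (-(b / 2 ^ k) * energy W') := by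
        intro Φ r hΦ t₁ ht₁ Z' W'
        have h0 : 0 ≤ t₁ := hlo.trans ht₁.1.le
        refine (abs_pseudoTerm_le hb hδ U E hΦ hB hgB k _ _ h0 Z' W').trans ?_
        rw [show m + 1 + k = m + (k + 1) by ring]
        gcongr
        linarith [ht₁.2]
      have hfree : ∀ m τ (Z : Config d m), 0 ≤ τ → energy (freeBack τ Z) = energy Z :=
        fun m τ Z _ => energy_freeBack τ Z
      have hshift : ∀ m τ (Z : Config d m), 0 ≤ τ → energy (shiftFree ε τ Z) = energy Z :=
        fun m τ Z _ => energy_shiftFree ε τ Z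
      refine (abs_stepIntegral_sub_le (b := b / 2 ^ k) (e := energy Z)
        (A := A (m + (k + 1)) * chainConst d b k * t ^ k)
        (B := B (m + (k + 1)) * chainConst d b k * t ^ k) (by positivity) (by positivity)
        (by positivity) hlo hδ measurable_freeBack (measurable_shiftFree ε) (M 0) J.head
        (hUE.measurable_times m _) (hUE.measurable_params m _)
        (measurable_pseudoTerm (fun _ => measurable_freeBack) 0 δ hUE.measurable_times
          hUE.measurable_params hgm k _ _)
        (measurable_pseudoTerm (fun _ => measurable_shiftFree ε) ε δ hUE.measurable_times
          hUE.measurable_params hgm k _ _) (by linarith) (fun τ hτ => hfree m τ Z hτ)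
        (fun τ hτ => (hshift m τ W hτ).trans he) (hH hfree) (hH hshift) ?_).trans_eq ?_
      · filter_upwards [(Measure.measurePreserving_sub_left volume t).quasiMeasurePreserving.ae h.ae_open]
          with t₁ hopen ht₁ hU p
        have hτ : δ ≤ t - t₁ := by linarith [ht₁.2]
        have ht₁0 : 0 ≤ t₁ := hlo.trans ht₁.1.le
        have hmaj : 0 ≤ stepMajorant (b / 2 ^ k) (A (m + (k + 1)) * chainConst d b k * t ^ k)
          (energy Z) p := stepMajorant_nonneg (by positivity) p
        simp only [stepIntegrand]
        by_cases hp : p ∈ (E m J.head (freeBack (t - t₁) Z))ᶜ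
        · rw [Set.indicator_of_mem hp, Set.indicator_of_mem hp]
          have hfar := le_coord_of_notMem hUE ⟨ht₁0, by linarith⟩ hU
          have hv := velocity_eq_of_far hε.le h.near (by linarith : r + ε < ρ) hfar
          -- The time truncation keeps particle `j` at distance at least `ρ > r + ε` from the wall,
          -- so its two velocities are identical and no error arises from the kernel.
          have hflux : flux J.head p (shiftFree ε (t - t₁) W) =
            flux J.head p (freeBack (t - t₁) Z) := by rw [flux, flux, hv]
          rw [hflux, ← mul_sub]
          by_cases hfl : signedPart (M 0) (flux J.head p (freeBack (t - t₁) Z)) = 0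
          · rw [hfl, mul_zero, zero_mul, abs_zero]; exact hmaj
          refine abs_kernel_mul_le (M 0) J.head p (hfree m _ Z (hδ.trans hτ)) ?_
          by_cases hpR : ‖p.2‖ ≤ R
          · refine (ih (by omega) _ _ ht₁0 (r := r + 2 * ε) (by linarith) (by linarith)
              (h.adjoin hε.le hδ (by linarith) haρ hUE ⟨ht₁0, ht₁.2⟩ hU (hopen hτ) hp hpR
                hfl)).trans ?_
            rw [energy_adjoin, energy_freeBack, show m + 1 + k = m + (k + 1) by ring]
            gcongr
            linarith
          · have hEn : ∀ {r : ℝ} (Z : Config d m), R ^ 2 < energy (adjoin r (M 0) J.head p Z) := by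
              intro r Z
              rw [energy_adjoin]
              have := pow_lt_pow_left₀ (not_le.1 hpR) hR two_ne_zero
              linarith [energy_nonneg Z]
            rw [pseudoTerm_eq_zero hδ U E hfree hg0 k _ _ ht₁0 _ (hEn _),
              pseudoTerm_eq_zero hδ U E hshift hg0 k _ _ ht₁0 _ (hEn _), sub_zero, abs_zero]
            positivity
        · rw [Set.indicator_of_notMem hp, Set.indicator_of_notMem hp, sub_zero, abs_zero]
          exact hmaj
      · rw [chainConst, pow_succ (2 : ℝ) k, div_div]; ring
    · rw [sub_zero, abs_zero]; positivity


/-! ### Nondegeneracy of the gradient and bounds on the elementary terms -/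

/-- With zero gradient the data would be constant along `e1` and vanish at infinity, hence be zero,
against unit mass. This excludes the product `0 * ∞ = 0`, for which the bound would not be void when
the norm of the data is infinite. -/
theorem gradSqrtNorm_ne_zero {β : ℝ} {f₀ : Particle d → ℝ} (hX : MemX β f₀)
    (hpos : ∀ z ∈ closedPhase d, 0 ≤ f₀ z) (hint : (∫ z in closedPhase d, f₀ z) = 1)
    (hs : SqrtLipschitz f₀) : gradSqrtNorm f₀ ≠ 0 := by
  intro h0
  have hzero : ∀ z ∈ closedPhase d, f₀ z = 0 := by
    rintro ⟨x, v⟩ hz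
    have hx : 0 ≤ x 0 := hz
    have hmem : ∀ n : ℕ, (x + (n : ℝ) • (e1 : Space d), v) ∈ closedPhase d := fun n => by
      simp only [closedPhase, mem_ofPred_eq, PiLp.add_apply, PiLp.smul_apply, e1_apply_zero,
        smul_eq_mul, mul_one]
      positivity
    have hconst : ∀ n : ℕ, f₀ (x + (n : ℝ) • (e1 : Space d), v) = f₀ (x, v) := fun n => by
      have h1 := abs_sqrt_sub_sqrt_le hX hs v hx (hmem n)
      rw [h0, ENNReal.toReal_zero, zero_mul] at h1
      have h2 := sub_eq_zero.1 (abs_nonpos_iff.1 h1)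
      exact (Real.sqrt_inj (hpos _ (hmem n)) (hpos _ hz)).1 h2
    have hlim : Tendsto (fun n : ℕ => (x + (n : ℝ) • (e1 : Space d), v)) atTop
        (cocompact (Particle d) ⊓ 𝓟 (closedPhase d)) := by
      refine tendsto_inf.2 ⟨?_, tendsto_principal.2 (Eventually.of_forall hmem)⟩
      rw [← Metric.cobounded_eq_cocompact, ← tendsto_norm_atTop_iff_cobounded]
      refine tendsto_atTop_mono (fun n : ℕ => ?_) tendsto_natCast_atTop_atTop
      have h1 := (abs_coord_le_norm (x + (n : ℝ) • (e1 : Space d))).trans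
        (norm_fst_le (x + (n : ℝ) • (e1 : Space d), v))
      refine le_trans ?_ h1
      simp only [PiLp.add_apply, PiLp.smul_apply, e1_apply_zero, smul_eq_mul, mul_one]
      exact le_trans (by linarith) (le_abs_self _)
    have h1 := hX.vanishing.comp hlim
    have h2 : f₀ ∘ (fun n : ℕ => (x + (n : ℝ) • (e1 : Space d), v)) = fun _ => f₀ (x, v) :=
      funext hconst
    rw [h2] at h1
    exact tendsto_nhds_unique tendsto_const_nhds h1
  rw [setIntegral_congr_fun measurableSet_closedPhase hzero] at hint
  simp at hint

/-- The sum over the numbers and types of adjunctions of the constants bounding the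
corresponding terms. -/
noncomputable def totalConst (d s n : ℕ) (β₀ μ₀ : ℝ) : ℝ :=
  ∑ k ∈ Finset.Icc 1 n, ∑ _M : Fin k → ℤˣ, ∑ _J : Labels s k,
    dataConst μ₀ (s + k) * (3 * n) * chainConst d (β₀ / 8) k

theorem dataConst_nonneg (μ₀ : ℝ) (m : ℕ) : 0 ≤ dataConst μ₀ m := by
  unfold dataConst; positivity

theorem totalConst_nonneg {d s n : ℕ} {β₀ μ₀ : ℝ} (hβ : 0 < β₀) : 0 ≤ totalConst d s n β₀ μ₀ := by
  refine Finset.sum_nonneg fun k _ => Finset.sum_nonneg fun _ _ => Finset.sum_nonneg fun _ _ => ?_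
  have := dataConst_nonneg μ₀ (s + k)
  have := chainConst_nonneg (d := d) (b := β₀ / 8) (by positivity) k
  positivity

theorem abs_boltzmannTerm_sub_hybridTerm_le {β₀ μ₀ : ℝ} (hβ : 0 < β₀) {f₀ : Particle d → ℝ}
    (hX : MemX β₀ f₀) (hpos : ∀ z ∈ closedPhase d, 0 ≤ f₀ z) (hs : SqrtLipschitz f₀)
    (hS : seqNorm (β₀ / 2) μ₀ (tensor f₀) ≠ ∞) {s n k : ℕ} (hsk : 2 ≤ s + k) (hk1 : 1 ≤ k)
    (hkn : k ≤ n) {R δ ε a ε₀ ρ α : ℝ} (hR : 0 ≤ R) (hδ : 0 ≤ δ) (hε : 0 < ε) (haρ : a < ρ)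
    (hna : 2 * n * ε ≤ a) {U : TimeFamily d} {E : ParamFamily d}
    (hUE : IsPathologicalFamily R δ ε a ε₀ ρ α U E) {t : ℝ} (ht : 0 ≤ t) (ht1 : t ≤ 1)
    {Z : Config d s} (hZ : GoodPair ε δ ε₀ 0 Z Z) (M : Fin k → ℤˣ) (J : Labels s k) :
    |boltzmannTerm δ U E (cutTensor f₀ R) k M J t Z -
      hybridTerm ε δ U E (cutTensor f₀ R) k M J t Z| ≤
      dataConst μ₀ (s + k) * (3 * n) * chainConst d (β₀ / 8) k *
        (t * ε * (gradSqrtNorm f₀).toReal * (seqNorm (β₀ / 2) μ₀ (tensor f₀)).toReal) := by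
  obtain ⟨N, hN, hNf⟩ := exists_gaussian_bound hX
  set L := (gradSqrtNorm f₀).toReal with hLdef
  set S := (seqNorm (β₀ / 2) μ₀ (tensor f₀)).toReal with hSdef
  have hL : 0 ≤ L := ENNReal.toReal_nonneg
  have hS0 : 0 ≤ S := ENNReal.toReal_nonneg
  have hb : 0 < β₀ / 8 := by positivity
  have hkn' : (k : ℝ) ≤ n := by exact_mod_cast hkn
  have hn1 : (1 : ℝ) ≤ n := by exact_mod_cast hk1.trans hkn
  have hkε : 2 * k * ε ≤ 2 * n * ε := by gcongr
  have hnε : ε ≤ n * ε := le_mul_of_one_le_left hε.le hn1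
  have hC := dataConst_nonneg μ₀ (s + k)
  have hQ := chainConst_nonneg (d := d) hb k
  have hcut : ∀ m (Z : Config d m), (∀ i, Z i ∈ closedPhase d) →
      cutTensor f₀ R m Z = cutTensor (extendZero f₀) R m Z :=
    fun m Z hZ => (cutTensor_extendZero hZ).symm
  rw [hybridTerm, boltzmannTerm_eq_pseudoTerm, hybridTermAux_eq_pseudoTerm,
    boltzmannTerm_congr U E hcut, hybrid_pseudoTerm_eq hε hδ haρ hUE hR hcut
      (fun m Z => cutTensor_eq_zero hR) (fun m Z => cutTensor_eq_zero hR) k M J ht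
      (by linarith) hZ]
  -- Starting from a zero gap, the final one is at most `2 * k * ε + ε ≤ 3 * n * ε`. The exponent
  -- `β₀ / 8` is the one surviving in the data comparison.
  have hmain := abs_pseudoTerm_sub_le (b := β₀ / 8) (r' := 3 * n * ε)
    (A := fun m => dataConst μ₀ m * (3 * n * ε) * L * S) (B := fun m => N ^ m) hε hδ hb haρ hUE hR
    (fun m => measurable_cutTensor (measurable_extendZero hX) R m)
    (fun m Z => cutTensor_eq_zero hR)
    (fun m => by have := dataConst_nonneg μ₀ m; positivity) (fun m => by positivity)
    (fun m Z => abs_cutTensor_le hN (fun z => (hNf z).trans (by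
      gcongr ?_ * Real.exp (?_ * _)
      linarith)) R m Z)
    (fun m hm Z W hZ hW h => by
      rw [cutTensor_extendZero hZ, cutTensor_extendZero hW]
      exact abs_cutTensor_sub_le
        (abs_tensor_sub_tensor_le hβ.le hX hpos hs hS hm (by positivity) hZ hW h) h)
    k hsk M J ht (by linarith) (by linarith) hZ
  refine hmain.trans ?_
  have hexp : Real.exp (-(β₀ / 8 / 2 ^ k) * energy Z) ≤ 1 := by
    rw [Real.exp_le_one_iff, neg_mul, neg_nonpos]
    have := energy_nonneg Z
    positivity
  -- One factor `t` is kept, available because `k ≥ 1`; it later absorbs the constants.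
  have htk : t ^ k ≤ t := pow_le_of_le_one ht ht1 (by omega)
  calc _ ≤ dataConst μ₀ (s + k) * (3 * n * ε) * L * S * chainConst d (β₀ / 8) k * t * 1 := by
        gcongr
    _ = _ := by ring

theorem goodPair_self {ε δ ε₀ : ℝ} {m : ℕ} {Z : Config d m} (hZ : ∀ i, Z i ∈ openPhase d)
    (hhard : Z ∈ goodHard d ε ε m)
    (hsep : ∀ τ i j, i ≠ j → ε₀ < ‖(freeBack τ Z i).1 - (freeBack τ Z j).1‖) :
    GoodPair ε δ ε₀ 0 Z Z where
  near i := Or.inl ⟨rfl, by simp⟩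
  closed i := by
    have h : 0 < (Z i).1 0 := hZ i
    exact h.le
  hard := hhard
  separated τ _ := hsep τ
  ae_open := by
    filter_upwards [ae_all_iff.2 fun i => ae_freeBackParticle_mem_openPhase (hZ i)] with τ hτ _
    exact hτ

end

end HalfSpaceLanford

/-! ### Choice of thresholds and of the time `T'`, and conclusion -/

open HalfSpaceLanford

theorem mainTheorem10 (d : ℕ) [NeZero d] (hd : 2 ≤ d) :
    ∃ c > (0 : ℝ), ∃ C > (0 : ℝ),
    ∀ s : ℕ, 1 ≤ s →
    -- thresholds depending only on the compact set `K`
    ∃ εbar ε₀bar αbar γbar Rbar : Set (Config d s) → ℝ,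
      (∀ K, 0 < εbar K ∧ 0 < ε₀bar K ∧ 0 < αbar K ∧ 0 < γbar K ∧ 0 < Rbar K) ∧
    ∀ n : ℕ, 1 ≤ n → ∀ β₀ μ₀ : ℝ, 0 < β₀ → ∀ T > (0 : ℝ),
    ∃ T' : ℝ, 0 < T' ∧ T' < T ∧
    ∀ f₀ : Particle d → ℝ, MemX β₀ f₀ →
      (∀ z ∈ closedPhase d, 0 ≤ f₀ z) → (∫ z in closedPhase d, f₀ z) = 1 →
      SqrtLipschitz f₀ →
    ∀ K : Set (Config d s), IsCompact K → K ⊆ convergenceDomain d s →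
    ∀ R δ ε a ε₀ ρ η α : ℝ,
      0 < R → 0 < δ → 0 < ε → 0 < a → 0 < ε₀ → 0 < ρ → 0 < η → 0 < α →
      ε ≤ εbar K → ε₀ ≤ ε₀bar K → α ≤ αbar K →
      max (16 * R * ε / ε₀) (ε₀ / δ) ≤ γbar K → Rbar K ≤ R →
      4 * Real.sqrt 3 * a ≤ ε₀ → 3 * a ≤ ρ → ε₀ ≤ η * δ → 1 ≤ R → η ≤ 1 → α ≤ c →
      2 * n * ε ≤ a →
    ∀ (U : TimeFamily d) (E : ParamFamily d), IsPathologicalFamily R δ ε a ε₀ ρ α U E →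
    ∀ t ∈ Set.Icc (0 : ℝ) T', ∀ Z ∈ K,
      ENNReal.ofReal
        |∑ k ∈ Finset.Icc 1 n, ∑ M : Fin k → ℤˣ, ∑ J : Labels s k,
          (boltzmannTerm δ U E (cutTensor f₀ R) k M J t Z -
            hybridTerm ε δ U E (cutTensor f₀ R) k M J t Z)| ≤
      ENNReal.ofReal (C * (s + n) ^ 2 * n * R * (ε / α)) * gradSqrtNorm f₀ *
        seqNorm (β₀ / 2) μ₀ (tensor f₀) := by
  refine ⟨1, one_pos, 1, one_pos, fun s hs => ?_⟩
  -- Thresholds must be functions on all sets; the value `1` serves those that are not compact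
  -- subsets of the domain.
  have hthr : ∀ K : Set (Config d s), ∃ c > 0, IsCompact K → K ⊆ convergenceDomain d s →
      ∀ Z ∈ K, (∀ τ i j, i ≠ j → c ≤ ‖(freeBack τ Z i).1 - (freeBack τ Z j).1‖) ∧
      ∀ ε, 0 < ε → ε ≤ c → Z ∈ goodHard d ε ε s := fun K => by
    by_cases h : IsCompact K ∧ K ⊆ convergenceDomain d s
    · obtain ⟨c, hc, hK⟩ := exists_good_threshold h.1 h.2
      exact ⟨c, hc, fun _ _ => hK⟩
    · exact ⟨1, one_pos, fun h1 h2 => absurd ⟨h1, h2⟩ h⟩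
  choose c hc hcK using hthr
  -- Halving `c K` turns the weak separation into the strict inequality required by `GoodPair`.
  refine ⟨c, fun K => c K / 2, fun _ => 1, fun _ => 1, fun _ => 1,
    fun K => ⟨hc K, half_pos (hc K), one_pos, one_pos, one_pos⟩, ?_⟩
  intro n hn β₀ μ₀ hβ T hT
  have hΘ := totalConst_nonneg (d := d) (s := s) (n := n) (μ₀ := μ₀) hβ
  set Θ := totalConst d s n β₀ μ₀ with hΘdef
  -- The bound `1` allows `t ^ k ≤ t`, and `1 / (Θ + 1)` ensures `Θ * t ≤ 1`. `Θ` involves neither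
  -- `f₀` nor `K`, as the quantifiers demand.
  refine ⟨min (T / 2) (min 1 (1 / (Θ + 1))), by positivity,
    (min_le_left _ _).trans_lt (by linarith), ?_⟩
  intro f₀ hX hpos hint hLip K hK hKΩ R δ ε a ε₀ ρ η α hR hδ hε ha hε₀ hρ hη hα hεK hε₀K _ _ _ _
    haρ _ hR1 _ hα1 hna U E hUE t ht Z hZK
  have hn1 : (1 : ℝ) ≤ n := by exact_mod_cast hn
  have hs1 : (1 : ℝ) ≤ s := by exact_mod_cast hs
  -- Since `α ≤ 1` and all other factors are at least `1`, an error of order `ε` is already below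
  -- the target.
  have hcoef : ε ≤ 1 * ((s : ℝ) + n) ^ 2 * n * R * (ε / α) := by
    have h1 : ε ≤ ε / α := (le_div_iff₀ hα).2 (mul_le_of_le_one_right hε.le hα1)
    have h2 : (1 : ℝ) ≤ 1 * ((s : ℝ) + n) ^ 2 * n * R := by
      have h3 : (1 : ℝ) ≤ ((s : ℝ) + n) ^ 2 := one_le_pow₀ (by linarith)
      have h4 : (1 : ℝ) ≤ ((s : ℝ) + n) ^ 2 * n := one_le_mul_of_one_le_of_one_le h3 hn1
      rw [one_mul]
      exact one_le_mul_of_one_le_of_one_le h4 hR1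
    exact h1.trans (le_mul_of_one_le_left (by positivity) h2)
  have hgrad0 := gradSqrtNorm_ne_zero hX hpos hint hLip
  have hgradtop := gradSqrtNorm_ne_top hLip
  by_cases hS : seqNorm (β₀ / 2) μ₀ (tensor f₀) = ∞
  · have h1 : ENNReal.ofReal (1 * (s + n) ^ 2 * n * R * (ε / α)) ≠ 0 :=
      (ENNReal.ofReal_pos.2 (hε.trans_le hcoef)).ne'
    rw [hS, ENNReal.mul_top (mul_ne_zero h1 hgrad0)]
    exact le_top
  rw [← ENNReal.ofReal_toReal hgradtop, ← ENNReal.ofReal_toReal hS,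
    ← ENNReal.ofReal_mul (hε.le.trans hcoef),
    ← ENNReal.ofReal_mul (mul_nonneg (hε.le.trans hcoef) ENNReal.toReal_nonneg)]
  refine ENNReal.ofReal_le_ofReal ?_
  set L := (gradSqrtNorm f₀).toReal with hLdef
  set S := (seqNorm (β₀ / 2) μ₀ (tensor f₀)).toReal with hSdef
  have hL : 0 ≤ L := ENNReal.toReal_nonneg
  have hS0 : 0 ≤ S := ENNReal.toReal_nonneg
  obtain ⟨ht0, htT⟩ := ht
  have ht1 : t ≤ 1 := htT.trans ((min_le_right _ _).trans (min_le_left _ _))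
  have htΘ : t ≤ 1 / (Θ + 1) := htT.trans ((min_le_right _ _).trans (min_le_right _ _))
  have hgood : GoodPair ε δ ε₀ 0 Z Z := by
    obtain ⟨h1, h2⟩ := hcK K hK hKΩ Z hZK
    refine goodPair_self (hKΩ hZK).1 (h2 ε hε hεK) fun τ i j hij => ?_
    have := hc K
    exact (lt_of_le_of_lt hε₀K (by linarith)).trans_le (h1 τ i j hij)
  have hterm : ∀ k ∈ Finset.Icc 1 n, ∀ (M : Fin k → ℤˣ) (J : Labels s k),
      |boltzmannTerm δ U E (cutTensor f₀ R) k M J t Z -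
        hybridTerm ε δ U E (cutTensor f₀ R) k M J t Z| ≤
      dataConst μ₀ (s + k) * (3 * n) * chainConst d (β₀ / 8) k * (t * ε * L * S) := by
    intro k hk M J
    obtain ⟨hk1, hkn⟩ := Finset.mem_Icc.1 hk
    exact abs_boltzmannTerm_sub_hybridTerm_le hβ hX hpos hLip hS (by omega) hk1 hkn hR.le hδ.le hε
      (by linarith) hna hUE ht0 ht1 hgood M J
  have hsum : |∑ k ∈ Finset.Icc 1 n, ∑ M : Fin k → ℤˣ, ∑ J : Labels s k,
      (boltzmannTerm δ U E (cutTensor f₀ R) k M J t Z -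
        hybridTerm ε δ U E (cutTensor f₀ R) k M J t Z)| ≤ Θ * (t * ε * L * S) := by
    rw [hΘdef, totalConst]
    simp only [Finset.sum_mul]
    refine (Finset.abs_sum_le_sum_abs _ _).trans (Finset.sum_le_sum fun k hk => ?_)
    refine (Finset.abs_sum_le_sum_abs _ _).trans (Finset.sum_le_sum fun M _ => ?_)
    exact (Finset.abs_sum_le_sum_abs _ _).trans (Finset.sum_le_sum fun J _ => hterm k hk M J)
  have hΘt : Θ * t ≤ 1 := by
    have := (le_div_iff₀ (by positivity)).1 htΘ
    nlinarith
  calc _ ≤ Θ * (t * ε * L * S) := hsum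
    _ = (Θ * t) * (ε * L * S) := by ring
    _ ≤ 1 * (ε * L * S) := by gcongr
    _ = ε * L * S := one_mul _
    _ ≤ _ := by gcongr
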